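/- **Conventions.** Manifolds are smooth, finite dimensional, Hausdorff, second countable and without boundary. An *exterior differential system* (EDS) on $M$ is an ideal $\mathcal I\subset\Omega^*(M)$, closed under $d$, whose homogeneous components are $\mathcal I^k=\mathcal S(I^k)$, the smooth sections of constant rank subbundles $I^k\subset\Lambda^k(T^*M)$; $\mathcal I|_U$ denotes the sections over $U$. Write $\langle\,\cdot\,\rangle_{\rm alg}$ for the algebraically generated ideal. *Integrable extension.* $\mathbf p:(\mathcal E,N)\to(\mathcal I,M)$ is an integrable extension with admissible subbundle $J\subset T^*N$ if $\mathbf p:N\to M$ is a smooth submersion, $J$ is a constant rank subbundle with $\operatorname{ann}(J)\oplus\ker\mathbf p_*=TN$, and $\mathcal E=\langle \mathcal S(J)\cup\mathbf p^*(\mathcal I)\rangle_{\rm alg}$. *Decomposable.* $\mathcal I$ is decomposable of type $[p,\rho]$, $p,\rho\ge 2$, with singular Pfaffian systems $\hat V,\check V\subset T^*M$ if each point has an open neighbourhood $U$ with a coframe $\theta^1,\dots,\theta^s,\hat\sigma^1,\dots,\hat\sigma^p,\check\sigma^1,\dots,\check\sigma^\rho$ and smooth functions $A^i_{ab},B^j_{\alpha\beta}$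 ($1\le i\le t$, $1\le j\le\tau$, $t,\tau\ge1$) such that $$\mathcal I|_U=\langle \theta^e,\ A^i_{ab}\hat\sigma^a\wedge\hat\sigma^b,\ B^j_{\alpha\beta}\check\sigma^\alpha\wedge\check\sigma^\beta\rangle_{\rm alg},\qquad \hat V|_U=\operatorname{span}\{\theta^e,\hat\sigma^a\},\quad \check V|_U=\operatorname{span}\{\theta^e,\check\sigma^\alpha\}.$$ *First integrals.* For $W\subset T^*M$, let $W^\infty_x$ be the span of all $df_x$, with $f$ a smooth function on an open neighbourhood of $x$ such that $df$ is a section of $W$. *Darboux integrable.* A decomposable $\mathcal I$ is Darboux integrable if (for its singular Pfaffian systems) $\hat V^\infty$ and $\check V^\infty$ have constant rank, $\hat V+\check V^\infty=T^*M=\check V+\hat V^\infty$, and $\hat V^\infty\cap\check V^\infty=0$ at every point. **Theorem.** Let $\mathbf p:(\mathcal E,N)\to(\mathcal I,M)$ be an integrable extension with admissible subbundle $J$. (i) If $\mathcal I$ is decomposable of type $[p,\rho]$ with singular Pfaffian systems $\hat V$ and $\check V$, then $\mathcal E$ is decomposable of type $[p,\rho]$ with singular Pfaffian systems $$\hat Z=J\oplus\mathbf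 p^*(\hat V),\qquad \check Z=J\oplus\mathbf p^*(\check V),$$ the sums being direct. (ii) Let $\mathcal I$ be Darboux integrable with respect to $\hat V,\check V$, let $(E^1)^\infty=0$, and let $\hat Z,\check Z$ be as in (i). Assume that $\hat Z^\infty$, $\check Z^\infty$ and $\hat Z^\infty\cap\check Z^\infty$ have constant rank. Then $\mathcal E$ is Darboux integrable, with singular Pfaffian systems $\hat Z,\check Z$. -/

import Mathlib

open scoped Manifold ContDiff Topology

namespace EDS

noncomputable section

/-! ### Wedge product of alternating forms -/

/-- The wedge product, with the normalization
`(α ∧ β)(u₁, …, u_{k+l}) = ∑ sign σ • α(u_{σ 1}, …) * β(u_{σ (k+1)}, …)` over `(k, l)`-shuffles. -/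
def wedgeAlt {V : Type*} [AddCommGroup V] [Module ℝ V] [TopologicalSpace V] {k l : ℕ}
    (α : V [⋀^Fin k]→L[ℝ] ℝ) (β : V [⋀^Fin l]→L[ℝ] ℝ) : V [⋀^Fin (k + l)]→ₗ[ℝ] ℝ :=
  ((LinearMap.mul' ℝ ℝ).compAlternatingMap
    (α.toAlternatingMap.domCoprod β.toAlternatingMap)).domDomCongr finSumFinEquiv

theorem continuous_wedgeAlt {V : Type*} [AddCommGroup V] [Module ℝ V] [TopologicalSpace V]
    {k l : ℕ} (α : V [⋀^Fin k]→L[ℝ] ℝ) (β : V [⋀^Fin l]→L[ℝ] ℝ) :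
    Continuous fun v => wedgeAlt α β v := by
  have h : ∀ v, wedgeAlt α β v = ∑ σ : Equiv.Perm.ModSumCongr (Fin k) (Fin l),
      LinearMap.mul' ℝ ℝ (AlternatingMap.domCoprod.summand α.toAlternatingMap β.toAlternatingMap σ
        (fun i => v (finSumFinEquiv i))) := by
    intro v
    simp [wedgeAlt, AlternatingMap.domCoprod_apply, Function.comp_def]
  simp only [h]
  refine continuous_finsetSum _ fun σ _ => ?_
  induction σ using Quotient.inductionOn' with
  | h σ =>
    simp only [AlternatingMap.domCoprod.summand_mk'']
    have e : ∀ v : Fin (k + l) → V,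
        LinearMap.mul' ℝ ℝ ((Equiv.Perm.sign σ •
          (MultilinearMap.domCoprod (α.toAlternatingMap : MultilinearMap ℝ (fun _ => V) ℝ)
            (β.toAlternatingMap : MultilinearMap ℝ (fun _ => V) ℝ)).domDomCongr σ)
              (fun i => v (finSumFinEquiv i))) =
        Equiv.Perm.sign σ • (α (fun i => v (finSumFinEquiv (σ (Sum.inl i)))) *
          β (fun i => v (finSumFinEquiv (σ (Sum.inr i))))) := by
      intro v
      rcases Int.units_eq_one_or (Equiv.Perm.sign σ) with h | h <;> simp [h]
    simp only [e]
    refine Continuous.const_smul ?_ _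
    exact (α.cont.comp (continuous_pi fun i => continuous_apply _)).mul
      (β.cont.comp (continuous_pi fun i => continuous_apply _))

/-- The wedge product as a continuous alternating map. -/
def wedge {V : Type*} [AddCommGroup V] [Module ℝ V] [TopologicalSpace V] {k l : ℕ}
    (α : V [⋀^Fin k]→L[ℝ] ℝ) (β : V [⋀^Fin l]→L[ℝ] ℝ) : V [⋀^Fin (k + l)]→L[ℝ] ℝ where
  toMultilinearMap := (wedgeAlt α β).toMultilinearMap
  cont := continuous_wedgeAlt α β
  map_eq_zero_of_eq' := (wedgeAlt α β).map_eq_zero_of_eq'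

/-! ### Differential forms on a manifold modelled on `E` -/

/-- The fibre `Λᵏ T*ₓM`. In particular `Alt E 1 x` is the cotangent space at `x`. -/
abbrev Alt (E : Type*) [NormedAddCommGroup E] [NormedSpace ℝ E] {M : Type*} [TopologicalSpace M]
    [ChartedSpace E M] (k : ℕ) (x : M) : Type _ :=
  TangentSpace 𝓘(ℝ, E) x [⋀^Fin k]→L[ℝ] ℝ

/-- A (not necessarily smooth) differential `k`-form on `M`. -/
abbrev Form (E : Type*) [NormedAddCommGroup E] [NormedSpace ℝ E] (M : Type*) [TopologicalSpace M]
    [ChartedSpace E M] (k : ℕ) : Type _ :=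
  ∀ x : M, Alt E k x

section

variable {E : Type*} [NormedAddCommGroup E] [NormedSpace ℝ E]
  {M : Type*} [TopologicalSpace M] [ChartedSpace E M]

/-- The expression of `τ` in the preferred chart `φ` at `x₀`: the pullback `(φ⁻¹)^* τ`,
a form on the target of `φ`. -/
def chartRep {k : ℕ} (τ : Form E M k) (x₀ : M) : E → E [⋀^Fin k]→L[ℝ] ℝ := fun u =>
  (τ ((chartAt E x₀).symm u)).compContinuousLinearMap
    (mfderiv 𝓘(ℝ, E) 𝓘(ℝ, E) (chartAt E x₀).symm u)

/-- `τ` is smooth on `U` (used for open `U`). -/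
def SmoothOn {k : ℕ} (τ : Form E M k) (U : Set M) : Prop :=
  ∀ x₀ : M, ContDiffOn ℝ ∞ (chartRep τ x₀)
    ((chartAt E x₀).target ∩ (chartAt E x₀).symm ⁻¹' U)

/-- The exterior derivative, computed at `x` in the preferred chart at `x`. -/
def extD {k : ℕ} (τ : Form E M k) : Form E M (k + 1) := fun x =>
  (extDeriv (chartRep τ x) (chartAt E x x)).compContinuousLinearMap
    (mfderiv 𝓘(ℝ, E) 𝓘(ℝ, E) (chartAt E x) x)

/-- The differential of a function, as a `1`-form. -/
def differential (f : M → ℝ) : Form E M 1 := fun x =>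
  ContinuousAlternatingMap.ofSubsingleton ℝ (TangentSpace 𝓘(ℝ, E) x) ℝ (0 : Fin 1)
    (mfderiv 𝓘(ℝ, E) 𝓘(ℝ, ℝ) f x)

/-- `τ` is a smooth section over `U` of the family of subspaces `W x ⊆ Λᵏ T*ₓM`. -/
def IsSection {k : ℕ} (W : ∀ x : M, Submodule ℝ (Alt E k x)) (U : Set M) (τ : Form E M k) : Prop :=
  SmoothOn τ U ∧ ∀ x ∈ U, τ x ∈ W x

/-- `W` is a smooth subbundle of constant rank of `Λᵏ T*M`. -/
def IsSubbundle {k : ℕ} (W : ∀ x : M, Submodule ℝ (Alt E k x)) : Prop :=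
  ∃ r : ℕ, ∀ x : M, ∃ U : Set M, IsOpen U ∧ x ∈ U ∧ ∃ η : Fin r → Form E M k,
    (∀ i, SmoothOn (η i) U) ∧
    ∀ z ∈ U, LinearIndependent ℝ (fun i => η i z) ∧
      W z = Submodule.span ℝ (Set.range fun i => η i z)

/-- The fibres of `W` all have the same dimension. -/
def HasConstantRank {k : ℕ} (W : ∀ x : M, Submodule ℝ (Alt E k x)) : Prop :=
  ∃ r : ℕ, ∀ x : M, Module.finrank ℝ (W x) = r

/-- The annihilator of `W ⊆ T*M` in the tangent space at `x`. -/
def ann (W : ∀ x : M, Submodule ℝ (Alt E 1 x)) (x : M) :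
    Submodule ℝ (TangentSpace 𝓘(ℝ, E) x) where
  carrier := {v | ∀ η ∈ W x, η (fun _ => v) = 0}
  add_mem' := by
    intro a b ha hb η hη
    have := (ContinuousAlternatingMap.ofSubsingleton ℝ (TangentSpace 𝓘(ℝ, E) x) ℝ
      (0 : Fin 1)).symm η |>.map_add a b
    simp only [ContinuousAlternatingMap.ofSubsingleton_symm_apply_apply] at this
    have h1 := ha η hη
    have h2 := hb η hη
    simp_all [Function.const_def]
  zero_mem' := by
    intro η _
    exact η.map_coord_zero 0 rfl
  smul_mem' := by
    intro c a ha η hη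
    have := (ContinuousAlternatingMap.ofSubsingleton ℝ (TangentSpace 𝓘(ℝ, E) x) ℝ
      (0 : Fin 1)).symm η |>.map_smul c a
    simp only [ContinuousAlternatingMap.ofSubsingleton_symm_apply_apply] at this
    have h1 := ha η hη
    simp_all [Function.const_def]

/-- The ideal of `Ω^*(U)` generated algebraically by the homogeneous forms in `S`. Forms on `U`
are represented by forms on `M`, two of them being identified when they agree on `U`.
`AlgIdeal U S k τ` says that the `k`-form `τ` belongs to this ideal. -/
inductive AlgIdeal (U : Set M) (S : ∀ k, Form E M k → Prop) : ∀ k, Form E M k → Prop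
  | of {k : ℕ} (τ : Form E M k) : S k τ → AlgIdeal U S k τ
  | zero (k : ℕ) : AlgIdeal U S k (fun _ => 0)
  | add {k : ℕ} (τ η : Form E M k) :
      AlgIdeal U S k τ → AlgIdeal U S k η → AlgIdeal U S k (fun x => τ x + η x)
  | smul {k : ℕ} (f : M → ℝ) (τ : Form E M k) :
      ContMDiffOn 𝓘(ℝ, E) 𝓘(ℝ, ℝ) ∞ f U → AlgIdeal U S k τ → AlgIdeal U S k (fun x => f x • τ x)
  | wedge {k l : ℕ} (α : Form E M k) (τ : Form E M l) :
      SmoothOn α U → AlgIdeal U S l τ → AlgIdeal U S (k + l) (fun x => EDS.wedge (α x) (τ x))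
  | congr {k : ℕ} (τ η : Form E M k) :
      (∀ x ∈ U, τ x = η x) → AlgIdeal U S k τ → AlgIdeal U S k η

end

/-! ### Exterior differential systems -/

/-- An exterior differential system of constant rank on `M`: a family of constant rank subbundles
`Iᵏ ⊆ Λᵏ T*M` whose smooth sections form an ideal of `Ω^*(M)` closed under the exterior
derivative. The ideal consists of the global sections `IsSection (I.bdl k) Set.univ`. -/
structure ExteriorDiffSystem (E : Type*) [NormedAddCommGroup E] [NormedSpace ℝ E]
    (M : Type*) [TopologicalSpace M] [ChartedSpace E M] where
  bdl : ∀ (k : ℕ) (x : M), Submodule ℝ (Alt E k x)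
  isSubbundle : ∀ k, IsSubbundle (bdl k)
  wedge_mem : ∀ {k l : ℕ} (x : M) (α : Alt E k x) (τ : Alt E l x),
    τ ∈ bdl l x → wedge α τ ∈ bdl (k + l) x
  extD_mem : ∀ {k : ℕ} (τ : Form E M k), IsSection (bdl k) Set.univ τ →
    ∀ x, extD τ x ∈ bdl (k + 1) x

section

variable {E : Type*} [NormedAddCommGroup E] [NormedSpace ℝ E]
  {M : Type*} [TopologicalSpace M] [ChartedSpace E M]

/-- The generators `θ^e`, `A^i_{ab} σ̂^a ∧ σ̂^b` and `B^j_{αβ} σ̌^α ∧ σ̌^β`. -/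
inductive DecompGen {s q r t u : ℕ} (θ : Fin s → Form E M 1) (σh : Fin q → Form E M 1)
    (σc : Fin r → Form E M 1) (A : Fin t → Fin q → Fin q → M → ℝ)
    (B : Fin u → Fin r → Fin r → M → ℝ) : ∀ k, Form E M k → Prop
  | one (e : Fin s) : DecompGen θ σh σc A B 1 (θ e)
  | hat (i : Fin t) : DecompGen θ σh σc A B 2
      (fun x => ∑ a, ∑ b, A i a b x • wedge (σh a x) (σh b x))
  | check (j : Fin u) : DecompGen θ σh σc A B 2
      (fun x => ∑ a, ∑ b, B j a b x • wedge (σc a x) (σc b x))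

/-- `I` is decomposable of type `[q, r]` with singular Pfaffian systems `Vh` and `Vc`: near every
point there is a coframe `θ, σ̂, σ̌` for which `I` is algebraically generated by the `θ`s, `t ≥ 1`
quadratic forms in the `σ̂`s and `u ≥ 1` quadratic forms in the `σ̌`s, and for which
`Vh = span {θ, σ̂}` and `Vc = span {θ, σ̌}`. -/
def IsDecomposable (I : ExteriorDiffSystem E M) (q r : ℕ)
    (Vh Vc : ∀ x : M, Submodule ℝ (Alt E 1 x)) : Prop :=
  2 ≤ q ∧ 2 ≤ r ∧ ∀ x : M, ∃ U : Set M, IsOpen U ∧ x ∈ U ∧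
    ∃ (s t u : ℕ) (θ : Fin s → Form E M 1) (σh : Fin q → Form E M 1) (σc : Fin r → Form E M 1)
      (A : Fin t → Fin q → Fin q → M → ℝ) (B : Fin u → Fin r → Fin r → M → ℝ),
      1 ≤ t ∧ 1 ≤ u ∧
      (∀ e, SmoothOn (θ e) U) ∧ (∀ a, SmoothOn (σh a) U) ∧ (∀ a, SmoothOn (σc a) U) ∧
      (∀ i a b, ContMDiffOn 𝓘(ℝ, E) 𝓘(ℝ, ℝ) ∞ (A i a b) U) ∧
      (∀ j a b, ContMDiffOn 𝓘(ℝ, E) 𝓘(ℝ, ℝ) ∞ (B j a b) U) ∧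
      (∀ z ∈ U,
        LinearIndependent ℝ
          (Sum.elim (fun e => θ e z) (Sum.elim (fun a => σh a z) (fun a => σc a z))) ∧
        Submodule.span ℝ (Set.range
          (Sum.elim (fun e => θ e z) (Sum.elim (fun a => σh a z) (fun a => σc a z)))) = ⊤) ∧
      (∀ (k : ℕ) (τ : Form E M k),
        IsSection (I.bdl k) U τ ↔ AlgIdeal U (DecompGen θ σh σc A B) k τ) ∧
      ∀ z ∈ U,
        Vh z = Submodule.span ℝ ((Set.range fun e => θ e z) ∪ Set.range fun a => σh a z) ∧
        Vc z = Submodule.span ℝ ((Set.range fun e => θ e z) ∪ Set.range fun a => σc a z)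

/-- `W^∞`: the fibre at `x` is spanned by the differentials at `x` of the local first integrals of
`W` defined about `x`, i.e. smooth functions `f` on open `U ∋ x` with `df` a section of `W`. -/
def firstIntegrals (W : ∀ x : M, Submodule ℝ (Alt E 1 x)) (x : M) : Submodule ℝ (Alt E 1 x) :=
  Submodule.span ℝ {η | ∃ (U : Set M) (f : M → ℝ), IsOpen U ∧ x ∈ U ∧
    ContMDiffOn 𝓘(ℝ, E) 𝓘(ℝ, ℝ) ∞ f U ∧ (∀ z ∈ U, differential f z ∈ W z) ∧
    η = differential f x}

/-- `I` is Darboux integrable, with respect to the singular Pfaffian systems `Vh`, `Vc` of a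
decomposition of type `[q, r]`. The bundles of first integrals are required to have constant rank
(they are then smooth subbundles, being spanned by differentials). -/
structure IsDarbouxIntegrable (I : ExteriorDiffSystem E M) (q r : ℕ)
    (Vh Vc : ∀ x : M, Submodule ℝ (Alt E 1 x)) : Prop where
  decomposable : IsDecomposable I q r Vh Vc
  constantRank_hat : HasConstantRank (firstIntegrals Vh)
  constantRank_check : HasConstantRank (firstIntegrals Vc)
  hat_sup : ∀ x, Vh x ⊔ firstIntegrals Vc x = ⊤
  check_sup : ∀ x, Vc x ⊔ firstIntegrals Vh x = ⊤
  inf_eq_bot : ∀ x, firstIntegrals Vh x ⊓ firstIntegrals Vc x = ⊥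

end

/-! ### Integrable extensions -/

section

variable {EN : Type*} [NormedAddCommGroup EN] [NormedSpace ℝ EN]
  {N : Type*} [TopologicalSpace N] [ChartedSpace EN N]
  {EM : Type*} [NormedAddCommGroup EM] [NormedSpace ℝ EM]
  {M : Type*} [TopologicalSpace M] [ChartedSpace EM M]

/-- The pullback `p^* τ`. -/
def pullbackForm (p : N → M) {k : ℕ} (τ : Form EM M k) : Form EN N k := fun y =>
  (τ (p y)).compContinuousLinearMap (mfderiv 𝓘(ℝ, EN) 𝓘(ℝ, EM) p y)

/-- The pullback `p^* V ⊆ T*N` of `V ⊆ T*M`: its fibre at `y` is the image of `V (p y)` under the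
transpose of `dp_y`. -/
def pullbackBundle (p : N → M) (V : ∀ x : M, Submodule ℝ (Alt EM 1 x)) (y : N) :
    Submodule ℝ (Alt EN 1 y) :=
  (V (p y)).map (ContinuousAlternatingMap.compContinuousLinearMapₗ
    (mfderiv 𝓘(ℝ, EN) 𝓘(ℝ, EM) p y))

/-- The set `S(J) ∪ p^*(I)` of forms on `N`. -/
inductive ExtensionGen (p : N → M) (I : ExteriorDiffSystem EM M)
    (J : ∀ y : N, Submodule ℝ (Alt EN 1 y)) : ∀ k, Form EN N k → Prop
  | ofJ (η : Form EN N 1) : IsSection J Set.univ η → ExtensionGen p I J 1 η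
  | ofI {k : ℕ} (τ : Form EM M k) : IsSection (I.bdl k) Set.univ τ →
      ExtensionGen p I J k (pullbackForm p τ)

/-- `p : (K, N) → (I, M)` is an integrable extension with admissible subbundle `J`: `p` is a smooth
submersion, `J ⊆ T*N` is a subbundle with `ann J` transverse (complementary) to the fibres of `p`,
and `K` is the algebraic ideal generated by `S(J) ∪ p^*(I)`. -/
structure IsIntegrableExtension (p : N → M) (K : ExteriorDiffSystem EN N)
    (I : ExteriorDiffSystem EM M) (J : ∀ y : N, Submodule ℝ (Alt EN 1 y)) : Prop where
  contMDiff : ContMDiff 𝓘(ℝ, EN) 𝓘(ℝ, EM) ∞ p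
  surjective_mfderiv : ∀ y, Function.Surjective (mfderiv 𝓘(ℝ, EN) 𝓘(ℝ, EM) p y)
  isSubbundle : IsSubbundle J
  transverse : ∀ y,
    IsCompl (ann J y) (LinearMap.ker (mfderiv 𝓘(ℝ, EN) 𝓘(ℝ, EM) p y).toLinearMap)
  generated : ∀ (k : ℕ) (τ : Form EN N k),
    IsSection (K.bdl k) Set.univ τ ↔ AlgIdeal Set.univ (ExtensionGen p I J) k τ

/-- `J + p^* V`. -/
def extend (p : N → M) (J : ∀ y : N, Submodule ℝ (Alt EN 1 y))
    (V : ∀ x : M, Submodule ℝ (Alt EM 1 x)) (y : N) : Submodule ℝ (Alt EN 1 y) :=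
  J y ⊔ pullbackBundle p V y

end

end

end EDS

/-! Part (i). Dually, transversality of `ann J` to the fibres of `p` says that `J` is a complement
in `T*N` of the image of `p^*`. A local frame of `J` followed by the pullback of an adapted coframe
of `M` is therefore a coframe of `N`, and the quadratic generators pull back to quadratic
generators. The extension is generated by global forms, whereas decomposability asks for generation
near a point. The passage is pointwise: every value at `y` of a form of the extension is the value
of a form in the local ideal (`IsIntegrableExtension.exists_algIdeal_value`), and constant rank
spreads this to a neighbourhood with smooth coefficients (`exists_nhds_isSection_iff`).

Part (ii). The two spanning conditions follow from those on `M`, since first integrals pull back to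
first integrals. The substance is that `P = Ẑ^∞` and `Q = Ž^∞` meet in zero. If they do not, a
nonconstant first integral of `Ẑ ∩ Ž`, which is contained in `E^1`, is constructed, contradicting
`(E^1)^∞ = 0`.

Complete a frame `θ` of `Ẑ ∩ Ž` to a coframe by differentials `dξ` from `P` and `dη` from `Q`. In
the dual frame the fields `X` dual to the `dη` span `ann Ẑ`, and the fields `Y` dual to the `dξ`
span `ann Ž`. Every form of a decomposable system vanishes on planes with one direction in each
annihilator, so `dθ(X, Y) = 0` and hence `[X, Y] = 0`. Consequently `Y` maps first integrals of `Ẑ`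
to first integrals of `Ẑ`.

Let now `ξ`, `η` give full bases of `P`, `Q`. Write each `dη_s` in a frame of `P + Q` formed by all
the `dξ_i` and some of the `dη_j`. Applying the Lie derivative along `Y` shows that the coefficients
`B` of the `dη_j` are first integrals of `Ž` (`IsCommutingFrame.coeff_mem`). Whether a combination
`∑ d_s dη_s` lies in `P` is thus governed by functions whose differentials lie in the span of the
`dη`.

Take finally a second frame of `P + Q`, formed by all the `dη` and part of the `dξ`. As `P ∩ Q ≠ 0`,
some `ξ_{i0}` is left out. Let `g` be a local map preserving all `η` and freezing the `ξ` of this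
frame (`exists_slice`). Then `d(ξ_{i0} ∘ g)` is a combination of the `dη`; it lies in `P` at `z`
because it does so at `g z` and the functions `B` agree at `z` and `g z`. It is nonzero at the base
point, so `ξ_{i0} ∘ g` is the required common integral (`IsCommutingFrame.exists_common_integral`).
-/

namespace EDS

/-! ### Smooth frames, dual frames and first integrals on open sets of a vector space. -/

section VectorSpace

open Filter

variable {E : Type*} [NormedAddCommGroup E] [NormedSpace ℝ E]
  {V : Type*} [NormedAddCommGroup V] [NormedSpace ℝ V]

/-- From a family `w` one can select a subfamily completing the independent family `v` to a basis
of the span of both. -/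
theorem exists_selection {ι κ : Type*} (v : ι → V) (w : κ → V) (hv : LinearIndependent ℝ v) :
    ∃ T : Set κ, LinearIndependent ℝ (Sum.elim v (fun j : T => w j)) ∧
      Submodule.span ℝ (Set.range (Sum.elim v (fun j : T => w j))) =
        Submodule.span ℝ (Set.range v) ⊔ Submodule.span ℝ (Set.range w) := by
  set S := Submodule.span ℝ (Set.range v) with hS
  -- Selecting modulo the span of `v` makes the chosen `w` independent of `v` as well as of each
  -- other.
  obtain ⟨κ', a, ha, hspan, hli⟩ := exists_linearIndependent' ℝ (fun j => S.mkQ (w j))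
  have hv' : LinearIndependent ℝ (fun i => (⟨v i, Submodule.subset_span ⟨i, rfl⟩⟩ : S)) :=
    linearIndependent_span hv
  have key := LinearIndependent.sumElim_of_quotient (M' := S) hv' (fun j => w (a j)) hli
  refine ⟨Set.range a, ?_, ?_⟩
  · have e1 : (Sum.elim v fun j : Set.range a => w j) =
        (Sum.elim v fun j => w (a j)) ∘ Sum.map id (Equiv.ofInjective a ha).symm := by
      ext (i | ⟨_, j, rfl⟩)
      · rfl
      · simp [Equiv.ofInjective_symm_apply]
    rw [e1]
    exact key.comp _ (Function.Injective.sumMap Function.injective_id (Equiv.injective _))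
  · rw [Set.Sum.elim_range, Submodule.span_union]
    refine le_antisymm (sup_le_sup_left (Submodule.span_mono ?_) _) (sup_le le_sup_left ?_)
    · rintro _ ⟨j, rfl⟩
      exact ⟨j, rfl⟩
    · have h1 : (Submodule.span ℝ (Set.range w)).map S.mkQ ≤
          (Submodule.span ℝ (Set.range fun j : Set.range a => w j)).map S.mkQ := by
        rw [Submodule.map_span, Submodule.map_span]
        have e1 : S.mkQ '' Set.range w = Set.range fun j => S.mkQ (w j) := by
          rw [← Set.range_comp]; rfl
        rw [e1, ← hspan]
        refine Submodule.span_mono ?_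
        rintro _ ⟨j, rfl⟩
        exact ⟨w (a j), ⟨⟨a j, j, rfl⟩, rfl⟩, rfl⟩
      have h2 := Submodule.comap_mono (f := S.mkQ) h1
      rw [Submodule.comap_map_mkQ, Submodule.comap_map_mkQ] at h2
      exact le_sup_right.trans h2

/-- Coefficients with respect to a smooth frame are smooth. -/
theorem exists_smooth_coeff [FiniteDimensional ℝ V] {ι : Type*} [Fintype ι] {Ω : Set E}
    (hΩ : IsOpen Ω) {w : ι → E → V} {τ : E → V} (hw : ∀ i, ContDiffOn ℝ ∞ (w i) Ω)
    (hτ : ContDiffOn ℝ ∞ τ Ω) (hli : ∀ z ∈ Ω, LinearIndependent ℝ (fun i => w i z))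
    (hmem : ∀ z ∈ Ω, τ z ∈ Submodule.span ℝ (Set.range fun i => w i z)) :
    ∃ c : ι → E → ℝ, (∀ i, ContDiffOn ℝ ∞ (c i) Ω) ∧ ∀ z ∈ Ω, τ z = ∑ i, c i z • w i z := by
  classical
  have hex : ∀ z, ∃ c : ι → ℝ, z ∈ Ω → τ z = ∑ i, c i • w i z := by
    intro z
    by_cases hz : z ∈ Ω
    · obtain ⟨c, hc⟩ := (Submodule.mem_span_range_iff_exists_fun ℝ).1 (hmem z hz)
      exact ⟨c, fun _ => hc.symm⟩
    · exact ⟨0, fun h => absurd h hz⟩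
  choose c hc using hex
  refine ⟨fun i z => c z i, ?_, fun z hz => hc z hz⟩
  suffices h : ContDiffOn ℝ ∞ c Ω from fun i => contDiffOn_pi.1 h i
  intro z0 hz0
  refine ContDiffAt.contDiffWithinAt ?_
  -- A left inverse `L` of the frame at `z0`, kept fixed, turns the frame at `z` into a square
  -- matrix `A z` with `A z0 = 1`. Near `z0` the coefficients are then `(A z)⁻¹ (L (τ z))`, which is
  -- smooth in `z`.
  obtain ⟨L, hL⟩ := (Fintype.linearCombination ℝ (fun i => w i z0)).exists_leftInverse_of_injective
    (by rw [LinearMap.ker_eq_bot]; exact (hli z0 hz0).fintypeLinearCombination_injective)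
  let L' : V →L[ℝ] (ι → ℝ) := LinearMap.toContinuousLinearMap L
  let A : E → (ι → ℝ) →L[ℝ] (ι → ℝ) := fun z =>
    ∑ i, (ContinuousLinearMap.proj i : (ι → ℝ) →L[ℝ] ℝ).smulRight (L' (w i z))
  have hnh : Ω ∈ 𝓝 z0 := hΩ.mem_nhds hz0
  have hA : ContDiffAt ℝ ∞ A z0 := by
    refine ContDiffAt.sum fun i _ => ?_
    exact ((ContinuousLinearMap.smulRightL ℝ (ι → ℝ) (ι → ℝ)
      (ContinuousLinearMap.proj i)).contDiff.comp L'.contDiff).contDiffAt.comp z0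
        ((hw i).contDiffAt hnh)
  have hA0 : A z0 = ContinuousLinearEquiv.refl ℝ (ι → ℝ) := by
    ext1 x
    have := LinearMap.congr_fun hL x
    simp only [LinearMap.comp_apply, Fintype.linearCombination_apply, map_sum, map_smul] at this
    simpa [A, L'] using this
  have hAc : ∀ z ∈ Ω, A z (c z) = L' (τ z) := by
    intro z hz
    rw [hc z hz]
    simp [A, map_sum]
  have hopen : ∀ᶠ z in 𝓝 z0, (A z).IsInvertible := by
    have := hA.continuousAt.preimage_mem_nhds
      (t := Set.range ((↑) : ((ι → ℝ) ≃L[ℝ] (ι → ℝ)) → _))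
      (by rw [hA0]; exact ContinuousLinearEquiv.nhds _)
    exact this
  have hfin : ContDiffAt ℝ ∞ (fun z => (A z).inverse (L' (τ z))) z0 := by
    refine ContDiffAt.clm_apply ?_ ?_
    · refine ContDiffAt.comp (g := ContinuousLinearMap.inverse) z0 ?_ hA
      rw [hA0]
      exact contDiffAt_map_inverse _
    · exact L'.contDiff.contDiffAt.comp z0 (hτ.contDiffAt hnh)
  refine hfin.congr_of_eventuallyEq ?_
  filter_upwards [hopen, hnh] with z hz hz'
  rw [← hAc z hz']
  obtain ⟨e, he⟩ := hz
  rw [← he]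
  simp

/-- The coordinate map of a basis of the dual is invertible. -/
theorem isInvertible_pi [FiniteDimensional ℝ E] {ι : Type*} [Fintype ι] {w : ι → E →L[ℝ] ℝ}
    (hli : LinearIndependent ℝ w) (hspan : Submodule.span ℝ (Set.range w) = ⊤) :
    (ContinuousLinearMap.pi w).IsInvertible := by
  have hinj : Function.Injective (ContinuousLinearMap.pi w) := by
    rw [injective_iff_map_eq_zero]
    intro v hv
    have h0 : ∀ ℓ ∈ Submodule.span ℝ (Set.range w), ℓ v = 0 := by
      intro ℓ hℓ
      induction hℓ using Submodule.span_induction with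
      | mem x h => obtain ⟨i, rfl⟩ := h; exact congrFun hv i
      | zero => rfl
      | add x y _ _ hx hy => simp [hx, hy]
      | smul a x _ hx => simp [hx]
    rw [hspan] at h0
    by_contra hne
    obtain ⟨f, hf⟩ := SeparatingDual.exists_ne_zero (R := ℝ) hne
    exact hf (h0 f trivial)
  have hcard : Module.finrank ℝ E = Module.finrank ℝ (ι → ℝ) := by
    have h1 := finrank_span_eq_card hli
    rw [hspan, finrank_top] at h1
    have h2 : Module.finrank ℝ (E →L[ℝ] ℝ) = Module.finrank ℝ E := by
      rw [← (LinearMap.toContinuousLinearMap (𝕜 := ℝ) (E := E) (F' := ℝ)).finrank_eq]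
      exact Subspace.dual_finrank_eq
    rw [← h2, h1, Module.finrank_fintype_fun_eq_card]
  exact ⟨(LinearEquiv.ofInjectiveOfFinrankEq (ContinuousLinearMap.pi w : E →ₗ[ℝ] (ι → ℝ)) hinj
    hcard).toContinuousLinearEquiv, by ext; rfl⟩

/-- The frame of vector fields dual to a smooth coframe. -/
theorem exists_dual_frame [FiniteDimensional ℝ E] {ι : Type*} [Fintype ι] [DecidableEq ι]
    {Ω : Set E} (hΩ : IsOpen Ω) {w : ι → E → E →L[ℝ] ℝ} (hw : ∀ i, ContDiffOn ℝ ∞ (w i) Ω)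
    (hli : ∀ z ∈ Ω, LinearIndependent ℝ (fun i => w i z))
    (hspan : ∀ z ∈ Ω, Submodule.span ℝ (Set.range fun i => w i z) = ⊤) :
    ∃ X : ι → E → E, (∀ i, ContDiffOn ℝ ∞ (X i) Ω) ∧
      ∀ z ∈ Ω, (∀ i j, w i z (X j z) = if i = j then 1 else 0) := by
  let C : E → E →L[ℝ] (ι → ℝ) := fun z => ContinuousLinearMap.pi fun i => w i z
  have hC : ContDiffOn ℝ ∞ C Ω := by
    have : C = fun z => ∑ i, (ContinuousLinearMap.compL ℝ E ℝ (ι → ℝ)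
        (ContinuousLinearMap.single ℝ (fun _ : ι => ℝ) i)) (w i z) := by
      ext z x i
      simp [C, Finset.sum_apply, Pi.single_apply]
    rw [this]
    exact ContDiffOn.sum fun i _ => (ContinuousLinearMap.contDiff _).comp_contDiffOn (hw i)
  have hinv : ∀ z ∈ Ω, (C z).IsInvertible := fun z hz => isInvertible_pi (hli z hz) (hspan z hz)
  refine ⟨fun j z => (C z).inverse (Pi.single j 1), fun j z hz => ?_, fun z hz i j => ?_⟩
  · refine ContDiffAt.contDiffWithinAt (ContDiffAt.clm_apply ?_ contDiffAt_const)
    refine ContDiffAt.comp (g := ContinuousLinearMap.inverse) z ?_ (hC.contDiffAt (hΩ.mem_nhds hz))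
    obtain ⟨e, he⟩ := hinv z hz
    rw [← he]
    exact contDiffAt_map_inverse _
  · obtain ⟨e, he⟩ := hinv z hz
    have : C z ((C z).inverse (Pi.single j 1)) = Pi.single j 1 := by
      rw [← he]; simp
    have h2 := congrFun this i
    simpa [C, Pi.single_apply] using h2

/-- Pointwise first integrals of a family of subspaces of the dual of a normed space. -/
noncomputable def firstIntegralsVS (Z : E → Submodule ℝ (E →L[ℝ] ℝ)) (z : E) :
    Submodule ℝ (E →L[ℝ] ℝ) :=
  Submodule.span ℝ {ℓ | ∃ (U : Set E) (f : E → ℝ), IsOpen U ∧ z ∈ U ∧ ContDiffOn ℝ ∞ f U ∧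
    (∀ w ∈ U, fderiv ℝ f w ∈ Z w) ∧ ℓ = fderiv ℝ f z}

theorem firstIntegralsVS_le (Z : E → Submodule ℝ (E →L[ℝ] ℝ)) (z : E) :
    firstIntegralsVS Z z ≤ Z z := by
  refine Submodule.span_le.2 ?_
  rintro _ ⟨U, f, _, hz, _, hf, rfl⟩
  exact hf z hz

theorem fderiv_mem_firstIntegralsVS {Z : E → Submodule ℝ (E →L[ℝ] ℝ)} {U : Set E} {f : E → ℝ}
    (hU : IsOpen U) (hf : ContDiffOn ℝ ∞ f U) (hmem : ∀ w ∈ U, fderiv ℝ f w ∈ Z w) {z : E}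
    (hz : z ∈ U) : fderiv ℝ f z ∈ firstIntegralsVS Z z :=
  Submodule.subset_span ⟨U, f, hU, hz, hf, hmem, rfl⟩

theorem contDiffOn_fderiv {Ω : Set E} (hΩ : IsOpen Ω) {f : E → V} (hf : ContDiffOn ℝ ∞ f Ω) :
    ContDiffOn ℝ ∞ (fderiv ℝ f) Ω :=
  hf.fderiv_of_isOpen hΩ (by simp)

/-- Linear independence of a family continuous at `z` persists near `z`. -/
theorem eventually_linearIndependent {X : Type*} [TopologicalSpace X] {ι : Type*} [Finite ι]
    {w : ι → X → V} {z0 : X} (hw : ∀ i, ContinuousAt (w i) z0)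
    (hli : LinearIndependent ℝ (fun i => w i z0)) :
    ∀ᶠ z in 𝓝 z0, LinearIndependent ℝ (fun i => w i z) := by
  have : ContinuousAt (fun z i => w i z) z0 := continuousAt_pi.2 hw
  exact this.eventually hli.eventually

/-- First integrals of constant rank have a local basis of differentials. -/
theorem exists_basis_firstIntegralsVS [FiniteDimensional ℝ E] {Z : E → Submodule ℝ (E →L[ℝ] ℝ)}
    {Ω : Set E} (hΩ : IsOpen Ω) {z0 : E} (hz0 : z0 ∈ Ω) {m : ℕ}
    (hm : ∀ z ∈ Ω, Module.finrank ℝ (firstIntegralsVS Z z) = m) :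
    ∃ (U : Set E) (ξ : Fin m → E → ℝ), IsOpen U ∧ z0 ∈ U ∧ U ⊆ Ω ∧
      (∀ i, ContDiffOn ℝ ∞ (ξ i) U) ∧
      ∀ z ∈ U, LinearIndependent ℝ (fun i => fderiv ℝ (ξ i) z) ∧
        firstIntegralsVS Z z = Submodule.span ℝ (Set.range fun i => fderiv ℝ (ξ i) z) := by
  obtain ⟨b, hbsub, hbspan, hbli⟩ := exists_linearIndependent ℝ
    {ℓ | ∃ (U : Set E) (f : E → ℝ), IsOpen U ∧ z0 ∈ U ∧ ContDiffOn ℝ ∞ f U ∧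
      (∀ w ∈ U, fderiv ℝ f w ∈ Z w) ∧ ℓ = fderiv ℝ f z0}
  have hfin : Finite b := hbli.finite
  have := Fintype.ofFinite b
  have hcard : Fintype.card b = m := by
    rw [← hm z0 hz0, firstIntegralsVS, ← hbspan]
    have := finrank_span_eq_card hbli
    rw [Subtype.range_coe] at this
    exact this.symm
  let e : Fin m ≃ b := (Fintype.equivFinOfCardEq hcard).symm
  choose U f hUo hzU hf hfZ hfe using fun i : b => hbsub i.2
  have hli0 : LinearIndependent ℝ (fun i => fderiv ℝ (f (e i)) z0) := by
    have e1 : (fun i => fderiv ℝ (f (e i)) z0) = Subtype.val ∘ e := funext fun i => (hfe (e i)).symm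
    rw [e1]
    exact hbli.comp e e.injective
  let U1 : Set E := ⋂ i, U (e i)
  have hU1 : IsOpen U1 := isOpen_iInter_of_finite fun i => hUo _
  have hz1 : z0 ∈ U1 := Set.mem_iInter.2 fun i => hzU _
  have hev := eventually_linearIndependent (w := fun i => fderiv ℝ (f (e i))) (z0 := z0)
    (fun i => (contDiffOn_fderiv (hUo _) (hf (e i))).continuousOn.continuousAt
      ((hUo _).mem_nhds (hzU _))) hli0
  obtain ⟨U2, hU2, hU2o, hz2⟩ := eventually_nhds_iff.1 hev
  refine ⟨U1 ∩ U2 ∩ Ω, fun i => f (e i), (hU1.inter hU2o).inter hΩ, ⟨⟨hz1, hz2⟩, hz0⟩,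
    fun x hx => hx.2, fun i => (hf _).mono fun x hx => Set.mem_iInter.1 hx.1.1 i,
    fun z hz => ⟨hU2 z hz.1.2, ?_⟩⟩
  symm
  -- Constant rank enters here: `m` independent differentials inside an `m`-dimensional fibre
  -- exhaust it at every nearby point.
  refine Submodule.eq_of_le_of_finrank_eq (Submodule.span_le.2 ?_) ?_
  · rintro _ ⟨i, rfl⟩
    exact fderiv_mem_firstIntegralsVS (hUo _) (hf (e i)) (hfZ _) (Set.mem_iInter.1 hz.1.1 i)
  · rw [finrank_span_eq_card (hU2 z hz.1.2), hm z hz.2, Fintype.card_fin]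

end VectorSpace

/-! ### Slices transverse to a family of functions. -/

section VectorSpace

open Filter VectorField

variable {E : Type*} [NormedAddCommGroup E] [NormedSpace ℝ E] [FiniteDimensional ℝ E]

/-- A slice for the fibres of a submersion `η`: a map `g` preserving every function whose
differential is spanned by the `dη`, and making constant the transverse functions `σ`. -/
theorem exists_slice {α β : Type*} [Finite α] [Finite β] {σ : α → E → ℝ} {η : β → E → ℝ}
    {Ω : Set E} (hΩ : IsOpen Ω) {z0 : E} (hz0 : z0 ∈ Ω)
    (hσ : ∀ i, ContDiffOn ℝ ∞ (σ i) Ω) (hη : ∀ i, ContDiffOn ℝ ∞ (η i) Ω)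
    (hli : LinearIndependent ℝ
      (Sum.elim (fun i => fderiv ℝ (σ i) z0) (fun i => fderiv ℝ (η i) z0))) :
    ∃ (U : Set E) (g : E → E), IsOpen U ∧ z0 ∈ U ∧ U ⊆ Ω ∧ ContDiffOn ℝ ∞ g U ∧
      Set.MapsTo g U U ∧ g z0 = z0 ∧ (∀ i, ∀ z ∈ U, σ i (g z) = σ i z0) ∧
      ∀ B : E → ℝ, ContDiffOn ℝ ∞ B U →
        (∀ z ∈ U, fderiv ℝ B z ∈ Submodule.span ℝ (Set.range fun i => fderiv ℝ (η i) z)) →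
        ∀ z ∈ U, B (g z) = B z := by
  classical
  have := Fintype.ofFinite α
  have := Fintype.ofFinite β
  -- The missing coordinates are taken among the linear functionals, each of which is its own
  -- differential.
  obtain ⟨T, hT, hTspan⟩ := exists_selection _ (fun ℓ : E →L[ℝ] ℝ => ℓ) hli
  have hTfin : Finite T := (hT.comp Sum.inr Sum.inr_injective).finite
  have := Fintype.ofFinite T
  -- the coordinates
  let Φ : (α ⊕ β) ⊕ T → E → ℝ := Sum.elim (Sum.elim σ η) (fun ℓ => ⇑(ℓ : E →L[ℝ] ℝ))
  have hΦ : ∀ i, ContDiffOn ℝ ∞ (Φ i) Ω := by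
    rintro ((i | i) | i)
    · exact hσ i
    · exact hη i
    · exact (i : E →L[ℝ] ℝ).contDiff.contDiffOn
  have hΦd : (fun i => fderiv ℝ (Φ i) z0) = Sum.elim (Sum.elim (fun i => fderiv ℝ (σ i) z0)
      (fun i => fderiv ℝ (η i) z0)) (fun ℓ : T => (ℓ : E →L[ℝ] ℝ)) := by
    funext i
    rcases i with (i | i) | i
    · rfl
    · rfl
    · exact (i : E →L[ℝ] ℝ).fderiv
  rw [← hΦd] at hT
  have hΦspan : Submodule.span ℝ (Set.range fun i => fderiv ℝ (Φ i) z0) = ⊤ := by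
    rw [hΦd, hTspan]
    simp
  let F : E → ((α ⊕ β) ⊕ T → ℝ) := fun z i => Φ i z
  have hF : ContDiffOn ℝ ∞ F Ω := contDiffOn_pi.2 hΦ
  have hFd : ∀ z ∈ Ω, fderiv ℝ F z = ContinuousLinearMap.pi fun i => fderiv ℝ (Φ i) z := by
    intro z hz
    exact fderiv_pi fun i => ((hΦ i).contDiffAt (hΩ.mem_nhds hz)).differentiableAt (by simp)
  have hFs : ∀ z ∈ Ω, ContDiffAt ℝ ∞ F z := fun z hz => hF.contDiffAt (hΩ.mem_nhds hz)
  have hinv0 : (fderiv ℝ F z0).IsInvertible := by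
    rw [hFd z0 hz0]
    exact isInvertible_pi hT hΦspan
  obtain ⟨e0, he0⟩ := hinv0
  have hinv : ∀ᶠ z in 𝓝 z0, (fderiv ℝ F z).IsInvertible := by
    have h1 : ContinuousAt (fderiv ℝ F) z0 :=
      (contDiffOn_fderiv hΩ hF).continuousOn.continuousAt (hΩ.mem_nhds hz0)
    exact h1.preimage_mem_nhds
      (t := Set.range ((↑) : (E ≃L[ℝ] ((α ⊕ β) ⊕ T → ℝ)) → _))
      (by rw [← he0]; exact ContinuousLinearEquiv.nhds _)
  obtain ⟨Ω1, hΩ1, hΩ1o, hz1⟩ := eventually_nhds_iff.1 hinv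
  have hd0 : HasFDerivAt F (e0 : E →L[ℝ] ((α ⊕ β) ⊕ T → ℝ)) z0 := by
    rw [he0]
    exact ((hFs z0 hz0).differentiableAt (by simp)).hasFDerivAt
  -- Shrinking the source to where `F` is smooth with invertible derivative makes the inverse smooth
  -- on the whole target, not only at the image of `z0`.
  let h := ((hFs z0 hz0).toOpenPartialHomeomorph F hd0 (by simp)).restrOpen (Ω ∩ Ω1)
    (hΩ.inter hΩ1o)
  have hhF : ∀ z, h z = F z := fun z => rfl
  have hsrc : h.source ⊆ Ω ∩ Ω1 := fun z hz => hz.2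
  have hz0s : z0 ∈ h.source :=
    ⟨(hFs z0 hz0).mem_toOpenPartialHomeomorph_source hd0 (by simp), hz0, hz1⟩
  have hsymm : ContDiffOn ℝ ∞ h.symm h.target := by
    intro u hu
    refine ContDiffAt.contDiffWithinAt ?_
    have hus := hsrc (h.map_target hu)
    obtain ⟨e, he⟩ := hΩ1 _ hus.2
    refine h.contDiffAt_symm (f₀' := e) hu ?_ (hFs _ hus.1)
    rw [he]
    exact ((hFs _ hus.1).differentiableAt (by simp)).hasFDerivAt
  obtain ⟨ε, hε, hball⟩ := Metric.isOpen_iff.1 h.open_target (F z0) (h.map_source hz0s)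
  -- In the coordinates `(σ, η, rest)`, keep `η` and reset the others to their values at `z0`. Each
  -- coordinate is unchanged or moved to that of the centre, so balls of the sup distance about `F
  -- z0` are preserved.
  let pr : ((α ⊕ β) ⊕ T → ℝ) → ((α ⊕ β) ⊕ T → ℝ) := fun u =>
    Sum.elim (Sum.elim (fun i => F z0 (.inl (.inl i))) (fun i => u (.inl (.inr i))))
      (fun i => F z0 (.inr i))
  have hpr : ∀ u ∈ Metric.ball (F z0) ε, pr u ∈ Metric.ball (F z0) ε := by
    intro u hu
    rw [Metric.mem_ball, dist_pi_lt_iff hε] at hu ⊢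
    rintro ((i | i) | i)
    · simpa [pr] using hε
    · exact hu _
    · simpa [pr] using hε
  have hprs : ContDiff ℝ ∞ pr := by
    refine contDiff_pi.2 ?_
    rintro ((i | i) | i)
    · exact contDiff_const
    · exact contDiff_apply ℝ ℝ _
    · exact contDiff_const
  have hpr0 : pr (F z0) = F z0 := by
    funext i
    rcases i with (i | i) | i <;> rfl
  let U := h.source ∩ h ⁻¹' Metric.ball (F z0) ε
  have hUo : IsOpen U := h.isOpen_inter_preimage Metric.isOpen_ball
  have hUb : ∀ u ∈ Metric.ball (F z0) ε, h.symm u ∈ U := fun u hu =>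
    ⟨h.map_target (hball hu), by
      rw [Set.mem_preimage, h.right_inv (hball hu)]; exact hu⟩
  have hFg : ∀ z ∈ U, F (h.symm (pr (F z))) = pr (F z) := fun z hz =>
    h.right_inv (hball (hpr _ hz.2))
  refine ⟨U, fun z => h.symm (pr (F z)), hUo, ⟨hz0s, Metric.mem_ball_self hε⟩,
    fun z hz => (hsrc hz.1).1, ?_, fun z hz => hUb _ (hpr _ hz.2), ?_, ?_, ?_⟩
  · refine hsymm.comp (hprs.comp_contDiffOn (hF.mono fun z hz => (hsrc hz.1).1)) ?_
    intro z hz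
    exact hball (hpr _ hz.2)
  · change h.symm (pr (F z0)) = z0
    rw [hpr0]
    exact h.left_inv hz0s
  · intro i z hz
    exact congrFun (hFg z hz) (.inl (.inl i))
  · intro B hB hBd z hz
    -- the segment from `pr u` to `u` in the coordinates
    let L : ℝ → ((α ⊕ β) ⊕ T → ℝ) := fun t => pr (F z) + t • (F z - pr (F z))
    have hL : ContDiff ℝ ∞ L := contDiff_const.add (contDiff_id.smul contDiff_const)
    have hLb : ∀ t ∈ Set.Icc (0 : ℝ) 1, L t ∈ Metric.ball (F z0) ε := by
      intro t ht
      exact (convex_ball (F z0) ε).add_smul_sub_mem (hpr _ hz.2) hz.2 ht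
    have hγ : ∀ t ∈ Set.Icc (0 : ℝ) 1, HasDerivAt (fun t => B (h.symm (L t))) 0 t := by
      intro t ht
      have hUt := hUb _ (hLb t ht)
      have h1 : DifferentiableAt ℝ (fun t => h.symm (L t)) t :=
        DifferentiableAt.comp t ((hsymm.contDiffAt (h.open_target.mem_nhds
          (hball (hLb t ht)))).differentiableAt (by simp))
          (hL.contDiffAt.differentiableAt (by simp))
      have h2 : ∀ f : E → ℝ, ContDiffOn ℝ ∞ f U → HasDerivAt (fun t => f (h.symm (L t)))
          (fderiv ℝ f (h.symm (L t)) (deriv (fun t => h.symm (L t)) t)) t := by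
        intro f hf
        exact ((hf.contDiffAt (hUo.mem_nhds hUt)).differentiableAt
          (by simp)).hasFDerivAt.comp_hasDerivAt t h1.hasDerivAt
      -- The segment changes only the coordinates other than `η`, so every `dη_i` kills its
      -- velocity. Hence so does `dB`, and `B` agrees at the two ends.
      have h3 : ∀ i, fderiv ℝ (η i) (h.symm (L t)) (deriv (fun t => h.symm (L t)) t) = 0 := by
        intro i
        refine (h2 (η i) ((hη i).mono fun z hz => (hsrc hz.1).1)).unique ?_
        refine (hasDerivAt_const t (η i z)).congr_of_eventuallyEq ?_
        filter_upwards [hL.continuous.continuousAt.preimage_mem_nhds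
          (Metric.isOpen_ball.mem_nhds (hLb t ht))] with s hs
        have h4 : F (h.symm (L s)) = L s := h.right_inv (hball hs)
        have h5 := congrFun h4 (.inl (.inr i))
        have h6 : L s (.inl (.inr i)) = η i z := by
          simp [L, pr, F, Φ]
        rw [← h6]
        exact h5
      have h7 : fderiv ℝ B (h.symm (L t)) (deriv (fun t => h.symm (L t)) t) = 0 := by
        have h8 := hBd _ hUt
        generalize fderiv ℝ B (h.symm (L t)) = ℓ at h8 ⊢
        induction h8 using Submodule.span_induction with
        | mem x h => obtain ⟨i, rfl⟩ := h; exact h3 i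
        | zero => rfl
        | add x y _ _ hx hy => simp [hx, hy]
        | smul a x _ hx => simp [hx]
      rw [← h7]
      exact h2 B hB
    have h9 := constant_of_has_deriv_right_zero
      (fun t ht => (hγ t ht).continuousAt.continuousWithinAt)
      (fun t ht => (hγ t ⟨ht.1, ht.2.le⟩).hasDerivWithinAt) 1 (by simp)
    have h10 : L 1 = F z := by simp [L]
    have h11 : L 0 = pr (F z) := by simp [L]
    rw [h10, h11] at h9
    have h12 : h.symm (F z) = z := h.left_inv hz.1
    rw [h12] at h9
    exact h9.symm

end VectorSpace

/-! ### Commuting frames and the action of `Y` on first integrals. -/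

section VectorSpace

open Filter VectorField

variable {E : Type*} [NormedAddCommGroup E] [NormedSpace ℝ E]

theorem minSmoothness_two_le : minSmoothness ℝ 2 ≤ ∞ := by
  rw [minSmoothness_of_isRCLikeNormedField]
  exact WithTop.coe_le_coe.2 (le_top : (2 : ℕ∞) ≤ ⊤)

/-- Frames `X`, `Y` of the annihilators of `Zh`, `Zc`, commuting with each other. -/
structure IsCommutingFrame {α β : Type*} (Zh Zc : E → Submodule ℝ (E →L[ℝ] ℝ)) (Ω : Set E)
    (X : α → E → E) (Y : β → E → E) : Prop where
  smooth_left : ∀ a, ContDiffOn ℝ ∞ (X a) Ω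
  smooth_right : ∀ b, ContDiffOn ℝ ∞ (Y b) Ω
  mem_left : ∀ z ∈ Ω, ∀ ℓ, ℓ ∈ Zh z ↔ ∀ a, ℓ (X a z) = 0
  mem_right : ∀ z ∈ Ω, ∀ ℓ, ℓ ∈ Zc z ↔ ∀ b, ℓ (Y b z) = 0
  lieBracket_eq_zero : ∀ z ∈ Ω, ∀ a b, lieBracket ℝ (X a) (Y b) z = 0

/-- The fields `Y` map first integrals of `Zh` to first integrals of `Zh`. -/
theorem IsCommutingFrame.fderiv_apply_mem {α β : Type*} {Zh Zc : E → Submodule ℝ (E →L[ℝ] ℝ)}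
    {Ω : Set E} {X : α → E → E} {Y : β → E → E} (h : IsCommutingFrame Zh Zc Ω X Y) {U : Set E}
    (hU : IsOpen U) (hUΩ : U ⊆ Ω) {f : E → ℝ} (hf : ContDiffOn ℝ ∞ f U)
    (hfZ : ∀ z ∈ U, fderiv ℝ f z ∈ Zh z) (b : β) :
    ∀ z ∈ U, fderiv ℝ (fun z => fderiv ℝ f z (Y b z)) z ∈ Zh z := by
  intro z hz
  rw [h.mem_left z (hUΩ hz)]
  intro a
  have hn := hU.mem_nhds hz
  have hdX := (((h.smooth_left a).mono hUΩ).contDiffAt hn).differentiableAt (by simp)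
  have hdY := (((h.smooth_right b).mono hUΩ).contDiffAt hn).differentiableAt (by simp)
  -- The commutator formula: since `[X, Y] = 0` and `X f` vanishes identically, `X (Y f) = Y (X f) =
  -- 0`.
  have key := fderiv_apply_lieBracket (hf.contDiffAt hn) minSmoothness_two_le hdY hdX
  rw [h.lieBracket_eq_zero z (hUΩ hz), map_zero] at key
  have h0 : (fun x => fderiv ℝ f x (X a x)) =ᶠ[𝓝 z] fun _ => 0 := by
    filter_upwards [hn] with w hw
    exact (h.mem_left w (hUΩ hw) _).1 (hfZ w hw) a
  rw [h0.fderiv_eq] at key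
  simpa using key.symm

/-- Subfamilies of frames of two subspaces, completing each other to frames of the sum. -/
theorem exists_frame_sup [FiniteDimensional ℝ E] {m n r : ℕ} {P Q : E → Submodule ℝ (E →L[ℝ] ℝ)}
    {ξ : Fin m → E → E →L[ℝ] ℝ} {η : Fin n → E → E →L[ℝ] ℝ} {Ω : Set E} (hΩ : IsOpen Ω) {z0 : E}
    (hz0 : z0 ∈ Ω) (hξ : ∀ i, ContDiffOn ℝ ∞ (ξ i) Ω) (hη : ∀ i, ContDiffOn ℝ ∞ (η i) Ω)
    (hP : ∀ z ∈ Ω, LinearIndependent ℝ (fun i => ξ i z) ∧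
      P z = Submodule.span ℝ (Set.range fun i => ξ i z))
    (hQ : ∀ z ∈ Ω, Q z = Submodule.span ℝ (Set.range fun i => η i z))
    (hr : ∀ z ∈ Ω, Module.finrank ℝ ↥(P z ⊔ Q z) = r) :
    ∃ (T : Set (Fin n)) (U : Set E), IsOpen U ∧ z0 ∈ U ∧ U ⊆ Ω ∧ ∀ z ∈ U,
      LinearIndependent ℝ (fun i => Sum.elim ξ (fun j : T => η j) i z) ∧
      P z ⊔ Q z = Submodule.span ℝ (Set.range fun i => Sum.elim ξ (fun j : T => η j) i z) := by
  obtain ⟨T, hT, hTs⟩ := exists_selection (fun i => ξ i z0) (fun i => η i z0) (hP z0 hz0).1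
  have he : ∀ z, (fun i => Sum.elim ξ (fun j : T => η j) i z) =
      Sum.elim (fun i => ξ i z) (fun j : T => η j z) := by
    intro z
    ext (i | i) <;> rfl
  rw [← he] at hT hTs
  rw [← (hP z0 hz0).2, ← hQ z0 hz0] at hTs
  have := Fintype.ofFinite T
  have hcard : Fintype.card (Fin m ⊕ T) = r := by
    rw [← hr z0 hz0, ← hTs, finrank_span_eq_card hT]
  have hev := eventually_linearIndependent (w := Sum.elim ξ (fun j : T => η j)) (z0 := z0)
    (by
      rintro (i | i)
      · exact ((hξ i).contDiffAt (hΩ.mem_nhds hz0)).continuousAt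
      · exact ((hη i).contDiffAt (hΩ.mem_nhds hz0)).continuousAt) hT
  obtain ⟨U, hU, hUo, hzU⟩ := eventually_nhds_iff.1 hev
  refine ⟨T, U ∩ Ω, hUo.inter hΩ, ⟨hzU, hz0⟩, fun x hx => hx.2, fun z hz => ⟨hU z hz.1, ?_⟩⟩
  symm
  refine Submodule.eq_of_le_of_finrank_eq (Submodule.span_le.2 ?_) ?_
  · rintro _ ⟨i | i, rfl⟩
    · refine Submodule.mem_sup_left ?_
      rw [(hP z hz.2).2]
      exact Submodule.subset_span ⟨i, rfl⟩
    · refine Submodule.mem_sup_right ?_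
      rw [hQ z hz.2]
      exact Submodule.subset_span ⟨_, rfl⟩
  · rw [finrank_span_eq_card (hU z hz.1), hr z hz.2, hcard]

/-- If `dη = ∑ A_i dξ_i + ∑ B_j dη_j` with `η, η_j` first integrals of `Zc`, the `ξ_i` first
integrals of `Zh` and the `dξ_i, dη_j` part of a coframe, then the coefficients `B_j` are first
integrals of `Zc`. -/
theorem IsCommutingFrame.coeff_mem {α β ι κ : Type*} [Fintype ι] [Fintype κ]
    {Zh Zc : E → Submodule ℝ (E →L[ℝ] ℝ)}
    {Ω : Set E} {X : α → E → E} {Y : β → E → E} (h : IsCommutingFrame Zh Zc Ω X Y)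
    (hΩ : IsOpen Ω) {ξ : ι → E → ℝ} {η : κ → E → ℝ} {η₀ : E → ℝ}
    (hξ : ∀ i, ContDiffOn ℝ ∞ (ξ i) Ω) (hη : ∀ i, ContDiffOn ℝ ∞ (η i) Ω)
    (hη₀ : ContDiffOn ℝ ∞ η₀ Ω)
    (hξZ : ∀ z ∈ Ω, firstIntegralsVS Zh z = Submodule.span ℝ (Set.range fun i => fderiv ℝ (ξ i) z))
    (hηZ : ∀ z ∈ Ω, ∀ i, fderiv ℝ (η i) z ∈ Zc z) (hη₀Z : ∀ z ∈ Ω, fderiv ℝ η₀ z ∈ Zc z)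
    (hli : ∀ z ∈ Ω, LinearIndependent ℝ
      (fun i => Sum.elim (fun i => fderiv ℝ (ξ i)) (fun i => fderiv ℝ (η i)) i z))
    {c : ι ⊕ κ → E → ℝ} (hc : ∀ i, ContDiffOn ℝ ∞ (c i) Ω)
    (heq : ∀ z ∈ Ω, fderiv ℝ η₀ z =
      ∑ i, c i z • Sum.elim (fun i => fderiv ℝ (ξ i)) (fun i => fderiv ℝ (η i)) i z) :
    ∀ z ∈ Ω, ∀ j, fderiv ℝ (c (.inr j)) z ∈ Zc z := by
  intro z hz j
  rw [h.mem_right z hz]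
  intro b
  have hn := hΩ.mem_nhds hz
  have hξZh : ∀ z ∈ Ω, ∀ i, fderiv ℝ (ξ i) z ∈ Zh z := fun z hz i =>
    firstIntegralsVS_le Zh z (by rw [hξZ z hz]; exact Submodule.subset_span ⟨i, rfl⟩)
  have dd : ∀ {f : E → ℝ}, ContDiffOn ℝ ∞ f Ω → DifferentiableAt ℝ f z := fun hf =>
    (hf.contDiffAt hn).differentiableAt (by simp)
  have d2 : ∀ {f : E → ℝ}, ContDiffOn ℝ ∞ f Ω → DifferentiableAt ℝ (fderiv ℝ f) z := fun hf =>
    ((contDiffOn_fderiv hΩ hf).contDiffAt hn).differentiableAt (by simp)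
  have dY : DifferentiableAt ℝ (Y b) z :=
    ((h.smooth_right b).contDiffAt hn).differentiableAt (by simp)
  have symm : ∀ {f : E → ℝ}, ContDiffOn ℝ ∞ f Ω → ∀ u v,
      fderiv ℝ (fderiv ℝ f) z u v = fderiv ℝ (fderiv ℝ f) z v u := fun hf u v =>
    (hf.contDiffAt hn).isSymmSndFDerivAt minSmoothness_two_le u v
  -- the identity differentiated
  have e1 : ∀ u v, fderiv ℝ (fderiv ℝ η₀) z u v =
      (∑ i, (c (.inl i) z * fderiv ℝ (fderiv ℝ (ξ i)) z u v +
        fderiv ℝ (c (.inl i)) z u * fderiv ℝ (ξ i) z v)) +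
      ∑ i, (c (.inr i) z * fderiv ℝ (fderiv ℝ (η i)) z u v +
        fderiv ℝ (c (.inr i)) z u * fderiv ℝ (η i) z v) := by
    intro u v
    have h1 : fderiv ℝ η₀ =ᶠ[𝓝 z] fun z => (∑ i, c (.inl i) z • fderiv ℝ (ξ i) z) +
        ∑ i, c (.inr i) z • fderiv ℝ (η i) z := by
      filter_upwards [hn] with w hw
      rw [heq w hw, Fintype.sum_sum_type]
      rfl
    rw [h1.fderiv_eq, fderiv_fun_add, fderiv_fun_sum, fderiv_fun_sum]
    · rw [add_apply, add_apply]
      simp only [FunLike.coe_sum, Finset.sum_apply]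
      congr 1 <;> refine Finset.sum_congr rfl fun i _ => ?_
      · rw [fderiv_fun_smul (dd (hc _)) (d2 (hξ i))]
        simp
      · rw [fderiv_fun_smul (dd (hc _)) (d2 (hη i))]
        simp
    · exact fun i _ => (dd (hc _)).smul (d2 (hη i))
    · exact fun i _ => (dd (hc _)).smul (d2 (hξ i))
    · exact DifferentiableAt.fun_sum fun i _ => (dd (hc _)).smul (d2 (hξ i))
    · exact DifferentiableAt.fun_sum fun i _ => (dd (hc _)).smul (d2 (hη i))
  -- the identity contracted with `Y`, differentiated
  have e2 : ∀ v, ∑ i, (c (.inl i) z * fderiv ℝ (fun z => fderiv ℝ (ξ i) z (Y b z)) z v +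
      fderiv ℝ (c (.inl i)) z v * fderiv ℝ (ξ i) z (Y b z)) = 0 := by
    intro v
    have h1 : (fun z => ∑ i, c (.inl i) z * fderiv ℝ (ξ i) z (Y b z)) =ᶠ[𝓝 z] fun _ => 0 := by
      filter_upwards [hn] with w hw
      have h2 := congrArg (fun ℓ : E →L[ℝ] ℝ => ℓ (Y b w)) (heq w hw)
      simp only [Fintype.sum_sum_type, add_apply,
        FunLike.coe_sum, Finset.sum_apply, Sum.elim_inl, Sum.elim_inr,
        smul_apply, smul_eq_mul] at h2
      rw [(h.mem_right w hw _).1 (hη₀Z w hw) b] at h2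
      have h3 : ∑ i, c (.inr i) w * fderiv ℝ (η i) w (Y b w) = 0 :=
        Finset.sum_eq_zero fun i _ => by rw [(h.mem_right w hw _).1 (hηZ w hw i) b, mul_zero]
      rw [h3, add_zero] at h2
      exact h2.symm
    have h4 := congrArg (fun ℓ : E →L[ℝ] ℝ => ℓ v) h1.fderiv_eq
    rw [fderiv_fun_sum fun i _ => (dd (hc _)).fun_mul ((d2 (hξ i)).clm_apply dY)] at h4
    simp only [FunLike.coe_sum, Finset.sum_apply, fderiv_fun_const] at h4
    rw [← show _ = (0 : ℝ) from h4]
    refine Finset.sum_congr rfl fun i _ => ?_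
    rw [fderiv_fun_mul (dd (hc _)) ((d2 (hξ i)).clm_apply dY)]
    simp [mul_comm]
  -- This is the Lie derivative along `Y` of the identity for `dη₀`. All terms `d(Y η)` vanish,
  -- leaving `∑ Y(B_j) dη_j = -∑ (Y(A_i) dξ_i + A_i d(Y ξ_i))`. The right side lies in the span of
  -- the `dξ` because `Y ξ_i` is again a first integral of `Zh`; independence of the frame then
  -- forces `Y(B_j) = 0`.
  have e3 : ∑ i, (fderiv ℝ (c (.inr i)) z (Y b z)) • fderiv ℝ (η i) z =
      - ∑ i, ((fderiv ℝ (c (.inl i)) z (Y b z)) • fderiv ℝ (ξ i) z +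
        c (.inl i) z • fderiv ℝ (fun z => fderiv ℝ (ξ i) z (Y b z)) z) := by
    ext v
    have s1 := e1 (Y b z) v
    have s2 := e1 v (Y b z)
    rw [symm hη₀, s2] at s1
    have s3 : ∑ i, (c (.inr i) z * fderiv ℝ (fderiv ℝ (η i)) z v (Y b z) +
        fderiv ℝ (c (.inr i)) z v * fderiv ℝ (η i) z (Y b z)) =
        ∑ i, c (.inr i) z * fderiv ℝ (fderiv ℝ (η i)) z (Y b z) v := by
      refine Finset.sum_congr rfl fun i _ => ?_
      rw [(h.mem_right z hz _).1 (hηZ z hz i) b, symm (hη i) v, mul_zero, add_zero]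
    rw [s3] at s1
    have s4 := e2 v
    simp only [fun i => symm (hξ i) v (Y b z)] at s1
    simp only [Finset.sum_add_distrib] at s1 s4 ⊢
    simp only [neg_apply, add_apply,
        FunLike.coe_sum, Finset.sum_apply,
        smul_apply, smul_eq_mul]
    linarith
  have e4 : ∑ i, (fderiv ℝ (c (.inr i)) z (Y b z)) • fderiv ℝ (η i) z ∈
      Submodule.span ℝ (Set.range fun i => fderiv ℝ (ξ i) z) := by
    rw [e3]
    refine Submodule.neg_mem _ (Submodule.sum_mem _ fun i _ => Submodule.add_mem _ ?_ ?_)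
    · exact Submodule.smul_mem _ _ (Submodule.subset_span ⟨i, rfl⟩)
    · refine Submodule.smul_mem _ _ ?_
      rw [← hξZ z hz]
      refine fderiv_mem_firstIntegralsVS hΩ ?_ (h.fderiv_apply_mem hΩ subset_rfl (hξ i)
        (fun z hz => hξZh z hz i) b) hz
      exact (contDiffOn_fderiv hΩ (hξ i)).clm_apply (h.smooth_right b)
  obtain ⟨d, hd⟩ := (Submodule.mem_span_range_iff_exists_fun ℝ).1 e4
  have e5 := Fintype.linearIndependent_iff.1 (hli z hz)
    (Sum.elim (fun i => - d i) (fun i => fderiv ℝ (c (.inr i)) z (Y b z)))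
    (by
      rw [Fintype.sum_sum_type]
      simp only [Sum.elim_inl, Sum.elim_inr, neg_smul, Finset.sum_neg_distrib]
      rw [hd, neg_add_cancel]) (.inr j)
  exact e5

end VectorSpace

/-! ### A common first integral from a nonzero intersection. -/

section VectorSpace

open Filter VectorField

variable {E : Type*} [NormedAddCommGroup E] [NormedSpace ℝ E]

theorem fderiv_apply_of_comp_eventuallyEq {β : Type*} {η : β → E → ℝ} {g : E → E} {z : E}
    (hg : DifferentiableAt ℝ g z) (hη : ∀ j, DifferentiableAt ℝ (η j) (g z))
    (hηg : ∀ j, (fun z => η j (g z)) =ᶠ[𝓝 z] η j) (j : β) (v : E) :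
    fderiv ℝ (η j) (g z) (fderiv ℝ g z v) = fderiv ℝ (η j) z v := by
  rw [← (hηg j).fderiv_eq, fderiv_fun_comp z (hη j) hg]
  rfl

/-- Two families of first integrals of complementary systems annihilated by commuting frames: if
`P ∩ Q` has constant rank and is nonzero, it contains the differential of a function. -/
theorem IsCommutingFrame.exists_common_integral [FiniteDimensional ℝ E] {α β : Type*}
    {Zh Zc : E → Submodule ℝ (E →L[ℝ] ℝ)}
    {Ω : Set E} {X : α → E → E} {Y : β → E → E} (h : IsCommutingFrame Zh Zc Ω X Y)
    (hΩ : IsOpen Ω) {z0 : E} (hz0 : z0 ∈ Ω) {m n r : ℕ}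
    (hm : ∀ z ∈ Ω, Module.finrank ℝ (firstIntegralsVS Zh z) = m)
    (hn : ∀ z ∈ Ω, Module.finrank ℝ (firstIntegralsVS Zc z) = n)
    (hr : ∀ z ∈ Ω, Module.finrank ℝ ↥(firstIntegralsVS Zh z ⊓ firstIntegralsVS Zc z) = r)
    (hne : firstIntegralsVS Zh z0 ⊓ firstIntegralsVS Zc z0 ≠ ⊥) :
    firstIntegralsVS (fun z => Zh z ⊓ Zc z) z0 ≠ ⊥ := by
  obtain ⟨U1, ξ, hU1, hz1, hU1Ω, hξ, hξb⟩ := exists_basis_firstIntegralsVS hΩ hz0 hm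
  obtain ⟨U2, η, hU2, hz2, hU2Ω, hη, hηb⟩ := exists_basis_firstIntegralsVS hU1 hz1
    (fun z hz => hn z (hU1Ω hz))
  replace hξ := fun i => (hξ i).mono hU2Ω
  replace hξb := fun z hz => hξb z (hU2Ω hz)
  -- The sum `P + Q` has constant rank because `P`, `Q` and `P ∩ Q` do; this is what makes frames of
  -- the sum at `z0` persist nearby.
  have hr1 : ∀ z ∈ U2, Module.finrank ℝ ↥(firstIntegralsVS Zh z ⊔ firstIntegralsVS Zc z) =
      m + n - r := by
    intro z hz
    have hzΩ := hU1Ω (hU2Ω hz)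
    have := Submodule.finrank_sup_add_finrank_inf_eq (firstIntegralsVS Zh z) (firstIntegralsVS Zc z)
    rw [hm z hzΩ, hn z hzΩ, hr z hzΩ] at this
    omega
  have hr2 : ∀ z ∈ U2, Module.finrank ℝ ↥(firstIntegralsVS Zc z ⊔ firstIntegralsVS Zh z) =
      m + n - r := fun z hz => by rw [sup_comm, hr1 z hz]
  have hdξ := fun i => contDiffOn_fderiv hU2 (hξ i)
  have hdη := fun i => contDiffOn_fderiv hU2 (hη i)
  -- Two frames of the same sum with different roles. In `dξ, dη_T` membership in `P` is the
  -- vanishing of the `T` coefficients; `dη, dξ_S` is the frame adapted to the slice.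
  obtain ⟨T, U3, hU3, hz3, hU3Ω, hT⟩ := exists_frame_sup hU2 hz2 hdξ hdη hξb
    (fun z hz => (hηb z hz).2) hr1
  obtain ⟨S, U4, hU4, hz4, hU4Ω, hS⟩ := exists_frame_sup hU3 hz3
    (fun i => (hdη i).mono hU3Ω) (fun i => (hdξ i).mono hU3Ω) (fun z hz => hηb z (hU3Ω hz))
    (fun z hz => (hξb z (hU3Ω hz)).2) (fun z hz => hr2 z (hU3Ω hz))
  have hU42 : U4 ⊆ U2 := hU4Ω.trans hU3Ω
  have hU4Ω' : U4 ⊆ Ω := hU42.trans (hU2Ω.trans hU1Ω)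
  have := Fintype.ofFinite T
  have := Fintype.ofFinite S
  have hξP : ∀ z ∈ U4, ∀ i, fderiv ℝ (ξ i) z ∈ firstIntegralsVS Zh z := fun z hz i => by
    rw [(hξb z (hU42 hz)).2]; exact Submodule.subset_span ⟨i, rfl⟩
  have hηQ : ∀ z ∈ U4, ∀ i, fderiv ℝ (η i) z ∈ firstIntegralsVS Zc z := fun z hz i => by
    rw [(hηb z (hU42 hz)).2]; exact Submodule.subset_span ⟨i, rfl⟩
  -- the coefficients of `dη` in the frame `dξ, dη_T`
  have hcoef : ∀ s, ∃ c : Fin m ⊕ T → E → ℝ, (∀ i, ContDiffOn ℝ ∞ (c i) U4) ∧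
      ∀ z ∈ U4, fderiv ℝ (η s) z = ∑ i, c i z •
        Sum.elim (fun i => fderiv ℝ (ξ i)) (fun i : T => fderiv ℝ (η i)) i z := by
    intro s
    refine exists_smooth_coeff hU4 ?_ ((hdη s).mono hU42) (fun z hz => (hT z (hU4Ω hz)).1) ?_
    · rintro (i | i)
      · exact (hdξ i).mono hU42
      · exact (hdη i).mono hU42
    · intro z hz
      rw [← (hT z (hU4Ω hz)).2]
      exact Submodule.mem_sup_right (hηQ z hz s)
  choose c hc hcη using hcoef
  have hcQ : ∀ s, ∀ z ∈ U4, ∀ j, fderiv ℝ (c s (.inr j)) z ∈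
      Submodule.span ℝ (Set.range fun i => fderiv ℝ (η i) z) := by
    intro s z hz j
    rw [← (hηb z (hU42 hz)).2]
    have hframe : IsCommutingFrame Zh Zc U4 X Y :=
      ⟨fun a => (h.smooth_left a).mono hU4Ω', fun a => (h.smooth_right a).mono hU4Ω',
        fun z hz => h.mem_left z (hU4Ω' hz), fun z hz => h.mem_right z (hU4Ω' hz),
        fun z hz => h.lieBracket_eq_zero z (hU4Ω' hz)⟩
    refine fderiv_mem_firstIntegralsVS hU4 (hc s _) (fun z hz => hframe.coeff_mem hU4
      (fun i => (hξ i).mono hU42) (fun i : T => (hη i).mono hU42) ((hη s).mono hU42)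
      (fun z hz => (hξb z (hU42 hz)).2)
      (fun z hz i => firstIntegralsVS_le _ _ (hηQ z hz i))
      (fun z hz => firstIntegralsVS_le _ _ (hηQ z hz s))
      (fun z hz => (hT z (hU4Ω hz)).1) (hc s) (hcη s) z hz j) hz
  -- a function `ξ i0` not needed for the frame `dη, dξ_S`
  obtain ⟨i0, hi0⟩ : ∃ i0, i0 ∉ S := by
    -- If `S` contained every index, all the `dη` and `dξ` together would be independent, and `P ∩
    -- Q` would be zero at `z0`.
    by_contra! hall
    refine hne ?_
    rw [(hξb z0 hz2).2, (hηb z0 hz2).2]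
    have hli := (hS z0 hz4).1
    have := hli.comp (Sum.map id fun i : Fin m => (⟨i, hall i⟩ : S))
      (Function.Injective.sumMap Function.injective_id fun i j hij => by simpa using hij)
    have h2 : Disjoint (Submodule.span ℝ (Set.range fun i => fderiv ℝ (η i) z0))
        (Submodule.span ℝ (Set.range fun i => fderiv ℝ (ξ i) z0)) :=
      (linearIndependent_sum.1 this).2.2
    exact h2.symm.eq_bot
  have hli0 : LinearIndependent ℝ
      (Sum.elim (fun i : S => fderiv ℝ (ξ i) z0) (fun i => fderiv ℝ (η i) z0)) := by
    have e1 : Sum.elim (fun i : S => fderiv ℝ (ξ i) z0) (fun i => fderiv ℝ (η i) z0) =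
        (fun i => Sum.elim (fun i => fderiv ℝ (η i)) (fun i : S => fderiv ℝ (ξ i)) i z0) ∘
          Sum.swap := by
      ext (i | i) <;> rfl
    rw [e1]
    exact (hS z0 hz4).1.comp _ (Equiv.sumComm _ _).injective
  obtain ⟨U, g, hU, hzU, hUΩ, hg, hgU, hg0, hgσ, hgB⟩ := exists_slice hU4 hz4
    (fun i : S => (hξ i).mono hU42) (fun i => (hη i).mono hU42) hli0
  -- the differential of `ξ i0 ∘ g`
  have hU2' : U ⊆ U2 := hUΩ.trans hU42
  have dat : ∀ {f : E → ℝ}, ContDiffOn ℝ ∞ f U2 → ∀ z ∈ U, DifferentiableAt ℝ f z :=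
    fun hf z hz => (hf.contDiffAt (hU2.mem_nhds (hU2' hz))).differentiableAt (by simp)
  have dg : ∀ z ∈ U, DifferentiableAt ℝ g z := fun z hz =>
    (hg.contDiffAt (hU.mem_nhds hz)).differentiableAt (by simp)
  -- In the frame `dη, dξ_S` at `g z`, pulling back by `g` kills the `dξ_S` and carries `dη_j` at `g
  -- z` to `dη_j` at `z`. Thus the coefficients `d` found at `g z` also describe the pulled back
  -- differential at `z`.
  have key : ∀ z ∈ U, ∃ (a : S → ℝ) (d : Fin n → ℝ),
      fderiv ℝ (ξ i0) (g z) = ∑ j, d j • fderiv ℝ (η j) (g z) + ∑ i, a i • fderiv ℝ (ξ i) (g z) ∧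
      fderiv ℝ (fun z => ξ i0 (g z)) z = ∑ j, d j • fderiv ℝ (η j) z := by
    intro z hz
    have h1 : fderiv ℝ (ξ i0) (g z) ∈ Submodule.span ℝ (Set.range fun i =>
        Sum.elim (fun i => fderiv ℝ (η i)) (fun i : S => fderiv ℝ (ξ i)) i (g z)) := by
      rw [← (hS _ (hUΩ (hgU hz))).2]
      exact Submodule.mem_sup_right (hξP _ (hUΩ (hgU hz)) i0)
    obtain ⟨q, hq⟩ := (Submodule.mem_span_range_iff_exists_fun ℝ).1 h1
    rw [Fintype.sum_sum_type] at hq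
    simp only [Sum.elim_inl, Sum.elim_inr] at hq
    refine ⟨fun i => q (.inr i), fun i => q (.inl i), hq.symm, ?_⟩
    ext v
    rw [fderiv_fun_comp z (dat (hξ i0) _ (hgU hz)) (dg z hz), ContinuousLinearMap.comp_apply, ← hq,
      add_apply]
    have h2 : ∀ i : S, fderiv ℝ (ξ i) (g z) (fderiv ℝ g z v) = 0 := by
      intro i
      have h3 : (fun z => ξ i (g z)) =ᶠ[𝓝 z] fun _ => ξ i z0 := by
        filter_upwards [hU.mem_nhds hz] with w hw using hgσ i w hw
      have h4 := congrArg (fun ℓ : E →L[ℝ] ℝ => ℓ v) h3.fderiv_eq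
      rw [fderiv_fun_comp z (dat (hξ i) _ (hgU hz)) (dg z hz)] at h4
      simpa using h4
    have h5 : ∀ j, fderiv ℝ (η j) (g z) (fderiv ℝ g z v) = fderiv ℝ (η j) z v := by
      intro j
      refine fderiv_apply_of_comp_eventuallyEq (dg z hz) (fun j => dat (hη j) _ (hgU hz))
        (fun j => ?_) j v
      filter_upwards [hU.mem_nhds hz] with w hw
      exact hgB (η j) ((hη j).mono hU2') (fun z hz => Submodule.subset_span ⟨j, rfl⟩) w hw
    simp only [FunLike.coe_sum, Finset.sum_apply, smul_apply, h2, h5, smul_zero,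
      Finset.sum_const_zero, add_zero]
  -- it belongs to both families
  have hmem : ∀ z ∈ U, fderiv ℝ (fun z => ξ i0 (g z)) z ∈ Zh z ⊓ Zc z := by
    intro z hz
    obtain ⟨a, d, h1, h2⟩ := key z hz
    have hgz := hUΩ (hgU hz)
    refine ⟨firstIntegralsVS_le _ _ ?_, firstIntegralsVS_le _ _ ?_⟩
    · -- expand in the frame `dξ, dη_T`
      have h3 : ∀ w ∈ U4, ∑ j, d j • fderiv ℝ (η j) w =
          (∑ i, (∑ j, d j * c j (.inl i) w) • fderiv ℝ (ξ i) w) +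
            ∑ i : T, (∑ j, d j * c j (.inr i) w) • fderiv ℝ (η i) w := by
        intro w hw
        calc ∑ j, d j • fderiv ℝ (η j) w = ∑ j, ∑ i, (d j * c j i w) •
              Sum.elim (fun i => fderiv ℝ (ξ i)) (fun i : T => fderiv ℝ (η i)) i w := by
              refine Finset.sum_congr rfl fun j _ => ?_
              rw [hcη j w hw, Finset.smul_sum]
              simp only [mul_smul]
          _ = _ := by
              rw [Finset.sum_comm, Fintype.sum_sum_type]
              simp only [Sum.elim_inl, Sum.elim_inr, Finset.sum_smul]
      have h4 : ∑ j, d j • fderiv ℝ (η j) (g z) ∈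
          Submodule.span ℝ (Set.range fun i => fderiv ℝ (ξ i) (g z)) := by
        rw [← (hξb _ (hU42 hgz)).2, ← sub_eq_iff_eq_add.2 h1]
        refine Submodule.sub_mem _ (hξP _ hgz i0) (Submodule.sum_mem _ fun i _ =>
          Submodule.smul_mem _ _ (hξP _ hgz i))
      obtain ⟨p, hp⟩ := (Submodule.mem_span_range_iff_exists_fun ℝ).1 h4
      rw [h3 _ hgz] at hp
      have h5 : ∀ i : T, ∑ j, d j * c j (.inr i) (g z) = 0 := by
        intro i
        refine Fintype.linearIndependent_iff.1 (hT _ (hU4Ω hgz)).1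
          (Sum.elim (fun i => (∑ j, d j * c j (.inl i) (g z)) - p i)
            fun i => ∑ j, d j * c j (.inr i) (g z)) ?_ (.inr i)
        rw [Fintype.sum_sum_type]
        simp only [Sum.elim_inl, Sum.elim_inr, sub_smul, Finset.sum_sub_distrib]
        rw [hp]
        abel
      -- The `T` coefficients of `∑ d_j dη_j` vanish at `g z`, where this combination lies in `P`.
      -- The functions `c j (.inr i)` take equal values at `z` and `g z`, so the `T` coefficients
      -- vanish at `z` too, with the same constants `d`.
      have h6 : ∀ i : T, ∑ j, d j * c j (.inr i) z = 0 := by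
        intro i
        rw [← h5 i]
        refine Finset.sum_congr rfl fun j _ => ?_
        rw [hgB (c j (.inr i)) ((hc j _).mono hUΩ) (fun z hz => hcQ j z (hUΩ hz) i) z hz]
      rw [h2, h3 z (hUΩ hz)]
      simp only [h6, zero_smul, Finset.sum_const_zero, add_zero]
      exact Submodule.sum_mem _ fun i _ => Submodule.smul_mem _ _ (hξP _ (hUΩ hz) i)
    · rw [h2]
      exact Submodule.sum_mem _ fun i _ => Submodule.smul_mem _ _ (hηQ _ (hUΩ hz) i)
  have hG : ContDiffOn ℝ ∞ (fun z => ξ i0 (g z)) U :=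
    ((hξ i0).mono hU2').comp hg hgU
  intro hbot
  have h7 := fderiv_mem_firstIntegralsVS (Z := fun z => Zh z ⊓ Zc z) hU hG hmem hzU
  rw [hbot, Submodule.mem_bot] at h7
  -- Since `g z0 = z0`, a vanishing differential at `z0` would put `dξ_{i0}` in the span of the
  -- `dξ_S`, against the independence of the `dξ` and `i0 ∉ S`.
  obtain ⟨a, d, h1, h2⟩ := key z0 hzU
  rw [hg0] at h1
  rw [← h2, h7, zero_add] at h1
  have h8 := (hξb z0 hz2).1.notMem_span_image (s := S) (x := i0) hi0
  refine h8 ?_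
  rw [h1]
  exact Submodule.sum_mem _ fun i _ => Submodule.smul_mem _ _
    (Submodule.subset_span ⟨i, i.2, rfl⟩)

end VectorSpace

/-! ### Construction of the commuting frames from a dual frame. -/

section VectorSpace

open Filter VectorField

variable {E : Type*} [NormedAddCommGroup E] [NormedSpace ℝ E]

theorem eq_sum_of_dual {ι : Type*} [Fintype ι] [DecidableEq ι] {w : ι → E →L[ℝ] ℝ} {e : ι → E}
    (hspan : Submodule.span ℝ (Set.range w) = ⊤)
    (hdual : ∀ i j, w i (e j) = if i = j then 1 else 0) (ℓ : E →L[ℝ] ℝ) :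
    ℓ = ∑ i, ℓ (e i) • w i := by
  obtain ⟨c, hc⟩ := (Submodule.mem_span_range_iff_exists_fun ℝ).1
    (show ℓ ∈ Submodule.span ℝ (Set.range w) by rw [hspan]; trivial)
  have : ∀ j, ℓ (e j) = c j := by
    intro j
    rw [← hc]
    simp [hdual]
  simp only [this, hc]

/-- Split `ℓ` along the coframe. The part outside `S` is in `A`, so if `ℓ ∈ A` the part along `S` is
in `A ⊓ B`, where its coefficients are zero. This identifies the annihilators of the two systems
with spans of dual vectors. -/
theorem mem_iff_of_dual {ι : Type*} [Fintype ι] [DecidableEq ι] {w : ι → E →L[ℝ] ℝ} {e : ι → E}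
    (hspan : Submodule.span ℝ (Set.range w) = ⊤)
    (hdual : ∀ i j, w i (e j) = if i = j then 1 else 0) {A B : Submodule ℝ (E →L[ℝ] ℝ)}
    (S : ι → Prop) (hA : ∀ i, ¬ S i → w i ∈ A) (hB : ∀ i, S i → w i ∈ B)
    (hAB : ∀ ℓ ∈ A ⊓ B, ∀ i, S i → ℓ (e i) = 0) (ℓ : E →L[ℝ] ℝ) :
    ℓ ∈ A ↔ ∀ i, S i → ℓ (e i) = 0 := by
  classical
  have hℓ := eq_sum_of_dual hspan hdual ℓ
  have hsplit := Finset.sum_filter_add_sum_filter_not Finset.univ S (fun i => ℓ (e i) • w i)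
  rw [← hℓ] at hsplit
  have hrest : ∑ i with ¬ S i, ℓ (e i) • w i ∈ A := Submodule.sum_mem _ fun i hi =>
    Submodule.smul_mem _ _ (hA i (Finset.mem_filter.1 hi).2)
  constructor
  · intro hmem i hi
    have hb : ∑ i with S i, ℓ (e i) • w i ∈ A ⊓ B := by
      refine ⟨?_, Submodule.sum_mem _ fun i hi =>
        Submodule.smul_mem _ _ (hB i (Finset.mem_filter.1 hi).2)⟩
      rw [← eq_sub_iff_add_eq] at hsplit
      rw [hsplit]
      exact Submodule.sub_mem _ hmem hrest
    have := hAB _ hb i hi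
    rw [FunLike.coe_sum, Finset.sum_apply, Finset.sum_eq_single i] at this
    · simpa [hdual] using this
    · intro j _ hj
      simp [hdual, hj]
    · simp [hi]
  · intro h0
    rw [← hsplit]
    refine Submodule.add_mem _ (Submodule.sum_mem _ fun i hi => ?_) hrest
    rw [h0 i (Finset.mem_filter.1 hi).2, zero_smul]
    exact Submodule.zero_mem _

/-- Dual frame fields commute if the coframe is closed on them. -/
theorem lieBracket_dual_eq_zero {ι : Type*} [Fintype ι] [DecidableEq ι] {Ω : Set E}
    (hΩ : IsOpen Ω) {w : ι → E → E →L[ℝ] ℝ} {X : ι → E → E}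
    (hw : ∀ i, ContDiffOn ℝ ∞ (w i) Ω) (hX : ∀ i, ContDiffOn ℝ ∞ (X i) Ω)
    (hspan : ∀ z ∈ Ω, Submodule.span ℝ (Set.range fun i => w i z) = ⊤)
    (hdual : ∀ z ∈ Ω, ∀ i j, w i z (X j z) = if i = j then 1 else 0) {a b : ι} {z : E}
    (hz : z ∈ Ω)
    (hcl : ∀ i, fderiv ℝ (w i) z (X a z) (X b z) = fderiv ℝ (w i) z (X b z) (X a z)) :
    lieBracket ℝ (X a) (X b) z = 0 := by
  have hn := hΩ.mem_nhds hz
  have dw : ∀ i, DifferentiableAt ℝ (w i) z := fun i =>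
    ((hw i).contDiffAt hn).differentiableAt (by simp)
  have dX : ∀ i, DifferentiableAt ℝ (X i) z := fun i =>
    ((hX i).contDiffAt hn).differentiableAt (by simp)
  have h1 : ∀ i j u, w i z (fderiv ℝ (X j) z u) = - fderiv ℝ (w i) z u (X j z) := by
    intro i j u
    have h2 : (fun z => w i z (X j z)) =ᶠ[𝓝 z] fun _ => if i = j then (1 : ℝ) else 0 := by
      filter_upwards [hn] with y hy using hdual y hy i j
    have h3 := congrArg (fun ℓ : E →L[ℝ] ℝ => ℓ u) h2.fderiv_eq
    rw [fderiv_clm_apply (dw i) (dX j)] at h3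
    simp at h3
    linarith
  -- Differentiating the constants `w_i(X_j)` gives `w_i([X_a, X_b]) = -dw_i(X_a, X_b)`, which is
  -- zero by `hcl`.
  have h4 : ∀ i, w i z (lieBracket ℝ (X a) (X b) z) = 0 := by
    intro i
    rw [lieBracket_eq]
    simp only [map_sub, h1, hcl]
    ring
  by_contra hne
  obtain ⟨ℓ, hℓ⟩ := SeparatingDual.exists_ne_zero (R := ℝ) hne
  refine hℓ ?_
  rw [eq_sum_of_dual (hspan z hz) (hdual z hz) ℓ]
  simp [h4]

/-- The common first integrals of two systems `Zh`, `Zc` as in Darboux integrability: if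
the first integrals of `Zh` and of `Zc` have a common differential, then so does `Zh ∩ Zc`. -/
theorem exists_common_integral [FiniteDimensional ℝ E]
    {Zh Zc : E → Submodule ℝ (E →L[ℝ] ℝ)} {Ω : Set E} (hΩ : IsOpen Ω) {z0 : E} (hz0 : z0 ∈ Ω)
    {s m n r : ℕ} {θ : Fin s → E → E →L[ℝ] ℝ} (hθ : ∀ e, ContDiffOn ℝ ∞ (θ e) Ω)
    (hθli : LinearIndependent ℝ (fun e => θ e z0))
    (hinf : ∀ z ∈ Ω, Zh z ⊓ Zc z = Submodule.span ℝ (Set.range fun e => θ e z))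
    (hd : ∀ z ∈ Ω, ∀ e u v, (∀ ℓ ∈ Zh z, ℓ u = 0) → (∀ ℓ ∈ Zc z, ℓ v = 0) →
      fderiv ℝ (θ e) z u v = fderiv ℝ (θ e) z v u)
    (hsuph : Zh z0 ⊔ firstIntegralsVS Zc z0 = ⊤) (hsupc : Zc z0 ⊔ firstIntegralsVS Zh z0 = ⊤)
    (hm : ∀ z ∈ Ω, Module.finrank ℝ (firstIntegralsVS Zh z) = m)
    (hn : ∀ z ∈ Ω, Module.finrank ℝ (firstIntegralsVS Zc z) = n)
    (hr : ∀ z ∈ Ω, Module.finrank ℝ ↥(firstIntegralsVS Zh z ⊓ firstIntegralsVS Zc z) = r)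
    (hne : firstIntegralsVS Zh z0 ⊓ firstIntegralsVS Zc z0 ≠ ⊥) :
    firstIntegralsVS (fun z => Zh z ⊓ Zc z) z0 ≠ ⊥ := by
  classical
  obtain ⟨U1, ξ, hU1, hz1, hU1Ω, hξ, hξb⟩ := exists_basis_firstIntegralsVS hΩ hz0 hm
  obtain ⟨U2, η, hU2, hz2, hU2Ω, hη, hηb⟩ := exists_basis_firstIntegralsVS hU1 hz1
    (fun z hz => hn z (hU1Ω hz))
  replace hξ := fun i => (hξ i).mono hU2Ω
  replace hξb := fun z hz => hξb z (hU2Ω hz)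
  have hU2Ω' := hU2Ω.trans hU1Ω
  obtain ⟨S, hS, hSs⟩ := exists_selection _ (fun i => fderiv ℝ (ξ i) z0) hθli
  obtain ⟨T, hT, hTs⟩ := exists_selection _ (fun i => fderiv ℝ (η i) z0) hS
  have := Fintype.ofFinite S
  have := Fintype.ofFinite T
  rw [hSs, ← hinf z0 hz0, ← (hξb z0 hz2).2, ← (hηb z0 hz2).2] at hTs
  -- By the modular law `Zh = (Zh ∩ Zc) + Zh^∞`, because `Zh^∞ ≤ Zh` and `Zc + Zh^∞` is everything.
  -- Hence `θ, dξ, dη` span the whole dual.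
  have htop : Zh z0 ⊓ Zc z0 ⊔ firstIntegralsVS Zh z0 ⊔ firstIntegralsVS Zc z0 = ⊤ := by
    have h1 : Zh z0 ⊓ Zc z0 ⊔ firstIntegralsVS Zh z0 = Zh z0 := by
      rw [inf_sup_assoc_of_le _ (firstIntegralsVS_le Zh z0), hsupc, inf_top_eq]
    rw [h1, hsuph]
  rw [htop] at hTs
  let w : (Fin s ⊕ S) ⊕ T → E → E →L[ℝ] ℝ := Sum.elim
    (Sum.elim θ (fun i => fderiv ℝ (ξ i))) (fun i => fderiv ℝ (η i))
  have hw : ∀ i, ContDiffOn ℝ ∞ (w i) U2 := by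
    rintro ((i | i) | i)
    · exact (hθ i).mono hU2Ω'
    · exact contDiffOn_fderiv hU2 (hξ i)
    · exact contDiffOn_fderiv hU2 (hη i)
  have hw0 : (fun i => w i z0) = Sum.elim (Sum.elim (fun e => θ e z0)
      (fun i : S => fderiv ℝ (ξ i) z0)) (fun i : T => fderiv ℝ (η i) z0) := by
    ext ((i | i) | i) <;> rfl
  rw [← hw0] at hT hTs
  have hcard : Fintype.card ((Fin s ⊕ S) ⊕ T) = Module.finrank ℝ (E →L[ℝ] ℝ) := by
    rw [← finrank_top, ← hTs, finrank_span_eq_card hT]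
  obtain ⟨U3, hU3, hU3o, hz3⟩ := eventually_nhds_iff.1 (eventually_linearIndependent (w := w)
    (fun i => ((hw i).contDiffAt (hU2.mem_nhds hz2)).continuousAt) hT)
  let U := U3 ∩ U2
  have hU : IsOpen U := hU3o.inter hU2
  have hli : ∀ z ∈ U, LinearIndependent ℝ (fun i => w i z) := fun z hz => hU3 z hz.1
  have hspan : ∀ z ∈ U, Submodule.span ℝ (Set.range fun i => w i z) = ⊤ := fun z hz =>
    Submodule.eq_top_of_finrank_eq (by rw [finrank_span_eq_card (hli z hz), hcard])
  have hUΩ : U ⊆ Ω := fun z hz => hU2Ω' hz.2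
  obtain ⟨X, hX, hdual⟩ := exists_dual_frame hU (fun i => (hw i).mono fun z hz => hz.2) hli hspan
  have hθm : ∀ z ∈ U, ∀ i, θ i z ∈ Zh z ⊓ Zc z := fun z hz i => by
    rw [hinf z (hUΩ hz)]; exact Submodule.subset_span ⟨i, rfl⟩
  have hξm : ∀ z ∈ U, ∀ i, fderiv ℝ (ξ i) z ∈ Zh z := fun z hz i =>
    firstIntegralsVS_le _ _ (by rw [(hξb z hz.2).2]; exact Submodule.subset_span ⟨i, rfl⟩)
  have hηm : ∀ z ∈ U, ∀ i, fderiv ℝ (η i) z ∈ Zc z := fun z hz i =>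
    firstIntegralsVS_le _ _ (by rw [(hηb z hz.2).2]; exact Submodule.subset_span ⟨i, rfl⟩)
  have hθ0 : ∀ z ∈ U, ∀ ℓ ∈ Zh z ⊓ Zc z, ∀ i : (Fin s ⊕ S) ⊕ T, (∀ e, i ≠ .inl (.inl e)) →
      ℓ (X i z) = 0 := by
    intro z hz ℓ hℓ i hi
    rw [hinf z (hUΩ hz)] at hℓ
    induction hℓ using Submodule.span_induction with
    | mem x h =>
      obtain ⟨e, rfl⟩ := h
      exact (hdual z hz (.inl (.inl e)) i).trans (if_neg (hi e).symm)
    | zero => rfl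
    | add x y _ _ hx hy => simp [hx, hy]
    | smul a x _ hx => simp [hx]
  have memh : ∀ z ∈ U, ∀ ℓ, ℓ ∈ Zh z ↔ ∀ a : T, ℓ (X (.inr a) z) = 0 := by
    intro z hz ℓ
    refine (mem_iff_of_dual (B := Zc z) (hspan z hz) (hdual z hz)
      (fun i => ∃ a, i = .inr a) ?_ ?_ ?_ ℓ).trans ⟨fun h a => h _ ⟨a, rfl⟩, ?_⟩
    · rintro ((i | i) | i) h
      · exact (hθm z hz i).1
      · exact hξm z hz i
      · exact absurd ⟨i, rfl⟩ h
    · rintro _ ⟨a, rfl⟩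
      exact hηm z hz a
    · rintro ℓ hℓ _ ⟨a, rfl⟩
      exact hθ0 z hz ℓ hℓ _ (by simp)
    · rintro h _ ⟨a, rfl⟩
      exact h a
  have memc : ∀ z ∈ U, ∀ ℓ, ℓ ∈ Zc z ↔ ∀ a : S, ℓ (X (.inl (.inr a)) z) = 0 := by
    intro z hz ℓ
    refine (mem_iff_of_dual (B := Zh z) (hspan z hz) (hdual z hz)
      (fun i => ∃ a, i = .inl (.inr a)) ?_ ?_ ?_ ℓ).trans ⟨fun h a => h _ ⟨a, rfl⟩, ?_⟩
    · rintro ((i | i) | i) h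
      · exact (hθm z hz i).2
      · exact absurd ⟨i, rfl⟩ h
      · exact hηm z hz i
    · rintro _ ⟨a, rfl⟩
      exact hξm z hz a
    · rintro ℓ hℓ _ ⟨a, rfl⟩
      rw [inf_comm] at hℓ
      exact hθ0 z hz ℓ hℓ _ (by simp)
    · rintro h _ ⟨a, rfl⟩
      exact h a
  have hframe : IsCommutingFrame Zh Zc U (fun a : T => X (.inr a))
      (fun b : S => X (.inl (.inr b))) := by
    refine ⟨fun a => hX _, fun b => hX _, memh, memc, fun z hz a b => ?_⟩
    refine lieBracket_dual_eq_zero hU (fun i => (hw i).mono fun z hz => hz.2) hX hspan hdual hz ?_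
    have hsymm : ∀ {f : E → ℝ}, ContDiffOn ℝ ∞ f U2 → ∀ u v,
        fderiv ℝ (fderiv ℝ f) z u v = fderiv ℝ (fderiv ℝ f) z v u := fun hf u v =>
      (hf.contDiffAt (hU2.mem_nhds hz.2)).isSymmSndFDerivAt minSmoothness_two_le u v
    -- Closedness on `(X, Y)` is automatic for the exact members `dξ`, `dη` of the coframe, by
    -- symmetry of second derivatives. Only the `θ` need the structure hypothesis `hd`.
    rintro ((i | i) | i)
    · exact hd z (hUΩ hz) i _ _ (fun ℓ hℓ => (memh z hz ℓ).1 hℓ a)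
        (fun ℓ hℓ => (memc z hz ℓ).1 hℓ b)
    · exact hsymm (hξ i) _ _
    · exact hsymm (hη i) _ _
  exact hframe.exists_common_integral hU ⟨hz3, hz2⟩ (fun z hz => hm z (hUΩ hz))
    (fun z hz => hn z (hUΩ hz)) (fun z hz => hr z (hUΩ hz)) hne

end VectorSpace

/-! ### Wedge products and smooth families of alternating forms in finite dimension. -/

section Multilinear

theorem wedge_apply {V : Type*} [AddCommGroup V] [Module ℝ V] [TopologicalSpace V] {k l : ℕ}
    (α : V [⋀^Fin k]→L[ℝ] ℝ) (β : V [⋀^Fin l]→L[ℝ] ℝ) (v : Fin (k + l) → V) :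
    wedge α β v = ∑ σ : Equiv.Perm.ModSumCongr (Fin k) (Fin l),
      ((Equiv.Perm.sign σ.out : ℤ) : ℝ) * (α (fun i => v (finSumFinEquiv (σ.out (Sum.inl i)))) *
        β (fun i => v (finSumFinEquiv (σ.out (Sum.inr i))))) := by
  have h : wedge α β v = ∑ σ : Equiv.Perm.ModSumCongr (Fin k) (Fin l),
      LinearMap.mul' ℝ ℝ (AlternatingMap.domCoprod.summand α.toAlternatingMap β.toAlternatingMap σ
        (fun i => v (finSumFinEquiv i))) := by
    change wedgeAlt α β v = _
    simp [wedgeAlt, AlternatingMap.domCoprod_apply, Function.comp_def]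
  rw [h]
  refine Finset.sum_congr rfl fun σ _ => ?_
  conv_lhs => rw [← Quotient.out_eq' σ]
  rw [AlternatingMap.domCoprod.summand_mk'']
  rcases Int.units_eq_one_or (Equiv.Perm.sign σ.out) with h | h <;> simp [h]

theorem wedge_compContinuousLinearMap {V W : Type*} [AddCommGroup V] [Module ℝ V]
    [TopologicalSpace V] [AddCommGroup W] [Module ℝ W] [TopologicalSpace W] {k l : ℕ}
    (α : V [⋀^Fin k]→L[ℝ] ℝ) (β : V [⋀^Fin l]→L[ℝ] ℝ) (A : W →L[ℝ] V) :
    (wedge α β).compContinuousLinearMap A =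
      wedge (α.compContinuousLinearMap A) (β.compContinuousLinearMap A) := by
  ext v
  rw [ContinuousAlternatingMap.compContinuousLinearMap_apply, wedge_apply, wedge_apply]
  rfl

theorem wedge_zero {V : Type*} [AddCommGroup V] [Module ℝ V]
    [TopologicalSpace V] {k l : ℕ} (α : V [⋀^Fin k]→L[ℝ] ℝ) :
    wedge α (0 : V [⋀^Fin l]→L[ℝ] ℝ) = 0 := by
  ext v
  rw [wedge_apply]
  simp

variable {E : Type*} [NormedAddCommGroup E] [NormedSpace ℝ E]
  {F : Type*} [NormedAddCommGroup F] [NormedSpace ℝ F] {k l : ℕ}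

/-- Evaluation of an alternating form on tuples of basis vectors. -/
noncomputable def evalBasis {ι : Type*} (b : Module.Basis ι ℝ E) (k : ℕ) :
    E [⋀^Fin k]→L[ℝ] ℝ →ₗ[ℝ] ((Fin k → ι) → ℝ) where
  toFun f i := f (fun j => b (i j))
  map_add' _ _ := rfl
  map_smul' _ _ := rfl

theorem evalBasis_injective {ι : Type*} [Finite ι] (b : Module.Basis ι ℝ E) (k : ℕ) :
    Function.Injective (evalBasis b k) := by
  intro f g h
  have : f.toContinuousMultilinearMap.toMultilinearMap =
      g.toContinuousMultilinearMap.toMultilinearMap :=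
    Module.Basis.ext_multilinear (fun _ => b) fun i => congrFun h i
  ext v
  exact congrArg (fun m : MultilinearMap ℝ (fun _ : Fin k => E) ℝ => m v) this

theorem alt_apply_eq_sum {ι : Type*} [Fintype ι] (b : Module.Basis ι ℝ E)
    (f : E [⋀^Fin k]→L[ℝ] ℝ) (v : Fin k → E) :
    f v = ∑ i : Fin k → ι, (∏ j, b.repr (v j) (i j)) * f (fun j => b (i j)) := by
  classical
  have h1 : v = fun j => ∑ a, b.repr (v j) a • b a := funext fun j => (b.sum_repr (v j)).symm
  have h2 := f.toContinuousMultilinearMap.toMultilinearMap.map_sum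
    (fun j a => b.repr (v j) a • b a)
  rw [← h1] at h2
  refine h2.trans (Finset.sum_congr rfl fun i _ => ?_)
  exact f.toContinuousMultilinearMap.toMultilinearMap.map_smul_univ (fun j => b.repr (v j) (i j))
    (fun j => b (i j))

variable [FiniteDimensional ℝ E]

instance finiteDimensional_alt (k : ℕ) : FiniteDimensional ℝ (E [⋀^Fin k]→L[ℝ] ℝ) :=
  FiniteDimensional.of_injective _ (evalBasis_injective (Module.finBasis ℝ E) k)

/-- Evaluation on basis tuples embeds the finite dimensional space of alternating forms linearly in
a space of functions, so a linear left inverse recovers `f` smoothly from its components. -/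
theorem contDiffAt_alt_iff {f : F → E [⋀^Fin k]→L[ℝ] ℝ} {x : F} :
    ContDiffAt ℝ ∞ f x ↔ ∀ v, ContDiffAt ℝ ∞ (fun y => f y v) x := by
  constructor
  · intro h v
    let L : E [⋀^Fin k]→L[ℝ] ℝ →ₗ[ℝ] ℝ := ⟨⟨fun f => f v, fun _ _ => rfl⟩, fun _ _ => rfl⟩
    exact (LinearMap.toContinuousLinearMap L).contDiff.contDiffAt.comp x h
  · intro h
    obtain ⟨L, hL⟩ := (evalBasis (Module.finBasis ℝ E) k).exists_leftInverse_of_injective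
      (LinearMap.ker_eq_bot.2 (evalBasis_injective _ k))
    have : f = fun y =>
        LinearMap.toContinuousLinearMap L (evalBasis (Module.finBasis ℝ E) k (f y)) :=
      funext fun y => (LinearMap.congr_fun hL (f y)).symm
    rw [this]
    refine (LinearMap.toContinuousLinearMap L).contDiff.contDiffAt.comp x ?_
    exact contDiffAt_pi.2 fun i => h _

theorem contDiffAt_alt_apply {f : F → E [⋀^Fin k]→L[ℝ] ℝ} {v : Fin k → F → E} {x : F}
    (hf : ContDiffAt ℝ ∞ f x) (hv : ∀ j, ContDiffAt ℝ ∞ (v j) x) :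
    ContDiffAt ℝ ∞ (fun y => f y (fun j => v j y)) x := by
  simp only [fun y => alt_apply_eq_sum (Module.finBasis ℝ E) (f y) (fun j => v j y)]
  refine ContDiffAt.sum fun i _ => ContDiffAt.mul (contDiffAt_prod fun j _ => ?_)
    (contDiffAt_alt_iff.1 hf _)
  exact (LinearMap.toContinuousLinearMap
    ((Module.finBasis ℝ E).coord (i j))).contDiff.contDiffAt.comp x (hv j)

theorem contDiffAt_alt_comp {E' : Type*} [NormedAddCommGroup E'] [NormedSpace ℝ E']
    [FiniteDimensional ℝ E'] {f : F → E [⋀^Fin k]→L[ℝ] ℝ} {A : F → E' →L[ℝ] E} {x : F}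
    (hf : ContDiffAt ℝ ∞ f x) (hA : ContDiffAt ℝ ∞ A x) :
    ContDiffAt ℝ ∞ (fun y => (f y).compContinuousLinearMap (A y)) x :=
  contDiffAt_alt_iff.2 fun v => contDiffAt_alt_apply (v := fun j y => A y (v j)) hf fun _ =>
    hA.clm_apply contDiffAt_const

theorem contDiffAt_wedge {f : F → E [⋀^Fin k]→L[ℝ] ℝ} {g : F → E [⋀^Fin l]→L[ℝ] ℝ} {x : F}
    (hf : ContDiffAt ℝ ∞ f x) (hg : ContDiffAt ℝ ∞ g x) :
    ContDiffAt ℝ ∞ (fun y => wedge (f y) (g y)) x := by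
  refine contDiffAt_alt_iff.2 fun v => ?_
  simp only [wedge_apply]
  exact ContDiffAt.sum fun σ _ => contDiffAt_const.mul
    ((contDiffAt_alt_iff.1 hf _).mul (contDiffAt_alt_iff.1 hg _))

end Multilinear

set_option linter.unusedSectionVars false

/-! ### Differential forms in charts: pullback, change of chart, smoothness, bump functions. -/

section Manifold

variable {E : Type*} [NormedAddCommGroup E] [NormedSpace ℝ E]
  {M : Type*} [TopologicalSpace M] [ChartedSpace E M] [IsManifold 𝓘(ℝ, E) ∞ M]
  {E' : Type*} [NormedAddCommGroup E'] [NormedSpace ℝ E']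
  {N : Type*} [TopologicalSpace N] [ChartedSpace E' N] [IsManifold 𝓘(ℝ, E') ∞ N]
  {k l : ℕ}

theorem mdifferentiable_chartAt (x0 : M) :
    OpenPartialHomeomorph.MDifferentiable 𝓘(ℝ, E) 𝓘(ℝ, E) (chartAt E x0) :=
  haveI : IsManifold 𝓘(ℝ, E) 1 M := IsManifold.of_le (n := ∞) (by simp)
  mdifferentiable_chart x0

theorem chartRep_congr_of_eq {τ η : Form E M k} {x0 : M} {u : E}
    (h : τ ((chartAt E x0).symm u) = η ((chartAt E x0).symm u)) :
    chartRep τ x0 u = chartRep η x0 u := by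
  simp only [chartRep, h]

/-- A form is recovered from its expression in a chart. -/
theorem eq_chartRep_comp (τ : Form E M k) {x0 y : M} (hy : y ∈ (chartAt E x0).source) :
    τ y = (chartRep τ x0 (chartAt E x0 y)).compContinuousLinearMap
      (mfderiv 𝓘(ℝ, E) 𝓘(ℝ, E) (chartAt E x0) y) := by
  have h1 := (mdifferentiable_chartAt x0).symm_comp_deriv hy
  have h2 : ∀ x', x' = y → (show E [⋀^Fin k]→L[ℝ] ℝ from τ x') = τ y := by
    rintro _ rfl; rfl
  have h3 := h2 _ ((chartAt E x0).left_inv hy)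
  ext v
  have h4 : ∀ i, mfderiv 𝓘(ℝ, E) 𝓘(ℝ, E) (chartAt E x0).symm (chartAt E x0 y)
      (mfderiv 𝓘(ℝ, E) 𝓘(ℝ, E) (chartAt E x0) y (v i)) = v i := fun i =>
    congrArg (fun A : TangentSpace 𝓘(ℝ, E) y →L[ℝ] TangentSpace 𝓘(ℝ, E) y => A (v i)) h1
  have h5 : (fun i => mfderiv 𝓘(ℝ, E) 𝓘(ℝ, E) (chartAt E x0).symm (chartAt E x0 y)
      (mfderiv 𝓘(ℝ, E) 𝓘(ℝ, E) (chartAt E x0) y (v i))) = v := funext h4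
  change _ = (show E [⋀^Fin k]→L[ℝ] ℝ from τ ((chartAt E x0).symm (chartAt E x0 y)))
    (fun i => mfderiv 𝓘(ℝ, E) 𝓘(ℝ, E) (chartAt E x0).symm (chartAt E x0 y)
      (mfderiv 𝓘(ℝ, E) 𝓘(ℝ, E) (chartAt E x0) y (v i)))
  rw [h3]
  exact (congrArg (show E [⋀^Fin k]→L[ℝ] ℝ from τ y) h5).symm

/-- The expression in charts of a map between manifolds. -/
noncomputable def chartMap (p : N → M) (y0 : N) (x0 : M) : E' → E := fun u =>
  chartAt E x0 (p ((chartAt E' y0).symm u))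

theorem contDiffAt_chartMap {p : N → M} {y0 y : N} {x0 : M}
    (hp : ContMDiffAt 𝓘(ℝ, E') 𝓘(ℝ, E) ∞ p y)
    (hy : y ∈ (chartAt E' y0).source) (hx : p y ∈ (chartAt E x0).source) :
    ContDiffAt ℝ ∞ (chartMap (E := E) p y0 x0) (chartAt E' y0 y) := by
  rw [← contMDiffAt_iff_contDiffAt]
  have h1 : ContMDiffAt 𝓘(ℝ, E') 𝓘(ℝ, E') ∞ (chartAt E' y0).symm (chartAt E' y0 y) :=
    contMDiffOn_chart_symm.contMDiffAt ((chartAt E' y0).open_target.mem_nhds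
      ((chartAt E' y0).map_source hy))
  have h2 : ContMDiffAt 𝓘(ℝ, E) 𝓘(ℝ, E) ∞ (chartAt E x0) (p y) :=
    contMDiffOn_chart.contMDiffAt ((chartAt E x0).open_source.mem_nhds hx)
  have h3 : (chartAt E' y0).symm (chartAt E' y0 y) = y := (chartAt E' y0).left_inv hy
  refine ContMDiffAt.comp (chartAt E' y0 y) (g := fun z => chartAt E x0 (p z)) ?_ h1
  rw [h3]
  exact ContMDiffAt.comp y h2 hp

theorem chartRep_pullbackForm {p : N → M} (τ : Form E M k) {y0 : N} {x0 : M} {u : E'}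
    (hu : u ∈ (chartAt E' y0).target)
    (hp : MDifferentiableAt 𝓘(ℝ, E') 𝓘(ℝ, E) p ((chartAt E' y0).symm u))
    (hx : p ((chartAt E' y0).symm u) ∈ (chartAt E x0).source) :
    chartRep (pullbackForm (EN := E') p τ) y0 u =
      (chartRep τ x0 (chartMap (E := E) p y0 x0 u)).compContinuousLinearMap
        (fderiv ℝ (chartMap (E := E) p y0 x0) u) := by
  have h1 : mfderiv 𝓘(ℝ, E') 𝓘(ℝ, E) (chartMap (E := E) p y0 x0) u =
      (mfderiv 𝓘(ℝ, E) 𝓘(ℝ, E) (chartAt E x0) (p ((chartAt E' y0).symm u))).comp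
        ((mfderiv 𝓘(ℝ, E') 𝓘(ℝ, E) p ((chartAt E' y0).symm u)).comp
          (mfderiv 𝓘(ℝ, E') 𝓘(ℝ, E') (chartAt E' y0).symm u)) := by
    have hs := (mdifferentiable_chartAt (E := E') y0).mdifferentiableAt_symm hu
    have h2 := mfderiv_comp u hp hs
    rw [← h2]
    exact mfderiv_comp u ((mdifferentiable_chartAt (E := E) x0).mdifferentiableAt hx)
      (hp.comp u hs)
  rw [← mfderiv_eq_fderiv, h1]
  simp only [chartRep, pullbackForm]
  rw [eq_chartRep_comp τ hx]
  rfl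

theorem pullbackForm_id (τ : Form E M k) : pullbackForm (EN := E) id τ = τ := by
  funext x
  simp only [pullbackForm, id_eq, mfderiv_id]
  rfl

/-- Smoothness of a form near a point, in the preferred chart there. -/
def SmoothFormAt (τ : Form E M k) (x : M) : Prop :=
  ContDiffAt ℝ ∞ (chartRep τ x) (chartAt E x x)

theorem SmoothFormAt.pullback [FiniteDimensional ℝ E] [FiniteDimensional ℝ E'] {p : N → M}
    {τ : Form E M k} {y0 y : N} {x0 : M} (hp : ContMDiff 𝓘(ℝ, E') 𝓘(ℝ, E) ∞ p)
    (hy : y ∈ (chartAt E' y0).source) (hx : p y ∈ (chartAt E x0).source)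
    (hτ : ContDiffAt ℝ ∞ (chartRep τ x0) (chartAt E x0 (p y))) :
    ContDiffAt ℝ ∞ (chartRep (pullbackForm (EN := E') p τ) y0) (chartAt E' y0 y) := by
  have hg := contDiffAt_chartMap hp.contMDiffAt hy hx
  have hyy : (chartAt E' y0).symm (chartAt E' y0 y) = y := (chartAt E' y0).left_inv hy
  have htgt := (chartAt E' y0).map_source hy
  have h1 : ContDiffAt ℝ ∞ (fun u =>
      (chartRep τ x0 (chartMap (E := E) p y0 x0 u)).compContinuousLinearMap
        (fderiv ℝ (chartMap (E := E) p y0 x0) u)) (chartAt E' y0 y) := by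
    have h2 : ContDiffAt ℝ ∞ (chartRep τ x0) (chartMap (E := E) p y0 x0 (chartAt E' y0 y)) := by
      rw [chartMap, hyy]
      exact hτ
    exact contDiffAt_alt_comp (f := fun u => chartRep τ x0 (chartMap (E := E) p y0 x0 u))
      (ContDiffAt.comp _ h2 hg) (hg.fderiv_right (by simp))
  refine h1.congr_of_eventuallyEq ?_
  have hopen : IsOpen ((chartAt E' y0).target ∩
      (chartAt E' y0).symm ⁻¹' (p ⁻¹' (chartAt E x0).source)) :=
    (chartAt E' y0).isOpen_inter_preimage_symm
      (hp.continuous.isOpen_preimage _ (chartAt E x0).open_source)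
  filter_upwards [hopen.mem_nhds ⟨htgt, by rw [Set.mem_preimage, hyy]; exact hx⟩] with u hu
  exact chartRep_pullbackForm τ hu.1 (hp.mdifferentiableAt (by simp)) hu.2

/-- A change of chart is the pullback by the identity map, read in two different charts. -/
theorem SmoothFormAt.chartRep_contDiffAt [FiniteDimensional ℝ E] {τ : Form E M k} {x y0 : M}
    (h : SmoothFormAt τ x) (hx : x ∈ (chartAt E y0).source) :
    ContDiffAt ℝ ∞ (chartRep τ y0) (chartAt E y0 x) := by
  have := SmoothFormAt.pullback (E' := E) (N := M) (p := id) (τ := τ) (y0 := y0) contMDiff_id hx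
    (mem_chart_source E x) h
  rwa [pullbackForm_id] at this

/-- By independence of the chart, one chart at each point suffices; this makes smoothness a local
property that can be checked pointwise. -/
theorem smoothOn_iff [FiniteDimensional ℝ E] {τ : Form E M k} {U : Set M} (hU : IsOpen U) :
    SmoothOn τ U ↔ ∀ x ∈ U, SmoothFormAt τ x := by
  constructor
  · intro h x hx
    refine (h x).contDiffAt (((chartAt E x).isOpen_inter_preimage_symm hU).mem_nhds
      ⟨mem_chart_target E x, ?_⟩)
    rwa [Set.mem_preimage, (chartAt E x).left_inv (mem_chart_source E x)]
  · intro h x0 u hu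
    have := (h _ hu.2).chartRep_contDiffAt (y0 := x0) ((chartAt E x0).map_target hu.1)
    rw [(chartAt E x0).right_inv hu.1] at this
    exact this.contDiffWithinAt

variable [FiniteDimensional ℝ E]

theorem SmoothOn.mono {τ : Form E M k} {U V : Set M} (h : SmoothOn τ U) (hV : V ⊆ U) :
    SmoothOn τ V := fun x0 => (h x0).mono fun _ hu => ⟨hu.1, hV hu.2⟩

theorem SmoothFormAt.congr {τ η : Form E M k} {x : M} (h : SmoothFormAt τ x)
    (he : ∀ᶠ y in 𝓝 x, η y = τ y) : SmoothFormAt η x := by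
  refine ContDiffAt.congr_of_eventuallyEq h ?_
  have hc : ContinuousAt (chartAt E x).symm (chartAt E x x) :=
    (chartAt E x).continuousAt_symm (mem_chart_target E x)
  have : ∀ᶠ u in 𝓝 (chartAt E x x), η ((chartAt E x).symm u) = τ ((chartAt E x).symm u) := by
    refine hc.eventually (p := fun y => η y = τ y) ?_
    rwa [(chartAt E x).left_inv (mem_chart_source E x)]
  filter_upwards [this] with u hu using chartRep_congr_of_eq hu

theorem SmoothOn.congr {τ η : Form E M k} {U : Set M} (h : SmoothOn τ U)
    (he : ∀ y ∈ U, η y = τ y) : SmoothOn η U := fun x0 =>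
  (h x0).congr fun _ hu => chartRep_congr_of_eq (he _ hu.2)

theorem chartRep_wedge (α : Form E M k) (β : Form E M l) (x0 : M) (u : E) :
    chartRep (fun x => wedge (α x) (β x)) x0 u = wedge (chartRep α x0 u) (chartRep β x0 u) :=
  wedge_compContinuousLinearMap _ _ _

theorem smoothOn_zero (U : Set M) : SmoothOn (fun _ => 0 : Form E M k) U := fun _ =>
  (contDiffOn_const (c := (0 : E [⋀^Fin k]→L[ℝ] ℝ))).congr fun _ _ => rfl

theorem SmoothOn.add {τ η : Form E M k} {U : Set M} (h : SmoothOn τ U) (h' : SmoothOn η U) :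
    SmoothOn (fun x => τ x + η x) U := fun x0 => (h x0).add (h' x0)

theorem contDiffOn_comp_chart_symm {f : M → ℝ} {U : Set M}
    (hf : ContMDiffOn 𝓘(ℝ, E) 𝓘(ℝ, ℝ) ∞ f U) (x0 : M) :
    ContDiffOn ℝ ∞ (fun u => f ((chartAt E x0).symm u))
      ((chartAt E x0).target ∩ (chartAt E x0).symm ⁻¹' U) := by
  rw [← contMDiffOn_iff_contDiffOn]
  exact hf.comp (contMDiffOn_chart_symm.mono fun u hu => hu.1) fun u hu => hu.2

theorem SmoothOn.smul {f : M → ℝ} {τ : Form E M k} {U : Set M} (h : SmoothOn τ U)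
    (hf : ContMDiffOn 𝓘(ℝ, E) 𝓘(ℝ, ℝ) ∞ f U) : SmoothOn (fun x => f x • τ x) U := fun x0 =>
  (contDiffOn_comp_chart_symm hf x0).smul (h x0)

theorem SmoothOn.sum {ι : Type*} (s : Finset ι) {τ : ι → Form E M k} {U : Set M}
    (h : ∀ i ∈ s, SmoothOn (τ i) U) : SmoothOn (fun x => ∑ i ∈ s, τ i x) U := by
  classical
  induction s using Finset.induction_on with
  | empty => exact (smoothOn_zero U).congr fun y _ => by simp
  | insert a s ha ih =>
    refine ((h a (Finset.mem_insert_self a s)).add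
      (ih fun i hi => h i (Finset.mem_insert_of_mem hi))).congr fun y _ => ?_
    rw [Finset.sum_insert ha]

theorem SmoothOn.wedge {α : Form E M k} {β : Form E M l} {U : Set M} (hU : IsOpen U)
    (h : SmoothOn α U) (h' : SmoothOn β U) : SmoothOn (fun x => wedge (α x) (β x)) U := by
  rw [smoothOn_iff hU] at h h' ⊢
  intro x hx
  refine (contDiffAt_wedge (h x hx) (h' x hx)).congr_of_eventuallyEq ?_
  exact Filter.Eventually.of_forall fun u => chartRep_wedge α β x u

theorem SmoothOn.pullback [FiniteDimensional ℝ E'] {p : N → M} {τ : Form E M k} {U : Set M}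
    (hp : ContMDiff 𝓘(ℝ, E') 𝓘(ℝ, E) ∞ p) (hU : IsOpen U) (h : SmoothOn τ U) :
    SmoothOn (pullbackForm (EN := E') p τ) (p ⁻¹' U) := by
  rw [smoothOn_iff (hp.continuous.isOpen_preimage _ hU)]
  rw [smoothOn_iff hU] at h
  intro y hy
  exact SmoothFormAt.pullback hp (mem_chart_source E' y) (mem_chart_source E (p y)) (h _ hy)

/-- A local form multiplied by a bump function. -/
theorem exists_bump_extension [T2Space M] {U : Set M} (hU : IsOpen U) {x : M} (hx : x ∈ U) :
    ∃ ρ : M → ℝ, ContMDiff 𝓘(ℝ, E) 𝓘(ℝ, ℝ) ∞ ρ ∧ (∀ᶠ y in 𝓝 x, ρ y = 1) ∧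
      (∀ y, y ∉ U → ρ y = 0) ∧ ∀ {k : ℕ} (τ : Form E M k), SmoothOn τ U →
        SmoothOn (fun y => ρ y • τ y) Set.univ := by
  obtain ⟨f, -, hf⟩ := (SmoothBumpFunction.nhds_basis_tsupport (I := 𝓘(ℝ, E)) x).mem_iff.1
    (hU.mem_nhds hx)
  refine ⟨f, f.contMDiff, f.eventuallyEq_one, fun y hy => ?_, fun τ hτ => ?_⟩
  · by_contra hne
    exact hy (hf (subset_tsupport _ hne))
  · rw [smoothOn_iff isOpen_univ]
    intro y _
    by_cases hy : y ∈ U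
    · exact (smoothOn_iff hU).1 (hτ.smul f.contMDiff.contMDiffOn) y hy
    · refine SmoothFormAt.congr ((smoothOn_iff isOpen_univ).1 (smoothOn_zero Set.univ) y trivial) ?_
      have : (tsupport f)ᶜ ∈ 𝓝 y := (isClosed_tsupport _).isOpen_compl.mem_nhds fun h => hy (hf h)
      filter_upwards [this] with z hz
      have : f z = 0 := by
        by_contra hne
        exact hz (subset_tsupport _ hne)
      rw [this, zero_smul]

end Manifold

/-! ### Local frames of forms, and local generation of an exterior differential system. -/

section Manifold

variable {E : Type*} [NormedAddCommGroup E] [NormedSpace ℝ E]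
  {M : Type*} [TopologicalSpace M] [ChartedSpace E M] [IsManifold 𝓘(ℝ, E) ∞ M]
  {k l : ℕ}

theorem eq_of_chartRep_eq {τ η : Form E M k} {x0 y : M} (hy : y ∈ (chartAt E x0).source)
    (h : chartRep τ x0 (chartAt E x0 y) = chartRep η x0 (chartAt E x0 y)) : τ y = η y := by
  rw [eq_chartRep_comp τ hy, eq_chartRep_comp η hy, h]

theorem chartRep_eq_of_eq {τ η : Form E M k} {x0 y : M} (hy : y ∈ (chartAt E x0).source)
    (h : τ y = η y) : chartRep τ x0 (chartAt E x0 y) = chartRep η x0 (chartAt E x0 y) := by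
  refine chartRep_congr_of_eq ?_
  have : ∀ x', x' = y → τ x' = η x' := by
    rintro _ rfl; exact h
  exact this _ ((chartAt E x0).left_inv hy)

theorem chartRep_sum_smul {ι : Type*} [Fintype ι] (c : ι → ℝ) (g : ι → Form E M k) (x0 : M)
    (u : E) : chartRep (fun x => ∑ i, c i • g i x) x0 u = ∑ i, c i • chartRep (g i) x0 u := by
  exact (map_sum (ContinuousAlternatingMap.compContinuousLinearMapₗ
    (mfderiv 𝓘(ℝ, E) 𝓘(ℝ, E) (chartAt E x0).symm u)) _ _).trans
      (Finset.sum_congr rfl fun i _ => map_smul _ _ _)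

/-- At a fixed point of the chart domain, passing to the chart is linear and invertible, so it
preserves and reflects linear relations. -/
theorem linearIndependent_chartRep_iff {ι : Type*} [Fintype ι] {g : ι → Form E M k} {x0 y : M}
    (hy : y ∈ (chartAt E x0).source) :
    LinearIndependent ℝ (fun i => chartRep (g i) x0 (chartAt E x0 y)) ↔
      LinearIndependent ℝ (fun i => g i y) := by
  rw [Fintype.linearIndependent_iff, Fintype.linearIndependent_iff]
  refine forall_congr' fun c => imp_congr_left ?_
  rw [← chartRep_sum_smul]
  exact ⟨fun h => eq_of_chartRep_eq (τ := fun x => ∑ i, c i • g i x) (η := fun _ => 0) hy h,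
    fun h => chartRep_eq_of_eq (τ := fun x => ∑ i, c i • g i x) (η := fun _ => 0) hy h⟩

theorem mem_span_chartRep_iff {ι : Type*} [Fintype ι] {g : ι → Form E M k} {τ : Form E M k}
    {x0 y : M} (hy : y ∈ (chartAt E x0).source) :
    chartRep τ x0 (chartAt E x0 y) ∈
        Submodule.span ℝ (Set.range fun i => chartRep (g i) x0 (chartAt E x0 y)) ↔
      τ y ∈ Submodule.span ℝ (Set.range fun i => g i y) := by
  rw [Submodule.mem_span_range_iff_exists_fun, Submodule.mem_span_range_iff_exists_fun]
  refine exists_congr fun c => ?_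
  rw [← chartRep_sum_smul]
  exact ⟨fun h => eq_of_chartRep_eq (τ := fun x => ∑ i, c i • g i x) hy h,
    fun h => chartRep_eq_of_eq (τ := fun x => ∑ i, c i • g i x) hy h⟩

variable [FiniteDimensional ℝ E]

theorem finiteDimensional_Alt (k : ℕ) (x : M) : FiniteDimensional ℝ (Alt E k x) :=
  inferInstanceAs (FiniteDimensional ℝ (E [⋀^Fin k]→L[ℝ] ℝ))

theorem eventually_linearIndependent_form {ι : Type*} [Finite ι] {g : ι → Form E M k} {U : Set M}
    (hU : IsOpen U) {y0 : M} (hy0 : y0 ∈ U) (hg : ∀ i, SmoothOn (g i) U)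
    (hli : LinearIndependent ℝ (fun i => g i y0)) :
    ∀ᶠ z in 𝓝 y0, LinearIndependent ℝ (fun i => g i z) := by
  have := Fintype.ofFinite ι
  have hs := mem_chart_source E y0
  rw [← linearIndependent_chartRep_iff hs] at hli
  have h1 := eventually_linearIndependent (w := fun i => chartRep (g i) y0)
    (fun i => ((smoothOn_iff hU).1 (hg i) y0 hy0).continuousAt) hli
  have h2 := ((chartAt E y0).continuousAt hs).eventually h1
  filter_upwards [h2, (chartAt E y0).open_source.mem_nhds hs] with z hz hzs
  exact (linearIndependent_chartRep_iff hzs).1 hz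

/-- Coefficients of smooth forms in a smooth frame are smooth. -/
theorem exists_smooth_coeff_form {ι : Type*} [Fintype ι] {g : ι → Form E M k} {τ : Form E M k}
    {V : Set M} (hV : IsOpen V) {y0 : M} (hVs : V ⊆ (chartAt E y0).source)
    (hg : ∀ i, SmoothOn (g i) V) (hτ : SmoothOn τ V)
    (hli : ∀ z ∈ V, LinearIndependent ℝ (fun i => g i z))
    (hmem : ∀ z ∈ V, τ z ∈ Submodule.span ℝ (Set.range fun i => g i z)) :
    ∃ c : ι → M → ℝ, (∀ i, ContMDiffOn 𝓘(ℝ, E) 𝓘(ℝ, ℝ) ∞ (c i) V) ∧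
      ∀ z ∈ V, τ z = ∑ i, c i z • g i z := by
  have hΩ := (chartAt E y0).isOpen_inter_preimage_symm hV
  have hfwd : ∀ z ∈ V, chartAt E y0 z ∈
      (chartAt E y0).target ∩ (chartAt E y0).symm ⁻¹' V := fun z hz =>
    ⟨(chartAt E y0).map_source (hVs hz), by
      rwa [Set.mem_preimage, (chartAt E y0).left_inv (hVs hz)]⟩
  have hback : ∀ u ∈ (chartAt E y0).target ∩ (chartAt E y0).symm ⁻¹' V,
      ∃ z ∈ V, z ∈ (chartAt E y0).source ∧ u = chartAt E y0 z := fun u hu =>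
    ⟨_, hu.2, hVs hu.2, ((chartAt E y0).right_inv hu.1).symm⟩
  obtain ⟨c, hc, hcτ⟩ := exists_smooth_coeff hΩ (fun i => hg i y0) (hτ y0)
    (by
      intro u hu
      obtain ⟨z, hz, hzs, rfl⟩ := hback u hu
      exact (linearIndependent_chartRep_iff hzs).2 (hli z hz))
    (by
      intro u hu
      obtain ⟨z, hz, hzs, rfl⟩ := hback u hu
      exact (mem_span_chartRep_iff hzs).2 (hmem z hz))
  refine ⟨fun i z => c i (chartAt E y0 z), fun i => ?_, fun z hz => ?_⟩
  · exact (contMDiffOn_iff_contDiffOn.2 (hc i)).comp (contMDiffOn_chart.mono hVs) hfwd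
  · have := hcτ _ (hfwd z hz)
    rw [← chartRep_sum_smul (fun i => c i (chartAt E y0 z))] at this
    exact eq_of_chartRep_eq (η := fun x => ∑ i, c i (chartAt E y0 z) • g i x) (hVs hz) this

theorem IsSection.mono {W : ∀ x : M, Submodule ℝ (Alt E k x)} {U V : Set M} {τ : Form E M k}
    (h : IsSection W U τ) (hV : V ⊆ U) : IsSection W V τ :=
  ⟨h.1.mono hV, fun x hx => h.2 x (hV hx)⟩

/-- Local sections extend to global ones, without change near a given point. -/
theorem IsSection.exists_extension [T2Space M] {W : ∀ x : M, Submodule ℝ (Alt E k x)} {U : Set M}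
    (hU : IsOpen U) {x : M} (hx : x ∈ U) {τ : Form E M k} (h : IsSection W U τ) :
    ∃ τ' : Form E M k, IsSection W Set.univ τ' ∧ ∀ᶠ y in 𝓝 x, τ' y = τ y := by
  obtain ⟨ρ, -, hρ1, hρ0, hρ⟩ := exists_bump_extension (E := E) hU hx
  refine ⟨fun y => ρ y • τ y, ⟨hρ τ h.1, fun y _ => ?_⟩, ?_⟩
  · by_cases hy : y ∈ U
    · exact Submodule.smul_mem _ _ (h.2 y hy)
    · simp only [hρ0 y hy, zero_smul]
      exact Submodule.zero_mem _
  · filter_upwards [hρ1] with y hy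
    rw [hy, one_smul]

theorem contMDiffOn_const' (c : ℝ) (U : Set M) :
    ContMDiffOn 𝓘(ℝ, E) 𝓘(ℝ, ℝ) ∞ (fun _ : M => c) U := contMDiffOn_const

/-- Every element of a subbundle is the value of a global section. -/
theorem IsSubbundle.exists_section [T2Space M] {W : ∀ x : M, Submodule ℝ (Alt E k x)}
    (hW : IsSubbundle W) {x : M} {κ : Alt E k x} (hκ : κ ∈ W x) :
    ∃ τ : Form E M k, IsSection W Set.univ τ ∧ τ x = κ := by
  obtain ⟨r, hr⟩ := hW
  obtain ⟨U, hU, hx, η, hη, hηW⟩ := hr x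
  rw [(hηW x hx).2] at hκ
  obtain ⟨c, hc⟩ := (Submodule.mem_span_range_iff_exists_fun ℝ).1 hκ
  have h1 : IsSection W U (fun y => ∑ i, c i • η i y) := by
    refine ⟨SmoothOn.sum _ fun i _ => (hη i).smul (contMDiffOn_const' (c i) U), fun y hy => ?_⟩
    rw [(hηW y hy).2]
    exact Submodule.sum_mem _ fun i _ => Submodule.smul_mem _ _ (Submodule.subset_span ⟨i, rfl⟩)
  obtain ⟨τ, hτ, hτe⟩ := h1.exists_extension hU hx
  exact ⟨τ, hτ, hτe.self_of_nhds.trans hc⟩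

theorem IsSubbundle.exists_finrank {W : ∀ x : M, Submodule ℝ (Alt E k x)}
    (hW : IsSubbundle W) : ∃ r : ℕ, ∀ x, Module.finrank ℝ (W x) = r := by
  obtain ⟨r, hr⟩ := hW
  refine ⟨r, fun x => ?_⟩
  obtain ⟨U, -, hx, η, -, hη⟩ := hr x
  rw [(hη x hx).2, finrank_span_eq_card (hη x hx).1, Fintype.card_fin]

variable {S : ∀ k, Form E M k → Prop} {U : Set M}

theorem AlgIdeal.smoothOn (hU : IsOpen U) (hS : ∀ k τ, S k τ → SmoothOn τ U) {τ : Form E M k}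
    (h : AlgIdeal U S k τ) : SmoothOn τ U := by
  induction h with
  | of τ h => exact hS _ _ h
  | zero k => exact smoothOn_zero U
  | add τ η _ _ h1 h2 => exact h1.add h2
  | smul f τ hf _ h => exact h.smul hf
  | wedge α τ hα _ h => exact hα.wedge hU h
  | congr τ η he _ h => exact h.congr fun y hy => (he y hy).symm

theorem AlgIdeal.mem_bdl {K : ExteriorDiffSystem E M}
    (hS : ∀ k τ, S k τ → ∀ x ∈ U, τ x ∈ K.bdl k x) {τ : Form E M k}
    (h : AlgIdeal U S k τ) : ∀ x ∈ U, τ x ∈ K.bdl k x := by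
  induction h with
  | of τ h => exact hS _ _ h
  | zero k => exact fun x _ => Submodule.zero_mem _
  | add τ η _ _ h1 h2 => exact fun x hx => Submodule.add_mem _ (h1 x hx) (h2 x hx)
  | smul f τ hf _ h => exact fun x hx => Submodule.smul_mem _ _ (h x hx)
  | wedge α τ hα _ h => exact fun x hx => K.wedge_mem x _ _ (h x hx)
  | congr τ η he _ h => exact fun x hx => he x hx ▸ h x hx

theorem AlgIdeal.mono {V : Set M} (hV : V ⊆ U) {τ : Form E M k}
    (h : AlgIdeal U S k τ) : AlgIdeal V S k τ := by
  induction h with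
  | of τ h => exact .of τ h
  | zero k => exact .zero k
  | add τ η _ _ h1 h2 => exact .add τ η h1 h2
  | smul f τ hf _ h => exact .smul f τ (hf.mono hV) h
  | wedge α τ hα _ h => exact .wedge α τ (hα.mono hV) h
  | congr τ η he _ h => exact .congr τ η (fun x hx => he x (hV hx)) h

theorem AlgIdeal.sum {ι : Type*} (s : Finset ι) {τ : ι → Form E M k}
    (h : ∀ i ∈ s, AlgIdeal U S k (τ i)) : AlgIdeal U S k (fun x => ∑ i ∈ s, τ i x) := by
  classical
  induction s using Finset.induction_on with
  | empty => exact .congr _ _ (fun x _ => by simp) (.zero k)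
  | insert a s ha ih =>
    refine .congr _ _ (fun x _ => (Finset.sum_insert ha).symm)
      (.add _ _ (h a (Finset.mem_insert_self a s))
        (ih fun i hi => h i (Finset.mem_insert_of_mem hi)))

/-- Forms of degree larger than the dimension vanish. -/
theorem alt_eq_zero_of_finrank_lt (hk : Module.finrank ℝ E < k) (f : E [⋀^Fin k]→L[ℝ] ℝ) :
    f = 0 := by
  ext v
  have hdep : ¬ LinearIndependent ℝ v := fun h => by
    have := h.fintype_card_le_finrank
    rw [Fintype.card_fin] at this
    omega
  exact f.toAlternatingMap.map_linearDependent v hdep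

theorem exists_linearIndependent_of_finrank {V : Type*} [AddCommGroup V] [Module ℝ V]
    [FiniteDimensional ℝ V] {W : Submodule ℝ V} {r : ℕ} (hr : Module.finrank ℝ W = r) :
    ∃ b : Fin r → V, LinearIndependent ℝ b ∧ ∀ i, b i ∈ W := by
  let b := Module.finBasisOfFinrankEq ℝ W hr
  exact ⟨fun i => b i, b.linearIndependent.map' W.subtype (Submodule.ker_subtype _),
    fun i => (b i).2⟩

/-- Only the values at the single point `y0` are assumed to be reached; constant rank propagates
this to a neighbourhood. The conclusion is stated for all smaller open `V'` so that neighbourhoods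
for several degrees can be intersected. -/
theorem exists_nhds_isSection_iff_degree {K : ExteriorDiffSystem E M} (hU : IsOpen U) {y0 : M}
    (hy0 : y0 ∈ U) (hSs : ∀ k τ, S k τ → SmoothOn τ U)
    (hSK : ∀ k τ, S k τ → ∀ x ∈ U, τ x ∈ K.bdl k x) (k : ℕ)
    (hval : ∀ κ ∈ K.bdl k y0, ∃ τ, AlgIdeal U S k τ ∧ τ y0 = κ) :
    ∃ V : Set M, IsOpen V ∧ y0 ∈ V ∧ V ⊆ U ∧ ∀ V' ⊆ V, IsOpen V' → ∀ τ : Form E M k,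
      IsSection (K.bdl k) V' τ → AlgIdeal V' S k τ := by
  have hfd := fun x : M => finiteDimensional_Alt (E := E) k x
  obtain ⟨r, hr⟩ := (K.isSubbundle k).exists_finrank
  obtain ⟨b, hbli, hbK⟩ := exists_linearIndependent_of_finrank (hr y0)
  -- Members of the local ideal whose values at `y0` form a basis of the fibre stay independent
  -- nearby. As they lie in fibres of the same dimension `r`, they are a frame, and sections have
  -- smooth coefficients in it.
  choose g hg hgy using fun i => hval _ (hbK i)
  have hgs := fun i => (hg i).smoothOn hU hSs
  have hgK := fun i => (hg i).mem_bdl hSK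
  have hli0 : LinearIndependent ℝ (fun i => g i y0) := by
    rw [show (fun i => g i y0) = b from funext hgy]
    exact hbli
  obtain ⟨V, hV, hVo, hyV⟩ := eventually_nhds_iff.1
    (eventually_linearIndependent_form hU hy0 hgs hli0)
  refine ⟨V ∩ U ∩ (chartAt E y0).source, (hVo.inter hU).inter (chartAt E y0).open_source,
    ⟨⟨hyV, hy0⟩, mem_chart_source E y0⟩, fun z hz => hz.1.2, fun V' hV' hV'o τ hτ => ?_⟩
  have hV'U : V' ⊆ U := fun z hz => (hV' hz).1.2
  have hspan : ∀ z ∈ V', K.bdl k z = Submodule.span ℝ (Set.range fun i => g i z) := by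
    intro z hz
    symm
    refine Submodule.eq_of_le_of_finrank_eq (Submodule.span_le.2 ?_) ?_
    · rintro _ ⟨i, rfl⟩
      exact hgK i z (hV'U hz)
    · rw [finrank_span_eq_card (hV z (hV' hz).1.1), hr z, Fintype.card_fin]
  obtain ⟨c, hc, hcτ⟩ := exists_smooth_coeff_form hV'o (fun z hz => (hV' hz).2)
    (fun i => (hgs i).mono hV'U) hτ.1 (fun z hz => hV z (hV' hz).1.1)
    (fun z hz => by rw [← hspan z hz]; exact hτ.2 z hz)
  refine .congr _ _ (fun z hz => (hcτ z hz).symm) (AlgIdeal.sum _ fun i _ => ?_)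
  exact .smul (c i) (g i) (hc i) ((hg i).mono hV'U)

/-- A family of forms whose pointwise ideal is that of an exterior differential system generates
its sections on a neighbourhood. -/
theorem exists_nhds_isSection_iff {K : ExteriorDiffSystem E M} (hU : IsOpen U) {y0 : M}
    (hy0 : y0 ∈ U) (hSs : ∀ k τ, S k τ → SmoothOn τ U)
    (hSK : ∀ k τ, S k τ → ∀ x ∈ U, τ x ∈ K.bdl k x)
    (hval : ∀ k, ∀ κ ∈ K.bdl k y0, ∃ τ, AlgIdeal U S k τ ∧ τ y0 = κ) :
    ∃ V : Set M, IsOpen V ∧ y0 ∈ V ∧ V ⊆ U ∧ ∀ (k : ℕ) (τ : Form E M k),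
      IsSection (K.bdl k) V τ ↔ AlgIdeal V S k τ := by
  choose V hVo hyV hVU hV using fun k =>
    exists_nhds_isSection_iff_degree hU hy0 hSs hSK k (hval k)
  -- Degrees above the dimension carry no nonzero forms, so a finite intersection of neighbourhoods
  -- serves for all degrees.
  let n := Module.finrank ℝ E
  let W : Set M := ⋂ k : Fin (n + 1), V k
  have hW : IsOpen W := isOpen_iInter_of_finite fun k => hVo k
  have hWV : ∀ k ≤ n, W ⊆ V k := fun k hk z hz =>
    Set.mem_iInter.1 hz (⟨k, by omega⟩ : Fin (n + 1))
  have hWU : W ⊆ U := (hWV 0 (Nat.zero_le _)).trans (hVU 0)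
  refine ⟨W, hW, Set.mem_iInter.2 fun k => hyV k, hWU, fun k τ => ⟨fun hτ => ?_, fun hτ => ?_⟩⟩
  · by_cases hk : k ≤ n
    · exact hV k W (hWV k hk) hW τ hτ
    · refine .congr _ _ (fun z _ => ?_) (.zero k)
      exact (alt_eq_zero_of_finrank_lt (E := E) (not_le.1 hk) (τ z)).symm
  · exact ⟨hτ.smoothOn hW fun k τ h => (hSs k τ h).mono hWU,
      hτ.mem_bdl fun k τ h x hx => hSK k τ h x (hWU hx)⟩

end Manifold

/-! ### Linear algebra of covectors: complements of the image of a transpose. -/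

section OneForms

variable {E : Type*} [NormedAddCommGroup E] [NormedSpace ℝ E]
  {E' : Type*} [NormedAddCommGroup E'] [NormedSpace ℝ E']

/-- Linear functionals as alternating `1`-forms. -/
noncomputable def oneForm (E : Type*) [NormedAddCommGroup E] [NormedSpace ℝ E] :
    (E →L[ℝ] ℝ) ≃ₗ[ℝ] (E [⋀^Fin 1]→L[ℝ] ℝ) :=
  (ContinuousAlternatingMap.ofSubsingletonLIE (𝕜 := ℝ) (E := E) (F := ℝ) (0 : Fin 1)).toLinearEquiv

theorem oneForm_apply (ℓ : E →L[ℝ] ℝ) (v : Fin 1 → E) : oneForm E ℓ v = ℓ (v 0) := rfl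

theorem oneForm_symm_apply (η : E [⋀^Fin 1]→L[ℝ] ℝ) (v : E) :
    (oneForm E).symm η v = η (fun _ => v) := rfl

/-- In finite dimension a subspace of the dual is the annihilator of its common kernel; here that
kernel is zero. -/
theorem eq_top_of_separating [FiniteDimensional ℝ E] {W : Submodule ℝ (E [⋀^Fin 1]→L[ℝ] ℝ)}
    (h : ∀ v : E, (∀ η ∈ W, η (fun _ => v) = 0) → v = 0) : W = ⊤ := by
  let e : (E [⋀^Fin 1]→L[ℝ] ℝ) ≃ₗ[ℝ] Module.Dual ℝ E :=
    (oneForm E).symm.trans LinearMap.toContinuousLinearMap.symm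
  have h1 : (W.map e.toLinearMap).dualCoannihilator = ⊥ := by
    rw [eq_bot_iff]
    intro v hv
    refine h v fun η hη => ?_
    exact (Submodule.mem_dualCoannihilator v).1 hv _ (Submodule.mem_map_of_mem hη)
  have h2 := Subspace.dualCoannihilator_dualAnnihilator_eq (W := W.map e.toLinearMap)
  rw [h1, Submodule.dualAnnihilator_bot] at h2
  have h3 := congrArg (Submodule.comap e.toLinearMap) h2
  rwa [Submodule.comap_top, Submodule.comap_map_eq_of_injective e.injective, eq_comm] at h3

variable {J : Submodule ℝ (E [⋀^Fin 1]→L[ℝ] ℝ)} {K : Submodule ℝ E} {f : E →L[ℝ] E'}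

/-- A vector killed by `J` lies in `K`, and one killed by all covectors pulled back along `f` lies
in `ker f`. These meet in zero, so the sum separates vectors. -/
theorem sup_range_eq_top [FiniteDimensional ℝ E]
    (hann : ∀ v, (∀ η ∈ J, η (fun _ => v) = 0) → v ∈ K)
    (hK : Disjoint K (LinearMap.ker f.toLinearMap)) :
    J ⊔ LinearMap.range
      (ContinuousAlternatingMap.compContinuousLinearMapₗ (N := ℝ) (ι := Fin 1) f) =
      ⊤ := by
  refine eq_top_of_separating fun v hv => ?_
  have h1 : v ∈ K := hann v fun η hη => hv η (Submodule.mem_sup_left hη)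
  have h2 : v ∈ LinearMap.ker f.toLinearMap := by
    rw [LinearMap.mem_ker]
    by_contra hne
    obtain ⟨ℓ, hℓ⟩ := SeparatingDual.exists_ne_zero (R := ℝ) hne
    exact hℓ (hv _ (Submodule.mem_sup_right ⟨oneForm E' ℓ, rfl⟩))
  exact Submodule.disjoint_def.1 hK v h1 h2

/-- A covector in both spaces vanishes on `K`, being in `J`, and on `ker f`, being pulled back;
together these span. -/
theorem disjoint_range
    (hann : ∀ v ∈ K, (∀ η ∈ J, η (fun _ => v) = 0))
    (hK : Codisjoint K (LinearMap.ker f.toLinearMap)) :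
    Disjoint J
      (LinearMap.range
        (ContinuousAlternatingMap.compContinuousLinearMapₗ (N := ℝ) (ι := Fin 1) f)) := by
  rw [Submodule.disjoint_def]
  rintro _ hη ⟨ζ, rfl⟩
  have h0 : (oneForm E).symm (ζ.compContinuousLinearMap f) = 0 := by
    ext v
    have hv : v ∈ K ⊔ LinearMap.ker f.toLinearMap := by rw [hK.eq_top]; trivial
    obtain ⟨a, ha, b, hb, rfl⟩ := Submodule.mem_sup.1 hv
    rw [map_add]
    have h1 : (oneForm E).symm (ζ.compContinuousLinearMap f) a = 0 := hann a ha _ hη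
    have h2 : (oneForm E).symm (ζ.compContinuousLinearMap f) b = 0 := by
      change (oneForm E').symm ζ (f b) = 0
      have h3 : f b = 0 := hb
      rw [h3, map_zero]
    rw [h1, h2]
    simp
  exact (oneForm E).symm.map_eq_zero_iff.1 h0

theorem compContinuousLinearMapₗ_injective {k : ℕ} (hf : Function.Surjective f) :
    Function.Injective
      (ContinuousAlternatingMap.compContinuousLinearMapₗ (N := ℝ) (ι := Fin k) f) := by
  intro α β h
  ext v
  choose g hg using hf
  have h1 : (fun i => f (g (v i))) = v := funext fun i => hg _
  have h2 := congrArg (fun α : E [⋀^Fin k]→L[ℝ] ℝ => α (fun i => g (v i))) h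
  change α (fun i => f (g (v i))) = β (fun i => f (g (v i))) at h2
  rwa [h1] at h2

end OneForms

/-! ### Integrable extensions: the splitting of `T*N` and pullback of ideals. -/

section Extension

variable {EM : Type*} [NormedAddCommGroup EM] [NormedSpace ℝ EM] [FiniteDimensional ℝ EM]
  {M : Type*} [TopologicalSpace M] [T2Space M]
  [ChartedSpace EM M] [IsManifold 𝓘(ℝ, EM) ∞ M]
  {EN : Type*} [NormedAddCommGroup EN] [NormedSpace ℝ EN] [FiniteDimensional ℝ EN]
  {N : Type*} [TopologicalSpace N] [T2Space N]
  [ChartedSpace EN N] [IsManifold 𝓘(ℝ, EN) ∞ N]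
  {I : ExteriorDiffSystem EM M} {K : ExteriorDiffSystem EN N} {p : N → M}
  {J : ∀ y : N, Submodule ℝ (Alt EN 1 y)} {k l : ℕ}

/-- The transpose of `dp` at `y`. -/
noncomputable abbrev transpose (p : N → M) (k : ℕ) (y : N) : Alt EM k (p y) →ₗ[ℝ] Alt EN k y :=
  ContinuousAlternatingMap.compContinuousLinearMapₗ (mfderiv 𝓘(ℝ, EN) 𝓘(ℝ, EM) p y)

theorem pullbackForm_wedge (α : Form EM M k) (β : Form EM M l) (y : N) :
    pullbackForm (EN := EN) p (fun x => wedge (α x) (β x)) y =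
      wedge (pullbackForm (EN := EN) p α y) (pullbackForm (EN := EN) p β y) :=
  wedge_compContinuousLinearMap _ _ _

theorem pullbackForm_quadratic {n : ℕ} (σ : Fin n → Form EM M 1) (A : Fin n → Fin n → M → ℝ)
    (y : N) : pullbackForm (EN := EN) p
        (fun x => ∑ a, ∑ b, A a b x • wedge (σ a x) (σ b x)) y =
      ∑ a, ∑ b, A a b (p y) •
        wedge (pullbackForm (EN := EN) p (σ a) y) (pullbackForm (EN := EN) p (σ b) y) := by
  change transpose (EM := EM) (EN := EN) p 2 y _ = _
  rw [map_sum]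
  refine Finset.sum_congr rfl fun a _ => ?_
  rw [map_sum]
  refine Finset.sum_congr rfl fun b _ => ?_
  rw [map_smul]
  exact congrArg _ (pullbackForm_wedge (EN := EN) (σ a) (σ b) y)

/-- The dual form of transversality. It gives the directness of both sums in part (i), the coframe
on `N`, and the spanning conditions of part (ii). -/
theorem IsIntegrableExtension.isCompl (hext : IsIntegrableExtension p K I J) (y : N) :
    IsCompl (J y) (LinearMap.range (transpose (EM := EM) (EN := EN) p 1 y)) :=
  ⟨disjoint_range (E := EN) (E' := EM) (K := ann J y) (fun _ hv => hv)
    (hext.transverse y).codisjoint,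
    codisjoint_iff.2 (sup_range_eq_top (E := EN) (E' := EM) (K := ann J y) (fun _ hv => hv)
      (hext.transverse y).disjoint)⟩

theorem IsIntegrableExtension.le_bdl (hext : IsIntegrableExtension p K I J) (y : N) :
    J y ≤ K.bdl 1 y := by
  intro η hη
  obtain ⟨τ, hτ, rfl⟩ := hext.isSubbundle.exists_section hη
  exact ((hext.generated 1 τ).2 (.of τ (.ofJ τ hτ))).2 y trivial

theorem IsIntegrableExtension.transpose_mem_bdl (hext : IsIntegrableExtension p K I J) (y : N)
    {κ : Alt EM k (p y)} (hκ : κ ∈ I.bdl k (p y)) : transpose (EN := EN) p k y κ ∈ K.bdl k y := by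
  obtain ⟨τ, hτ, rfl⟩ := (I.isSubbundle k).exists_section hκ
  exact ((hext.generated k _).2 (.of _ (.ofI τ hτ))).2 y trivial

theorem AlgIdeal.pullback {U' : Set M} {U : Set N} (hp : ContMDiff 𝓘(ℝ, EN) 𝓘(ℝ, EM) ∞ p)
    (hU' : IsOpen U') (hU : U ⊆ p ⁻¹' U')
    {S' : ∀ k, Form EM M k → Prop} {S : ∀ k, Form EN N k → Prop}
    (hS : ∀ k τ, S' k τ → AlgIdeal U S k (pullbackForm (EN := EN) p τ)) {τ : Form EM M k}
    (h : AlgIdeal U' S' k τ) : AlgIdeal U S k (pullbackForm (EN := EN) p τ) := by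
  induction h with
  | of τ h => exact hS _ _ h
  | zero k => exact .zero k
  | add τ η _ _ h1 h2 => exact .add _ _ h1 h2
  | smul f τ hf _ h =>
    exact .smul (fun y => f (p y)) _ (hf.comp hp.contMDiffOn hU) h
  | wedge α τ hα _ h =>
    exact .congr _ _ (fun y _ => (pullbackForm_wedge α τ y).symm)
      (.wedge _ _ ((hα.pullback hp hU').mono hU) h)
  | congr τ η he _ h =>
    refine .congr _ _ (fun y hy => ?_) h
    simp only [pullbackForm, he (p y) (hU hy)]

section Gen

variable {s q r t u : ℕ} {θ : Fin s → Form EM M 1} {σh : Fin q → Form EM M 1}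
    {σc : Fin r → Form EM M 1} {A : Fin t → Fin q → Fin q → M → ℝ}
    {B : Fin u → Fin r → Fin r → M → ℝ} {U : Set M}

theorem smoothOn_quadratic {n : ℕ} {σ : Fin n → Form EM M 1} {A : Fin n → Fin n → M → ℝ}
    (hU : IsOpen U) (hσ : ∀ a, SmoothOn (σ a) U)
    (hA : ∀ a b, ContMDiffOn 𝓘(ℝ, EM) 𝓘(ℝ, ℝ) ∞ (A a b) U) :
    SmoothOn (fun x => ∑ a, ∑ b, A a b x • wedge (σ a x) (σ b x)) U :=
  SmoothOn.sum _ fun a _ => SmoothOn.sum _ fun b _ => ((hσ a).wedge hU (hσ b)).smul (hA a b)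

theorem DecompGen.smoothOn (hU : IsOpen U) (hθ : ∀ e, SmoothOn (θ e) U)
    (hσh : ∀ a, SmoothOn (σh a) U) (hσc : ∀ a, SmoothOn (σc a) U)
    (hA : ∀ i a b, ContMDiffOn 𝓘(ℝ, EM) 𝓘(ℝ, ℝ) ∞ (A i a b) U)
    (hB : ∀ i a b, ContMDiffOn 𝓘(ℝ, EM) 𝓘(ℝ, ℝ) ∞ (B i a b) U) (k : ℕ) (τ : Form EM M k)
    (h : DecompGen θ σh σc A B k τ) : SmoothOn τ U := by
  cases h with
  | one e => exact hθ e
  | hat i => exact smoothOn_quadratic hU hσh (hA i)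
  | check j => exact smoothOn_quadratic hU hσc (hB j)

end Gen

theorem sum_elim_append {m n : ℕ} {R V : Type*} (f : Fin m → V) (g : Fin n → V) (h : R → V) :
    Sum.elim (Fin.append f g) h = Sum.elim f (Sum.elim g h) ∘
      ((finSumFinEquiv.symm.sumCongr (Equiv.refl R)).trans (Equiv.sumAssoc (Fin m) (Fin n) R)) := by
  ext (e | e)
  · refine Fin.addCases (fun i => ?_) (fun i => ?_) e <;> simp
  · simp

theorem range_append {m n : ℕ} {V : Type*} (f : Fin m → V) (g : Fin n → V) :
    Set.range (Fin.append f g) = Set.range f ∪ Set.range g := by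
  have h1 : Fin.append f g = Sum.elim f g ∘ finSumFinEquiv.symm := by
    ext e
    refine Fin.addCases (fun i => ?_) (fun i => ?_) e <;> simp
  rw [h1, EquivLike.range_comp, Set.Sum.elim_range]

/-- Adding to the image of a coframe under an injection a basis of a complement. -/
theorem linearIndependent_span_append {V V' R : Type*} [AddCommGroup V] [Module ℝ V]
    [AddCommGroup V'] [Module ℝ V'] {m n : ℕ} {ζ : Fin m → V'} {f : V →ₗ[ℝ] V'}
    (hf : Function.Injective f) {θ : Fin n → V} {σ : R → V} (hζ : LinearIndependent ℝ ζ)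
    (hli : LinearIndependent ℝ (Sum.elim θ σ))
    (hspan : Submodule.span ℝ (Set.range (Sum.elim θ σ)) = ⊤)
    (hcompl : IsCompl (Submodule.span ℝ (Set.range ζ)) (LinearMap.range f)) :
    LinearIndependent ℝ (Sum.elim (Fin.append ζ (fun i => f (θ i))) (fun i => f (σ i))) ∧
      Submodule.span ℝ (Set.range
        (Sum.elim (Fin.append ζ (fun i => f (θ i))) (fun i => f (σ i)))) = ⊤ := by
  have e1 : Sum.elim (fun i => f (θ i)) (fun i => f (σ i)) = f ∘ Sum.elim θ σ := by
    ext (i | i) <;> rfl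
  have e2 : Submodule.span ℝ (Set.range (f ∘ Sum.elim θ σ)) = LinearMap.range f := by
    rw [Set.range_comp, ← Submodule.map_span, hspan, Submodule.map_top]
  rw [sum_elim_append, e1]
  constructor
  · refine LinearIndependent.comp (LinearIndependent.sum_type hζ
      (hli.map' f (LinearMap.ker_eq_bot.2 hf)) ?_) _ (Equiv.injective _)
    rw [e2]
    exact hcompl.disjoint
  · rw [EquivLike.range_comp, Set.Sum.elim_range, Submodule.span_union, e2]
    exact hcompl.sup_eq_top

end Extension

/-! ### Part (i): decomposability of the extension. -/

section Extension

variable {EM : Type*} [NormedAddCommGroup EM] [NormedSpace ℝ EM] [FiniteDimensional ℝ EM]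
  {M : Type*} [TopologicalSpace M] [T2Space M]
  [ChartedSpace EM M] [IsManifold 𝓘(ℝ, EM) ∞ M]
  {EN : Type*} [NormedAddCommGroup EN] [NormedSpace ℝ EN] [FiniteDimensional ℝ EN]
  {N : Type*} [TopologicalSpace N] [T2Space N]
  [ChartedSpace EN N] [IsManifold 𝓘(ℝ, EN) ∞ N]
  {I : ExteriorDiffSystem EM M} {K : ExteriorDiffSystem EN N} {p : N → M}
  {J : ∀ y : N, Submodule ℝ (Alt EN 1 y)} {k l : ℕ}

/-- At a point, elements of an integrable extension are values of elements of any ideal containing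
a local frame of `J` and the pullback of the base system. -/
theorem IsIntegrableExtension.exists_algIdeal_value (hext : IsIntegrableExtension p K I J)
    {U' : Set M} {U : Set N} (hU' : IsOpen U') (hU : U ⊆ p ⁻¹' U') {y : N}
    {S' : ∀ k, Form EM M k → Prop} {S : ∀ k, Form EN N k → Prop}
    (hI : ∀ k τ, IsSection (I.bdl k) U' τ → AlgIdeal U' S' k τ)
    (hS : ∀ k τ, S' k τ → AlgIdeal U S k (pullbackForm (EN := EN) p τ))
    (hJ : ∀ κ ∈ J y, ∃ τ, AlgIdeal U S 1 τ ∧ τ y = κ) {κ : Alt EN k y} (hκ : κ ∈ K.bdl k y) :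
    ∃ τ, AlgIdeal U S k τ ∧ τ y = κ := by
  obtain ⟨τ, hτ, rfl⟩ := (K.isSubbundle k).exists_section hκ
  have h := (hext.generated k τ).1 hτ
  clear hκ hτ
  -- Only values at `y` have to be matched, so each global generator may be replaced by a local one:
  -- a section of `J` by any element of the local ideal with the same value at `y`, and a pulled
  -- back form by its local expression. Coefficients and wedge factors are simply restricted to `U`.
  induction h with
  | of τ h =>
    cases h with
    | ofJ η hη => exact hJ _ (hη.2 y trivial)
    | ofI τ hτ =>
      exact ⟨_, AlgIdeal.pullback hext.contMDiff hU' hU hS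
        (hI _ τ (hτ.mono (Set.subset_univ _))), rfl⟩
  | zero k => exact ⟨_, .zero k, rfl⟩
  | add τ η _ _ h1 h2 =>
    obtain ⟨τ', hτ, e1⟩ := h1
    obtain ⟨η', hη, e2⟩ := h2
    exact ⟨_, .add _ _ hτ hη, by rw [e1, e2]⟩
  | smul f τ hf _ h =>
    obtain ⟨τ', hτ, e1⟩ := h
    exact ⟨_, .smul f _ (hf.mono (Set.subset_univ _)) hτ, by rw [e1]⟩
  | wedge α τ hα _ h =>
    obtain ⟨τ', hτ, e1⟩ := h
    exact ⟨_, .wedge α _ (hα.mono (Set.subset_univ _)) hτ, by rw [e1]⟩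
  | congr τ η he _ h =>
    obtain ⟨τ', hτ, e1⟩ := h
    exact ⟨_, hτ, e1.trans (he y trivial)⟩

/-- The frame `ζ` of `J` is absorbed into the new `θ`, while the `σ̂`, `σ̌` and the coefficients are
pulled back. The type is therefore unchanged and only the number of `θ` grows, by the rank of `J`.
-/
theorem IsIntegrableExtension.isDecomposable (hext : IsIntegrableExtension p K I J) {q r : ℕ}
    {Vh Vc : ∀ x : M, Submodule ℝ (Alt EM 1 x)} (hI : IsDecomposable I q r Vh Vc) :
    IsDecomposable K q r (extend p J Vh) (extend p J Vc) := by
  refine ⟨hI.1, hI.2.1, fun y => ?_⟩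
  obtain ⟨U', hU', hpy, s, t, u, θ, σh, σc, A, B, ht, hu, hθ, hσh, hσc, hA, hB, hcof, hgen, hV⟩ :=
    hI.2.2 (p y)
  obtain ⟨m, hm⟩ := hext.isSubbundle
  obtain ⟨UJ, hUJ, hyJ, ζ, hζ, hζJ⟩ := hm y
  have hp := hext.contMDiff
  let U := p ⁻¹' U' ∩ UJ
  have hU : IsOpen U := (hp.continuous.isOpen_preimage _ hU').inter hUJ
  have hUU' : U ⊆ p ⁻¹' U' := fun z hz => hz.1
  let pb : Form EM M 1 → Form EN N 1 := fun τ => pullbackForm (EN := EN) p τ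
  have hpb : ∀ {τ}, SmoothOn τ U' → SmoothOn (pb τ) U := fun h => (h.pullback hp hU').mono hUU'
  let θ' : Fin (m + s) → Form EN N 1 := Fin.append ζ (fun e => pb (θ e))
  let A' : Fin t → Fin q → Fin q → N → ℝ := fun i a b z => A i a b (p z)
  let B' : Fin u → Fin r → Fin r → N → ℝ := fun i a b z => B i a b (p z)
  have hθ' : ∀ e, SmoothOn (θ' e) U := by
    intro e
    refine Fin.addCases (fun i => ?_) (fun i => ?_) e
    · simp only [θ', Fin.append_left]
      exact (hζ i).mono fun z hz => hz.2
    · simp only [θ', Fin.append_right]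
      exact hpb (hθ i)
  have hA' : ∀ i a b, ContMDiffOn 𝓘(ℝ, EN) 𝓘(ℝ, ℝ) ∞ (A' i a b) U := fun i a b =>
    (hA i a b).comp hp.contMDiffOn hUU'
  have hB' : ∀ i a b, ContMDiffOn 𝓘(ℝ, EN) 𝓘(ℝ, ℝ) ∞ (B' i a b) U := fun i a b =>
    (hB i a b).comp hp.contMDiffOn hUU'
  -- the pullbacks of the generators
  have hgen' : ∀ k τ, DecompGen θ σh σc A B k τ →
      AlgIdeal U (DecompGen θ' (fun a => pb (σh a)) (fun a => pb (σc a)) A' B') k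
        (pullbackForm (EN := EN) p τ) := by
    intro k τ h
    cases h with
    | one e =>
      have := AlgIdeal.of (U := U) _ (DecompGen.one (θ := θ') (σh := fun a => pb (σh a))
        (σc := fun a => pb (σc a)) (A := A') (B := B') (Fin.natAdd m e))
      simpa only [θ', Fin.append_right] using this
    | hat i =>
      exact .congr _ _ (fun z _ => (pullbackForm_quadratic σh (A i) z).symm) (.of _ (.hat i))
    | check i =>
      exact .congr _ _ (fun z _ => (pullbackForm_quadratic σc (B i) z).symm) (.of _ (.check i))
  have hmemI : ∀ k τ, DecompGen θ σh σc A B k τ → ∀ x ∈ U', τ x ∈ I.bdl k x := fun k τ h =>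
    ((hgen k τ).2 (.of τ h)).2
  have hmemK : ∀ k τ, DecompGen θ' (fun a => pb (σh a)) (fun a => pb (σc a)) A' B' k τ →
      ∀ z ∈ U, τ z ∈ K.bdl k z := by
    intro k τ h z hz
    cases h with
    | one e =>
      refine Fin.addCases (fun i => ?_) (fun i => ?_) e
      · simp only [θ', Fin.append_left]
        refine hext.le_bdl z ?_
        rw [(hζJ z hz.2).2]
        exact Submodule.subset_span ⟨i, rfl⟩
      · simp only [θ', Fin.append_right]
        exact hext.transpose_mem_bdl z (hmemI 1 _ (.one i) _ hz.1)
    | hat i =>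
      have h1 := hext.transpose_mem_bdl z (hmemI 2 _ (.hat i) _ hz.1)
      rwa [show transpose (EN := EN) p 2 z _ = _ from
        pullbackForm_quadratic σh (A i) z] at h1
    | check i =>
      have h1 := hext.transpose_mem_bdl z (hmemI 2 _ (.check i) _ hz.1)
      rwa [show transpose (EN := EN) p 2 z _ = _ from
        pullbackForm_quadratic σc (B i) z] at h1
  obtain ⟨V, hVo, hyV, hVU, hVgen⟩ := exists_nhds_isSection_iff (K := K) hU ⟨hpy, hyJ⟩
    (DecompGen.smoothOn hU hθ' (fun a => hpb (hσh a)) (fun a => hpb (hσc a)) hA' hB') hmemK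
    (fun k κ hκ => hext.exists_algIdeal_value hU' hUU'
      (fun k τ h => (hgen k τ).1 h) hgen' (by
        intro κ hκ
        rw [(hζJ y hyJ).2] at hκ
        obtain ⟨c, hc⟩ := (Submodule.mem_span_range_iff_exists_fun ℝ).1 hκ
        refine ⟨fun z => ∑ i, c i • ζ i z, AlgIdeal.sum _ fun i _ =>
          .smul _ _ (contMDiffOn_const' (c i) U) ?_, hc⟩
        have := AlgIdeal.of (U := U) _ (DecompGen.one (θ := θ') (σh := fun a => pb (σh a))
          (σc := fun a => pb (σc a)) (A := A') (B := B') (Fin.castAdd s i))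
        simpa only [θ', Fin.append_left] using this) hκ)
  have happ : ∀ z, (fun e => θ' e z) =
      Fin.append (fun i => ζ i z) (fun e => transpose (EN := EN) p 1 z (θ e (p z))) := by
    intro z
    funext e
    refine Fin.addCases (fun i => ?_) (fun i => ?_) e
    · simp only [θ', Fin.append_left]
    · simp only [θ', Fin.append_right]
      rfl
  have hext' : ∀ z ∈ U, ∀ {n : ℕ} (σ : Fin n → Form EM M 1)
      (W : ∀ x : M, Submodule ℝ (Alt EM 1 x)),
      W (p z) = Submodule.span ℝ
        ((Set.range fun e => θ e (p z)) ∪ Set.range fun a => σ a (p z)) →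
      extend p J W z =
        Submodule.span ℝ ((Set.range fun e => θ' e z) ∪ Set.range fun a => pb (σ a) z) := by
    intro z hz n σ W hW
    rw [happ, range_append, extend, (hζJ z hz.2).2, pullbackBundle, hW, Submodule.map_span,
      ← Submodule.span_union, Set.image_union, ← Set.range_comp, ← Set.range_comp, Set.union_assoc]
    rfl
  refine ⟨V, hVo, hyV, m + s, t, u, θ', fun a => pb (σh a), fun a => pb (σc a), A', B', ht, hu,
    fun e => (hθ' e).mono hVU, fun a => (hpb (hσh a)).mono hVU, fun a => (hpb (hσc a)).mono hVU,
    fun i a b => (hA' i a b).mono hVU, fun i a b => (hB' i a b).mono hVU, ?_, hVgen, ?_⟩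
  · intro z hz
    have hzU := hVU hz
    have hc := hext.isCompl z
    rw [(hζJ z hzU.2).2] at hc
    have key := linearIndependent_span_append (f := transpose (EN := EN) p 1 z)
      (compContinuousLinearMapₗ_injective (E := EN) (E' := EM) (hext.surjective_mfderiv z))
      (hζJ z hzU.2).1 (hcof (p z) hzU.1).1 (hcof (p z) hzU.1).2 hc
    rw [happ]
    have e1 : (Sum.elim (fun a => pb (σh a) z) (fun a => pb (σc a) z)) =
        fun i => transpose (EN := EN) p 1 z
          (Sum.elim (fun a => σh a (p z)) (fun a => σc a (p z)) i) := by
      funext i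
      rcases i with i | i <;> rfl
    rw [e1]
    exact key
  · intro z hz
    exact ⟨hext' z (hVU hz) σh Vh (hV (p z) (hVU hz).1).1,
      hext' z (hVU hz) σc Vc (hV (p z) (hVU hz).1).2⟩

theorem IsIntegrableExtension.disjoint_pullbackBundle (hext : IsIntegrableExtension p K I J)
    (V : ∀ x : M, Submodule ℝ (Alt EM 1 x)) (y : N) : Disjoint (J y) (pullbackBundle p V y) :=
  (hext.isCompl y).disjoint.mono_right (LinearMap.map_le_range)

end Extension

/-! ### Vanishing of a decomposable system on mixed planes. -/

section Linear

/-- Identifies the intersection of the two singular systems with the Pfaffian part spanned by the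
`θ`. -/
theorem span_union_inf_span_union {V ι κ μ : Type*} [AddCommGroup V] [Module ℝ V] {θ : ι → V}
    {σ : κ → V} {τ : μ → V} (h : LinearIndependent ℝ (Sum.elim θ (Sum.elim σ τ))) :
    Submodule.span ℝ (Set.range θ ∪ Set.range σ) ⊓ Submodule.span ℝ (Set.range θ ∪ Set.range τ) =
      Submodule.span ℝ (Set.range θ) := by
  refine le_antisymm ?_ (le_inf (Submodule.span_mono Set.subset_union_left)
    (Submodule.span_mono Set.subset_union_left))
  have h1 : Disjoint (Submodule.span ℝ (Set.range (Sum.elim θ σ)))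
      (Submodule.span ℝ (Set.range τ)) := by
    have h2 : LinearIndependent ℝ (Sum.elim (Sum.elim θ σ) τ) := by
      have h3 := h.comp (Equiv.sumAssoc ι κ μ) (Equiv.injective _)
      convert h3 using 1
      ext ((i | i) | i) <;> rfl
    exact (linearIndependent_sum.1 h2).2.2
  rintro x ⟨hx1, hx2⟩
  rw [Submodule.span_union] at hx2
  obtain ⟨a, ha, b, hb, rfl⟩ := Submodule.mem_sup.1 hx2
  have hb' : b ∈ Submodule.span ℝ (Set.range (Sum.elim θ σ)) := by
    rw [Set.Sum.elim_range]
    have := Submodule.sub_mem _ hx1 (Submodule.span_mono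
      (Set.subset_union_left (t := Set.range σ)) ha)
    rwa [add_sub_cancel_left] at this
  rw [Submodule.disjoint_def.1 h1 b hb' hb, add_zero]
  exact ha

variable {W V : Type*} [AddCommGroup W] [Module ℝ W] [TopologicalSpace W]
  [AddCommGroup V] [Module ℝ V] [TopologicalSpace V]

/-- Both factors come from a line, which carries no nonzero 2-form. -/
theorem wedge_comp_functional_eq_zero (α β : ℝ [⋀^Fin 1]→L[ℝ] ℝ) (f : W →L[ℝ] ℝ) :
    wedge (α.compContinuousLinearMap f) (β.compContinuousLinearMap f) = 0 := by
  rw [← wedge_compContinuousLinearMap]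
  have : wedge α β = 0 := alt_eq_zero_of_finrank_lt (E := ℝ) (by simp) _
  rw [this]
  rfl

end Linear

section Manifold

variable {E : Type*} [NormedAddCommGroup E] [NormedSpace ℝ E] [FiniteDimensional ℝ E]
  {M : Type*} [TopologicalSpace M] [T2Space M] [ChartedSpace E M] [IsManifold 𝓘(ℝ, E) ∞ M]
  {k : ℕ}

theorem firstIntegrals_mono {W W' : ∀ x : M, Submodule ℝ (Alt E 1 x)} (h : ∀ x, W x ≤ W' x)
    (x : M) : firstIntegrals W x ≤ firstIntegrals W' x := by
  refine Submodule.span_mono ?_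
  rintro _ ⟨U, f, hU, hx, hf, hfW, rfl⟩
  exact ⟨U, f, hU, hx, hf, fun z hz => h z (hfW z hz), rfl⟩

theorem IsDecomposable.inf_le_bdl {K : ExteriorDiffSystem E M} {q r : ℕ}
    {Zh Zc : ∀ x : M, Submodule ℝ (Alt E 1 x)} (h : IsDecomposable K q r Zh Zc) (x : M) :
    Zh x ⊓ Zc x ≤ K.bdl 1 x := by
  obtain ⟨U, hU, hx, s, t, u, θ, σh, σc, A, B, -, -, -, -, -, -, -, hcof, hgen, hV⟩ := h.2.2 x
  rw [(hV x hx).1, (hV x hx).2, span_union_inf_span_union (hcof x hx).1, Submodule.span_le]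
  rintro _ ⟨e, rfl⟩
  exact ((hgen 1 _).2 (.of _ (.one e))).2 x hx

/-- The map from the plane spanned by two vectors. -/
noncomputable def planeMap (a b : E) : (ℝ × ℝ) →L[ℝ] E :=
  (ContinuousLinearMap.fst ℝ ℝ ℝ).smulRight a + (ContinuousLinearMap.snd ℝ ℝ ℝ).smulRight b

theorem oneForm_planeMap (η : E [⋀^Fin 1]→L[ℝ] ℝ) (a b : E) (v : Fin 1 → ℝ × ℝ) :
    η.compContinuousLinearMap (planeMap a b) v =
      (v 0).1 * η (fun _ => a) + (v 0).2 * η (fun _ => b) := by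
  have h1 : η.compContinuousLinearMap (planeMap a b) v =
      (oneForm E).symm η (planeMap a b (v 0)) := by
    rw [oneForm_symm_apply]
    change η _ = η _
    congr 1
    funext i
    rw [Subsingleton.elim i 0]
    rfl
  rw [h1, show planeMap a b (v 0) = (v 0).1 • a + (v 0).2 • b from rfl, map_add, map_smul,
    map_smul]
  rfl

/-- If both covectors kill the same spanning vector, their restrictions to the plane factor through
the other coordinate. -/
theorem wedge_planeMap_eq_zero {η ζ : E [⋀^Fin 1]→L[ℝ] ℝ} {a b : E}
    (h : (η (fun _ => a) = 0 ∧ ζ (fun _ => a) = 0) ∨ (η (fun _ => b) = 0 ∧ ζ (fun _ => b) = 0)) :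
    (wedge η ζ).compContinuousLinearMap (planeMap a b) = 0 := by
  rw [wedge_compContinuousLinearMap]
  rcases h with ⟨h1, h2⟩ | ⟨h1, h2⟩
  · have key : ∀ η : E [⋀^Fin 1]→L[ℝ] ℝ, η (fun _ => a) = 0 →
        η.compContinuousLinearMap (planeMap a b) =
          (oneForm ℝ (η (fun _ => b) • ContinuousLinearMap.id ℝ ℝ)).compContinuousLinearMap
            (ContinuousLinearMap.snd ℝ ℝ ℝ) := by
      intro η hη
      ext v
      rw [oneForm_planeMap, hη]
      simp [oneForm_apply, mul_comm]
    rw [key η h1, key ζ h2, wedge_comp_functional_eq_zero]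
  · have key : ∀ η : E [⋀^Fin 1]→L[ℝ] ℝ, η (fun _ => b) = 0 →
        η.compContinuousLinearMap (planeMap a b) =
          (oneForm ℝ (η (fun _ => a) • ContinuousLinearMap.id ℝ ℝ)).compContinuousLinearMap
            (ContinuousLinearMap.fst ℝ ℝ ℝ) := by
      intro η hη
      ext v
      rw [oneForm_planeMap, hη]
      simp [oneForm_apply, mul_comm]
    rw [key η h1, key ζ h2, wedge_comp_functional_eq_zero]

/-- The elements of a decomposable system vanish on the planes spanned by vectors in the
annihilators of the two singular systems. -/
theorem algIdeal_planeMap_eq_zero {s q r t u : ℕ} {θ : Fin s → Form E M 1} {σh : Fin q → Form E M 1}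
    {σc : Fin r → Form E M 1} {A : Fin t → Fin q → Fin q → M → ℝ}
    {B : Fin u → Fin r → Fin r → M → ℝ} {U : Set M} {z : M} (hz : z ∈ U)
    {a b : E}
    (hθ : ∀ e, (show E [⋀^Fin 1]→L[ℝ] ℝ from θ e z) (fun _ => a) = 0 ∧
      (show E [⋀^Fin 1]→L[ℝ] ℝ from θ e z) (fun _ => b) = 0)
    (hh : ∀ e, (show E [⋀^Fin 1]→L[ℝ] ℝ from σh e z) (fun _ => a) = 0)
    (hc : ∀ e, (show E [⋀^Fin 1]→L[ℝ] ℝ from σc e z) (fun _ => b) = 0)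
    {τ : Form E M k} (h : AlgIdeal U (DecompGen θ σh σc A B) k τ) :
    (show E [⋀^Fin k]→L[ℝ] ℝ from τ z).compContinuousLinearMap (planeMap a b) = 0 := by
  have quad : ∀ {n : ℕ} (σ : Fin n → E [⋀^Fin 1]→L[ℝ] ℝ) (A : Fin n → Fin n → ℝ),
      (∀ i j, (wedge (σ i) (σ j)).compContinuousLinearMap (planeMap a b) = 0) →
      (∑ i, ∑ j, A i j • wedge (σ i) (σ j)).compContinuousLinearMap (planeMap a b) = 0 := by
    intro n σ A h
    change ContinuousAlternatingMap.compContinuousLinearMapₗ (planeMap a b) _ = 0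
    rw [map_sum]
    refine Finset.sum_eq_zero fun i _ => ?_
    rw [map_sum]
    refine Finset.sum_eq_zero fun j _ => ?_
    rw [map_smul]
    exact (congrArg (A i j • ·) (h i j)).trans (smul_zero _)
  -- Pullback to the plane is defined in every degree and respects wedge products, which evaluation
  -- on a fixed pair of vectors is not; hence the induction over the ideal closes.
  induction h with
  | of τ h =>
    cases h with
    | one e =>
      ext v
      rw [oneForm_planeMap, (hθ e).1, (hθ e).2]
      simp
    | hat i =>
      exact quad (fun e => σh e z) (fun e f => A i e f z)
        (fun e f => wedge_planeMap_eq_zero (.inl ⟨hh e, hh f⟩))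
    | check i =>
      exact quad (fun e => σc e z) (fun e f => B i e f z)
        (fun e f => wedge_planeMap_eq_zero (.inr ⟨hc e, hc f⟩))
  | zero k => rfl
  | add τ η _ _ h1 h2 =>
    exact (congrArg₂ (· + ·) h1 h2).trans (add_zero _)
  | smul f τ hf _ h =>
    exact (congrArg (f z • ·) h).trans (smul_zero _)
  | wedge α τ hα _ h =>
    refine (wedge_compContinuousLinearMap (V := E) (α z) (τ z) (planeMap a b)).trans ?_
    exact (congrArg (fun η => wedge _ η) h).trans (wedge_zero _)
  | congr τ η he _ h =>
    rw [← he z hz]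
    exact h

end Manifold

/-! ### Transfer of first integrals and exterior derivatives to a chart. -/

section Manifold

variable {E : Type*} [NormedAddCommGroup E] [NormedSpace ℝ E] [FiniteDimensional ℝ E]
  {M : Type*} [TopologicalSpace M] [ChartedSpace E M] [IsManifold 𝓘(ℝ, E) ∞ M]
  {k : ℕ}

/-- The transpose of the differential of the chart at `x0`. -/
noncomputable def cotChart (x0 z : M) : (E →L[ℝ] ℝ) →ₗ[ℝ] Alt E 1 z :=
  (ContinuousAlternatingMap.compContinuousLinearMapₗ
    (mfderiv 𝓘(ℝ, E) 𝓘(ℝ, E) (chartAt E x0) z)).comp (oneForm E).toLinearMap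

theorem cotChart_apply (x0 z : M) (ℓ : E →L[ℝ] ℝ) (v : Fin 1 → TangentSpace 𝓘(ℝ, E) z) :
    cotChart x0 z ℓ v = ℓ (mfderiv 𝓘(ℝ, E) 𝓘(ℝ, E) (chartAt E x0) z (v 0)) := rfl

theorem cotChart_injective {x0 z : M} (hz : z ∈ (chartAt E x0).source) :
    Function.Injective (cotChart (E := E) x0 z) := by
  have hs := (mdifferentiable_chartAt (E := E) x0).mfderiv_surjective hz
  exact (compContinuousLinearMapₗ_injective (E := E) (E' := E) hs).comp (oneForm E).injective

/-- `cotChart` as an equivalence. -/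
noncomputable def cotEquiv {x0 z : M} (hz : z ∈ (chartAt E x0).source) :
    (E →L[ℝ] ℝ) ≃ₗ[ℝ] (E [⋀^Fin 1]→L[ℝ] ℝ) :=
  LinearEquiv.ofInjectiveOfFinrankEq (cotChart (E := E) x0 z) (cotChart_injective hz)
    (oneForm E).finrank_eq

theorem cotChart_surjective {x0 z : M} (hz : z ∈ (chartAt E x0).source) :
    Function.Surjective (cotChart (E := E) x0 z) := (cotEquiv hz).surjective

theorem differential_comp_chart {x0 z : M} (hz : z ∈ (chartAt E x0).source) {f : E → ℝ}
    (hf : DifferentiableAt ℝ f (chartAt E x0 z)) :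
    differential (fun y => f (chartAt E x0 y)) z =
      cotChart (E := E) x0 z (fderiv ℝ f (chartAt E x0 z)) := by
  have h1 := mfderiv_comp z (g := f) hf.mdifferentiableAt
    ((mdifferentiable_chartAt (E := E) x0).mdifferentiableAt hz)
  rw [mfderiv_eq_fderiv] at h1
  unfold differential
  rw [show (fun y => f (chartAt E x0 y)) = f ∘ chartAt E x0 from rfl, h1]
  rfl

theorem differential_congr {f g : M → ℝ} {z : M} (h : f =ᶠ[𝓝 z] g) :
    (differential f z : Alt E 1 z) = differential g z := by
  unfold differential
  rw [h.mfderiv_eq]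

/-- A family of subspaces of `T*M` in a chart. -/
noncomputable def chartFamily (Z : ∀ x : M, Submodule ℝ (Alt E 1 x)) (x0 : M) (u : E) :
    Submodule ℝ (E →L[ℝ] ℝ) :=
  (Z ((chartAt E x0).symm u)).comap (cotChart x0 ((chartAt E x0).symm u))

/-- Local first integrals correspond under composition with the chart and with its inverse, and
their differentials correspond under the transpose of the derivative of the chart. -/
theorem map_firstIntegralsVS_chartFamily (Z : ∀ x : M, Submodule ℝ (Alt E 1 x)) {x0 : M} {u : E}
    (hu : u ∈ (chartAt E x0).target) :
    (firstIntegralsVS (chartFamily Z x0) u).map (cotChart x0 ((chartAt E x0).symm u)) =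
      firstIntegrals Z ((chartAt E x0).symm u) := by
  have hzs := (chartAt E x0).map_target hu
  have hzu := (chartAt E x0).right_inv hu
  rw [firstIntegralsVS, Submodule.map_span, firstIntegrals]
  congr 1
  ext η
  constructor
  · rintro ⟨_, ⟨U, f, hU, huU, hf, hfZ, rfl⟩, rfl⟩
    have hd : ∀ w ∈ U, DifferentiableAt ℝ f w := fun w hw =>
      (hf.contDiffAt (hU.mem_nhds hw)).differentiableAt (by simp)
    refine ⟨(chartAt E x0).source ∩ chartAt E x0 ⁻¹' U, fun y => f (chartAt E x0 y),
      (chartAt E x0).isOpen_inter_preimage hU, ⟨hzs, by rwa [Set.mem_preimage, hzu]⟩, ?_, ?_, ?_⟩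
    · exact (contMDiffOn_iff_contDiffOn.2 hf).comp (contMDiffOn_chart.mono fun z hz => hz.1)
        fun z hz => hz.2
    · rintro z ⟨hz, hzU⟩
      rw [differential_comp_chart hz (hd _ hzU)]
      have h1 := hfZ _ hzU
      have h2 : ∀ z', z' = z → ∀ ℓ, cotChart (E := E) x0 z' ℓ ∈ Z z' → cotChart x0 z ℓ ∈ Z z := by
        rintro _ rfl ℓ h; exact h
      exact h2 _ ((chartAt E x0).left_inv hz) _ h1
    · rw [differential_comp_chart hzs (by rw [hzu]; exact hd u huU), hzu]
  · rintro ⟨U, f, hU, hzU, hf, hfZ, rfl⟩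
    have hΩ := (chartAt E x0).isOpen_inter_preimage_symm hU
    have hfc := contDiffOn_comp_chart_symm hf x0
    have key : ∀ w ∈ (chartAt E x0).target ∩ (chartAt E x0).symm ⁻¹' U,
        cotChart x0 ((chartAt E x0).symm w)
          (fderiv ℝ (fun u => f ((chartAt E x0).symm u)) w) =
          differential f ((chartAt E x0).symm w) := by
      intro w hw
      have hws := (chartAt E x0).map_target hw.1
      have hwr := (chartAt E x0).right_inv hw.1
      have h1 := differential_comp_chart hws (f := fun u => f ((chartAt E x0).symm u))
        (by rw [hwr]; exact (hfc.contDiffAt (hΩ.mem_nhds hw)).differentiableAt (by simp))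
      rw [hwr] at h1
      rw [← h1]
      refine differential_congr ?_
      filter_upwards [(chartAt E x0).open_source.mem_nhds hws] with y hy
      rw [(chartAt E x0).left_inv hy]
    refine ⟨fderiv ℝ (fun u => f ((chartAt E x0).symm u)) u, ⟨_, _, hΩ, ⟨hu, hzU⟩, hfc, ?_, rfl⟩,
      key u ⟨hu, hzU⟩⟩
    intro w hw
    rw [chartFamily, Submodule.mem_comap, key w hw]
    exact hfZ _ hw.2

theorem map_chartFamily (Z : ∀ x : M, Submodule ℝ (Alt E 1 x)) {x0 : M} {u : E}
    (hu : u ∈ (chartAt E x0).target) :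
    (chartFamily Z x0 u).map (cotChart x0 ((chartAt E x0).symm u)) = Z ((chartAt E x0).symm u) :=
  Submodule.map_comap_eq_of_surjective (cotChart_surjective ((chartAt E x0).map_target hu)) _

theorem finrank_map_cotChart {x0 z : M} (hz : z ∈ (chartAt E x0).source)
    (W : Submodule ℝ (E →L[ℝ] ℝ)) :
    Module.finrank ℝ (W.map (cotChart x0 z)) = Module.finrank ℝ W :=
  ((W.equivMapOfInjective _ (cotChart_injective hz)).finrank_eq).symm

/-- The exterior derivative may be computed in any chart. -/
theorem extDeriv_chartRep {τ : Form E M k} (hτ : SmoothOn τ Set.univ) {x0 : M} {u : E}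
    (hu : u ∈ (chartAt E x0).target) :
    extDeriv (chartRep τ x0) u = (extD τ ((chartAt E x0).symm u)).compContinuousLinearMap
      (mfderiv 𝓘(ℝ, E) 𝓘(ℝ, E) (chartAt E x0).symm u) := by
  set z := (chartAt E x0).symm u with hz
  have hzz := mem_chart_source E z
  have hzs := (chartAt E x0).map_target hu
  have hzu : chartAt E x0 z = u := (chartAt E x0).right_inv hu
  -- The value of `extD` at `z` uses the preferred chart at `z`, so `g` is the transition from the
  -- chart at `x0` to that one, and naturality of `extDeriv` under `g` compares the two.
  let g : E → E := chartMap (E := E) (E' := E) id x0 z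
  have hg : ContDiffAt ℝ ∞ g u := by
    rw [← hzu]
    exact contDiffAt_chartMap contMDiff_id.contMDiffAt hzs hzz
  have hopen : IsOpen ((chartAt E x0).target ∩ (chartAt E x0).symm ⁻¹' (chartAt E z).source) :=
    (chartAt E x0).isOpen_inter_preimage_symm (chartAt E z).open_source
  have h1 : chartRep τ x0 =ᶠ[𝓝 u] fun w =>
      (chartRep τ z (g w)).compContinuousLinearMap (fderiv ℝ g w) := by
    filter_upwards [hopen.mem_nhds ⟨hu, hzz⟩] with w hw
    have := chartRep_pullbackForm (E' := E) (N := M) (p := id) τ hw.1 mdifferentiableAt_id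
      (x0 := z) hw.2
    rwa [pullbackForm_id] at this
  have hgu : g u = chartAt E z z := rfl
  have h2 : DifferentiableAt ℝ (chartRep τ z) (g u) := by
    rw [hgu]
    exact ((smoothOn_iff isOpen_univ).1 hτ z trivial).differentiableAt (by simp)
  rw [h1.extDeriv_eq, extDeriv_pullback h2 hg minSmoothness_two_le]
  have h3 : fderiv ℝ g u = (mfderiv 𝓘(ℝ, E) 𝓘(ℝ, E) (chartAt E z) z).comp
      (mfderiv 𝓘(ℝ, E) 𝓘(ℝ, E) (chartAt E x0).symm u) := by
    rw [← mfderiv_eq_fderiv]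
    exact mfderiv_comp u ((mdifferentiable_chartAt (E := E) z).mdifferentiableAt hzz)
      ((mdifferentiable_chartAt (E := E) x0).mdifferentiableAt_symm hu)
  rw [h3, hgu]
  rfl

/-- Rewrites `dw(a, b) = 0` as the symmetry of the derivative of `w` on `(a, b)`, the form in which
closedness enters the commuting frame. -/
theorem extDeriv_oneForm_apply {w : E → E [⋀^Fin 1]→L[ℝ] ℝ} {u : E} (hw : DifferentiableAt ℝ w u)
    (a b : E) : extDeriv w u ![a, b] =
      fderiv ℝ (fun u => (oneForm E).symm (w u)) u a b -
        fderiv ℝ (fun u => (oneForm E).symm (w u)) u b a := by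
  let L : (E [⋀^Fin 1]→L[ℝ] ℝ) →L[ℝ] (E →L[ℝ] ℝ) :=
    LinearMap.toContinuousLinearMap (oneForm E).symm.toLinearMap
  have h1 : fderiv ℝ (fun u => (oneForm E).symm (w u)) u = L.comp (fderiv ℝ w u) :=
    (L.hasFDerivAt.comp u hw.hasFDerivAt).fderiv
  have h2 : ∀ c d : E, L (fderiv ℝ w u c) d = fderiv ℝ w u c (fun _ => d) := fun c d => rfl
  rw [extDeriv_apply hw, Fin.sum_univ_two, h1, ContinuousLinearMap.comp_apply,
    ContinuousLinearMap.comp_apply, h2, h2]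
  have h3 : (Fin.removeNth 0 ![a, b] : Fin 1 → E) = fun _ => b := by
    funext i; rw [Subsingleton.elim i 0]; rfl
  have h4 : (Fin.removeNth 1 ![a, b] : Fin 1 → E) = fun _ => a := by
    funext i; rw [Subsingleton.elim i 0]; rfl
  have h5 : ∀ c d : E, fderiv ℝ (fun x => w x (fun _ => d)) u c = fderiv ℝ w u c (fun _ => d) := by
    intro c d
    let T : (E [⋀^Fin 1]→L[ℝ] ℝ) →L[ℝ] ℝ := (ContinuousLinearMap.apply ℝ ℝ d).comp L
    have := (T.hasFDerivAt.comp u hw.hasFDerivAt).fderiv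
    exact congrArg (fun A : E →L[ℝ] ℝ => A c) this
  simp [h3, h4, h5, sub_eq_add_neg]

end Manifold

/-! ### Independence of the two families of first integrals. -/

section Manifold

variable {E : Type*} [NormedAddCommGroup E] [NormedSpace ℝ E] [FiniteDimensional ℝ E]
  {M : Type*} [TopologicalSpace M] [ChartedSpace E M] [IsManifold 𝓘(ℝ, E) ∞ M]

theorem cotChart_apply_symm {x0 : M} {u : E} (hu : u ∈ (chartAt E x0).target) (ℓ : E →L[ℝ] ℝ)
    (X : E) : (show E [⋀^Fin 1]→L[ℝ] ℝ from cotChart x0 ((chartAt E x0).symm u) ℓ)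
      (fun _ => mfderiv 𝓘(ℝ, E) 𝓘(ℝ, E) (chartAt E x0).symm u X) = ℓ X := by
  have h1 := (mdifferentiable_chartAt (E := E) x0).comp_symm_deriv hu
  refine (cotChart_apply x0 _ ℓ _).trans (congrArg ℓ ?_)
  exact congrArg (fun A : E →L[ℝ] E => A X) h1

theorem cotChart_oneForm_symm_chartRep (τ : Form E M 1) {x0 : M} {u : E}
    (hu : u ∈ (chartAt E x0).target) :
    cotChart x0 ((chartAt E x0).symm u) ((oneForm E).symm (chartRep τ x0 u)) =
      τ ((chartAt E x0).symm u) := by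
  rw [eq_chartRep_comp τ ((chartAt E x0).map_target hu), (chartAt E x0).right_inv hu]
  exact congrArg (fun η : E [⋀^Fin 1]→L[ℝ] ℝ => η.compContinuousLinearMap
    (mfderiv 𝓘(ℝ, E) 𝓘(ℝ, E) (chartAt E x0) ((chartAt E x0).symm u)))
    ((oneForm E).apply_symm_apply (chartRep τ x0 u))

theorem planeMap_pair {n : ℕ} (hn : n = 2) (η : E [⋀^Fin n]→L[ℝ] ℝ) {a b : E}
    (h : η.compContinuousLinearMap (planeMap a b) = 0) :
    η (fun i => ![a, b] (Fin.cast hn i)) = 0 := by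
  subst hn
  have h1 := congrArg (fun α : (ℝ × ℝ) [⋀^Fin 2]→L[ℝ] ℝ => α ![(1, 0), (0, 1)]) h
  refine Eq.trans ?_ h1
  change η _ = η _
  congr 1
  funext i
  fin_cases i <;> simp [planeMap]

variable [T2Space M]

/-- If there are no first integrals common to `V̂` and `V̌` inside the Pfaffian system of a
decomposable system, then there are none at all. -/
theorem IsDecomposable.firstIntegrals_inf_eq_bot {K : ExteriorDiffSystem E M} {q r : ℕ}
    {Zh Zc : ∀ x : M, Submodule ℝ (Alt E 1 x)} (hdec : IsDecomposable K q r Zh Zc)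
    (hh : HasConstantRank (firstIntegrals Zh)) (hc : HasConstantRank (firstIntegrals Zc))
    (hhc : HasConstantRank (fun x => firstIntegrals Zh x ⊓ firstIntegrals Zc x))
    (hsuph : ∀ x, Zh x ⊔ firstIntegrals Zc x = ⊤) (hsupc : ∀ x, Zc x ⊔ firstIntegrals Zh x = ⊤)
    (hK : ∀ x, firstIntegrals (K.bdl 1) x = ⊥) (x : M) :
    firstIntegrals Zh x ⊓ firstIntegrals Zc x = ⊥ := by
  by_contra hne
  obtain ⟨m, hm⟩ := hh
  obtain ⟨n, hn⟩ := hc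
  obtain ⟨d, hd⟩ := hhc
  obtain ⟨U, hU, hxU, s, t, l, θ, σh, σc, A, B, -, -, -, -, -, -, -, hcof, hgen, hV⟩ := hdec.2.2 x
  have hθK : ∀ e, IsSection (K.bdl 1) U (θ e) := fun e => (hgen 1 _).2 (.of _ (.one e))
  -- Closure under the exterior derivative is given for global sections only, so the local `θ` are
  -- first extended without change near `x`.
  choose τ hτ hτθ using fun e => (hθK e).exists_extension hU hxU
  obtain ⟨V, hVθ, hV0, hxV⟩ := eventually_nhds_iff.1
    ((Filter.eventually_all.2 hτθ).and (hU.eventually_mem hxU))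
  set φ := chartAt E x with hφ
  set u0 := φ x with hu0
  have hx0 : φ.symm u0 = x := φ.left_inv (mem_chart_source E x)
  let Ω : Set E := φ.target ∩ φ.symm ⁻¹' V
  have hΩ : IsOpen Ω := φ.isOpen_inter_preimage_symm hV0
  have hu0Ω : u0 ∈ Ω := ⟨mem_chart_target E x, by rwa [Set.mem_preimage, hx0]⟩
  let θ' : Fin s → E → E →L[ℝ] ℝ := fun e u => (oneForm E).symm (chartRep (τ e) x u)
  have hrep : ∀ e, ContDiffOn ℝ ∞ (chartRep (τ e) x) Ω := fun e =>
    ((hτ e).1 x).mono fun u hu => ⟨hu.1, trivial⟩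
  have hθ' : ∀ u ∈ Ω, ∀ e, cotChart x (φ.symm u) (θ' e u) = θ e (φ.symm u) := fun u hu e =>
    (cotChart_oneForm_symm_chartRep (τ e) hu.1).trans ((hVθ _ hu.2).1 e)
  have hinj : ∀ u ∈ Ω, Function.Injective (cotChart (E := E) x (φ.symm u)) := fun u hu =>
    cotChart_injective (φ.map_target hu.1)
  have hmapinj : ∀ u ∈ Ω, Function.Injective (Submodule.map (cotChart (E := E) x (φ.symm u))) :=
    fun u hu => Submodule.map_injective_of_injective (hinj u hu)
  have htop : ∀ u ∈ Ω, (⊤ : Submodule ℝ (E →L[ℝ] ℝ)).map (cotChart x (φ.symm u)) = ⊤ :=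
    fun u hu => by
      rw [Submodule.map_top]
      exact LinearMap.range_eq_top.2 (cotChart_surjective (φ.map_target hu.1))
  have hfh := fun u (hu : u ∈ Ω) => map_firstIntegralsVS_chartFamily Zh hu.1
  have hfc := fun u (hu : u ∈ Ω) => map_firstIntegralsVS_chartFamily Zc hu.1
  have hfin := fun u (hu : u ∈ Ω) (W : Submodule ℝ (E →L[ℝ] ℝ)) =>
    finrank_map_cotChart (E := E) (φ.map_target hu.1) W
  refine exists_common_integral (Zh := chartFamily Zh x) (Zc := chartFamily Zc x) hΩ hu0Ω
    (s := s) (m := m) (n := n) (r := d) (θ := θ') ?_ ?_ ?_ ?_ ?_ ?_ ?_ ?_ ?_ ?_ ?_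
  · intro e
    exact (LinearMap.toContinuousLinearMap (oneForm E).symm.toLinearMap).contDiff.comp_contDiffOn
      (hrep e)
  · refine LinearIndependent.of_comp (cotChart x (φ.symm u0)) ?_
    have h1 := (hcof _ (hVθ _ hu0Ω.2).2).1.comp _ Sum.inl_injective
    convert h1 using 1
    funext e
    exact hθ' u0 hu0Ω e
  · intro u hu
    apply hmapinj u hu
    rw [Submodule.map_inf _ (hinj u hu), map_chartFamily Zh hu.1, map_chartFamily Zc hu.1,
      (hV _ (hVθ _ hu.2).2).1, (hV _ (hVθ _ hu.2).2).2,
      span_union_inf_span_union (hcof _ (hVθ _ hu.2).2).1, Submodule.map_span, ← Set.range_comp]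
    congr 2
    funext e
    exact (hθ' u hu e).symm
  · intro u hu e X Y hX hY
    have hzU : φ.symm u ∈ U := (hVθ _ hu.2).2
    have hkill : ∀ (Z : ∀ x : M, Submodule ℝ (Alt E 1 x)) (X : E),
        (∀ ℓ ∈ chartFamily Z x u, ℓ X = 0) → ∀ η ∈ Z (φ.symm u),
          (show E [⋀^Fin 1]→L[ℝ] ℝ from η)
            (fun _ => mfderiv 𝓘(ℝ, E) 𝓘(ℝ, E) φ.symm u X) = 0 := by
      intro Z X hX η hη
      obtain ⟨ℓ, rfl⟩ := cotChart_surjective (E := E) (φ.map_target hu.1) η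
      exact (cotChart_apply_symm hu.1 ℓ X).trans (hX ℓ hη)
    have hkX := hkill Zh X hX
    have hkY := hkill Zc Y hY
    rw [(hV _ hzU).1] at hkX
    rw [(hV _ hzU).2] at hkY
    -- Only the value of `dτ` at one point matters. A global section `α` with this value is already
    -- known to be smooth, so the local generators apply to it directly.
    obtain ⟨α, hα, hαe⟩ := (K.isSubbundle 2).exists_section (K.extD_mem (τ e) (hτ e) (φ.symm u))
    have hαU := (hgen 2 α).1 ⟨hα.1.mono (Set.subset_univ U), fun y _ => hα.2 y trivial⟩
    have h0 := planeMap_pair rfl _ (algIdeal_planeMap_eq_zero hzU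
      (fun e => ⟨hkX _ (Submodule.subset_span (.inl ⟨e, rfl⟩)),
        hkY _ (Submodule.subset_span (.inl ⟨e, rfl⟩))⟩)
      (fun e => hkX _ (Submodule.subset_span (.inr ⟨e, rfl⟩)))
      (fun e => hkY _ (Submodule.subset_span (.inr ⟨e, rfl⟩))) hαU)
    have hdiff : DifferentiableAt ℝ (chartRep (τ e) x) u :=
      ((hrep e).contDiffAt (hΩ.mem_nhds hu)).differentiableAt (by simp)
    have h1 := extDeriv_oneForm_apply hdiff X Y
    rw [extDeriv_chartRep (hτ e).1 hu.1, ← hαe] at h1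
    refine sub_eq_zero.1 (h1.symm.trans (Eq.trans ?_ h0))
    change α (φ.symm u) _ = α (φ.symm u) _
    congr 1
    funext i
    fin_cases i <;> rfl
  · apply hmapinj u0 hu0Ω
    rw [Submodule.map_sup, map_chartFamily Zh hu0Ω.1, hfc u0 hu0Ω, htop u0 hu0Ω, hsuph]
  · apply hmapinj u0 hu0Ω
    rw [Submodule.map_sup, map_chartFamily Zc hu0Ω.1, hfh u0 hu0Ω, htop u0 hu0Ω, hsupc]
  · intro u hu
    rw [← hfin u hu, hfh u hu, hm]
  · intro u hu
    rw [← hfin u hu, hfc u hu, hn]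
  · intro u hu
    rw [← hfin u hu, Submodule.map_inf _ (hinj u hu), hfh u hu, hfc u hu]
    exact hd _
  · intro h
    apply hne
    have h1 := congrArg (Submodule.map (cotChart (E := E) x (φ.symm u0))) h
    rw [Submodule.map_inf _ (hinj u0 hu0Ω), hfh u0 hu0Ω, hfc u0 hu0Ω, Submodule.map_bot] at h1
    have h2 : ∀ x', x' = x → firstIntegrals Zh x' ⊓ firstIntegrals Zc x' = ⊥ →
      firstIntegrals Zh x ⊓ firstIntegrals Zc x = ⊥ := by
      rintro _ rfl h; exact h
    exact h2 _ hx0 h1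
  · apply hmapinj u0 hu0Ω
    rw [Submodule.map_bot]
    -- Here the hypothesis on `K` is used: `Zh ∩ Zc` lies in the degree one part of `K`, so it has
    -- no nonzero first integrals.
    refine (map_firstIntegralsVS_chartFamily (fun z => Zh z ⊓ Zc z) hu0Ω.1).trans ?_
    rw [eq_bot_iff, ← hK]
    exact firstIntegrals_mono (fun z => hdec.inf_le_bdl z) _

end Manifold

/-! ### Part (ii): pullback of first integrals and the spanning conditions. -/

section Extension

variable {EM : Type*} [NormedAddCommGroup EM] [NormedSpace ℝ EM] [FiniteDimensional ℝ EM]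
  {M : Type*} [TopologicalSpace M] [T2Space M] [ChartedSpace EM M] [IsManifold 𝓘(ℝ, EM) ∞ M]
  {EN : Type*} [NormedAddCommGroup EN] [NormedSpace ℝ EN] [FiniteDimensional ℝ EN]
  {N : Type*} [TopologicalSpace N] [T2Space N] [ChartedSpace EN N] [IsManifold 𝓘(ℝ, EN) ∞ N]
  {I : ExteriorDiffSystem EM M} {K : ExteriorDiffSystem EN N} {p : N → M}
  {J : ∀ y : N, Submodule ℝ (Alt EN 1 y)}

theorem differential_comp {f : M → ℝ} {y : N} (hp : MDifferentiableAt 𝓘(ℝ, EN) 𝓘(ℝ, EM) p y)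
    (hf : MDifferentiableAt 𝓘(ℝ, EM) 𝓘(ℝ, ℝ) f (p y)) :
    (differential (fun z => f (p z)) y : Alt EN 1 y) =
      transpose (EM := EM) (EN := EN) p 1 y (differential f (p y)) := by
  unfold differential
  rw [show (fun z => f (p z)) = f ∘ p from rfl, mfderiv_comp y hf hp]
  rfl

/-- First integrals pull back to first integrals. -/
theorem map_firstIntegrals_le (hp : ContMDiff 𝓘(ℝ, EN) 𝓘(ℝ, EM) ∞ p)
    (V : ∀ x : M, Submodule ℝ (Alt EM 1 x)) (y : N) :
    (firstIntegrals V (p y)).map (transpose (EN := EN) p 1 y) ≤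
      firstIntegrals (pullbackBundle (EN := EN) p V) y := by
  rw [firstIntegrals, Submodule.map_span, Submodule.span_le]
  rintro _ ⟨_, ⟨U, f, hU, hyU, hf, hfV, rfl⟩, rfl⟩
  have key : ∀ z ∈ p ⁻¹' U, differential (fun z => f (p z)) z =
      transpose (EN := EN) p 1 z (differential f (p z)) := fun z hz =>
    differential_comp ((hp z).mdifferentiableAt (by simp))
      ((hf.contMDiffAt (hU.mem_nhds hz)).mdifferentiableAt (by simp))
  refine Submodule.subset_span ⟨p ⁻¹' U, fun z => f (p z), hU.preimage hp.continuous, hyU,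
    hf.comp hp.contMDiffOn fun z hz => hz, fun z hz => ?_, (key y hyU).symm⟩
  rw [key z hz]
  exact Submodule.mem_map_of_mem (hfV _ hz)

/-- The left side contains `J + p^*V + p^*(W^∞) = J + p^*(T*M)`, which is all of `T*N`. -/
theorem IsIntegrableExtension.extend_sup_firstIntegrals (hext : IsIntegrableExtension p K I J)
    {V W : ∀ x : M, Submodule ℝ (Alt EM 1 x)} (h : ∀ x, V x ⊔ firstIntegrals W x = ⊤) (y : N) :
    extend p J V y ⊔ firstIntegrals (extend p J W) y = ⊤ := by
  rw [eq_top_iff, ← (hext.isCompl y).sup_eq_top, ← Submodule.map_top, ← h (p y), Submodule.map_sup]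
  refine sup_le (le_sup_of_le_left le_sup_left)
    (sup_le (le_sup_of_le_left le_sup_right) (le_sup_of_le_right ?_))
  exact (map_firstIntegrals_le hext.contMDiff W y).trans
    (firstIntegrals_mono (fun z => le_sup_right) y)

end Extension

end EDS

theorem mainTheorem6
    {EM : Type*} [NormedAddCommGroup EM] [NormedSpace ℝ EM] [FiniteDimensional ℝ EM]
    {M : Type*} [TopologicalSpace M] [T2Space M] [SecondCountableTopology M]
    [ChartedSpace EM M] [IsManifold 𝓘(ℝ, EM) ∞ M]
    {EN : Type*} [NormedAddCommGroup EN] [NormedSpace ℝ EN] [FiniteDimensional ℝ EN]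
    {N : Type*} [TopologicalSpace N] [T2Space N] [SecondCountableTopology N]
    [ChartedSpace EN N] [IsManifold 𝓘(ℝ, EN) ∞ N]
    (I : EDS.ExteriorDiffSystem EM M) (K : EDS.ExteriorDiffSystem EN N) (p : N → M)
    (J : ∀ y : N, Submodule ℝ (EDS.Alt EN 1 y))
    (hext : EDS.IsIntegrableExtension p K I J) :
    -- Part (i)
    (∀ (q r : ℕ) (Vh Vc : ∀ x : M, Submodule ℝ (EDS.Alt EM 1 x)),
      EDS.IsDecomposable I q r Vh Vc →
        EDS.IsDecomposable K q r (EDS.extend p J Vh) (EDS.extend p J Vc) ∧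
        ∀ y, Disjoint (J y) (EDS.pullbackBundle p Vh y) ∧
          Disjoint (J y) (EDS.pullbackBundle p Vc y)) ∧
    -- Part (ii)
    (∀ (q r : ℕ) (Vh Vc : ∀ x : M, Submodule ℝ (EDS.Alt EM 1 x)),
      EDS.IsDarbouxIntegrable I q r Vh Vc →
      (∀ y, EDS.firstIntegrals (K.bdl 1) y = ⊥) →
      EDS.HasConstantRank (EDS.firstIntegrals (EDS.extend p J Vh)) →
      EDS.HasConstantRank (EDS.firstIntegrals (EDS.extend p J Vc)) →
      EDS.HasConstantRank (fun y => EDS.firstIntegrals (EDS.extend p J Vh) y ⊓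
        EDS.firstIntegrals (EDS.extend p J Vc) y) →
        EDS.IsDarbouxIntegrable K q r (EDS.extend p J Vh) (EDS.extend p J Vc)) := by
  refine ⟨fun q r Vh Vc hI => ⟨hext.isDecomposable hI, fun y =>
    ⟨hext.disjoint_pullbackBundle Vh y, hext.disjoint_pullbackBundle Vc y⟩⟩,
    fun q r Vh Vc hI hK hh hc hhc => ?_⟩
  have hdec := hext.isDecomposable hI.decomposable
  have hsuph := hext.extend_sup_firstIntegrals hI.hat_sup
  have hsupc := hext.extend_sup_firstIntegrals hI.check_sup
  -- Only the last clause uses the absence of first integrals of `E^1` and the constant rank of the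
  -- intersection.
  exact ⟨hdec, hh, hc, hsuph, hsupc,
    hdec.firstIntegrals_inf_eq_bot hh hc hhc hsuph hsupc hK⟩
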